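/- Let $X$ be a connected compact complex manifold of complex dimension $n\ge 1$, let $\pi:\widetilde X\to X$ be its universal cover, and let $\omega$ be an SKT hyperbolic metric on $X$; that is, $\omega$ is a $C^\infty$ positive definite real $(1,1)$-form with $\partial\bar\partial\omega=0$ such that, with $\widetilde\omega:=\pi^\star\omega$, one has $\widetilde\omega=\partial\alpha+\bar\partial\beta$ on $\widetilde X$ for some $C^\infty$ complex-valued $1$-forms $\alpha,\beta$ on $\widetilde X$ that are bounded with respect to $\widetilde\omega$. Let $p,q\ge 0$ be integers with $p+q=n-1$, and let $\varphi$ be a form of bidegree $(p,q)$ on $\widetilde X$ with measurable coefficients which is $L^2$ with respect to $\widetilde\omega$, i.e. $\int_{\widetilde X}|\varphi|^2_{\widetilde\omega}\,dV_{\widetilde\omega}<\infty$, and which is $\widetilde\omega$-primitive, i.e. $\widetilde\omega^{2}\wedge\varphi=0$ (almost everywhere). If $\partial\varphi=0$ and $\bar\partial\varphi=0$ in the sense of distributions, then $\varphi=0$ almost everywhere. -/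

import Mathlib

open scoped Manifold ContDiff ComplexConjugate
open MeasureTheory

noncomputable section

namespace SKT

/-! ### Linear algebra of complex-valued real-alternating forms -/

section LinearAlgebra

/-- The model space `ℂⁿ` with its Euclidean norm. -/
abbrev Cn (n : ℕ) : Type := EuclideanSpace ℂ (Fin n)

/-- The wedge product of complex-valued alternating forms on a real vector space, normalised so that
`(a ∧ b)(v₁, …, v_{j+k}) = ∑_σ sign(σ) a(v_{σ 1}, …, v_{σ j}) b(v_{σ (j+1)}, …, v_{σ (j+k)})`,
the sum being over `(j, k)`-shuffles. -/
def wedge {V : Type*} [AddCommGroup V] [Module ℝ V] {j k : ℕ}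
    (a : V [⋀^Fin j]→ₗ[ℝ] ℂ) (b : V [⋀^Fin k]→ₗ[ℝ] ℂ) : V [⋀^Fin (j + k)]→ₗ[ℝ] ℂ :=
  ((LinearMap.mul' ℝ ℂ).compAlternatingMap (a.domCoprod b)).domDomCongr finSumFinEquiv

/-- `φ ∧ Ω^m`, which equals `Ω^m ∧ φ` since the 2-form `Ω` has even degree. -/
def wedgePow {V : Type*} [AddCommGroup V] [Module ℝ V] {k : ℕ}
    (Ω : V [⋀^Fin 2]→ₗ[ℝ] ℂ) (φ : V [⋀^Fin k]→ₗ[ℝ] ℂ) : (m : ℕ) → V [⋀^Fin (k + 2 * m)]→ₗ[ℝ] ℂ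
  | 0 => φ
  | m + 1 => wedge (j := k + 2 * m) (k := 2) (wedgePow Ω φ m) Ω

/-- A `k`-form (`k ≤ n`) on a complex vector space of complex dimension `n` is `Ω`-primitive if
`Ω^{n-k+1} ∧ φ = 0`. -/
def IsPrimitive (n : ℕ) {V : Type*} [AddCommGroup V] [Module ℝ V] {k : ℕ}
    (Ω : V [⋀^Fin 2]→ₗ[ℝ] ℂ) (φ : V [⋀^Fin k]→ₗ[ℝ] ℂ) : Prop :=
  wedgePow Ω φ (n - k + 1) = 0

/-- A complex-valued form has bidegree `(p, q)` if `λ ∈ ℂ` acts on it by `λ^p λ̄^q`. (A sum of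
forms `dz_I ∧ dz̄_J` with `|I| = r`, `|J| = s`, `r + s = k`, is multiplied by `λ^r λ̄^s`; so this
says that only the component with `(r, s) = (p, q)` is present.) -/
def IsBidegree {V : Type*} [AddCommGroup V] [Module ℂ V] {k : ℕ} (p q : ℕ)
    (φ : V [⋀^Fin k]→ₗ[ℝ] ℂ) : Prop :=
  ∀ (c : ℂ) (v : Fin k → V), φ (fun i => c • v i) = c ^ p * conj c ^ q * φ v

/-- The real bilinear form `g(v, w) = Ω(v, i w)` attached to a real `(1,1)`-form `Ω`. -/
def riem {n : ℕ} (Ω : Cn n [⋀^Fin 2]→L[ℝ] ℂ) (v w : Cn n) : ℝ :=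
  (Ω ![v, Complex.I • w]).re

/-- The standard real basis `e₁, i e₁, …, e_n, i e_n` of `ℂⁿ`. -/
def stdFrame (n : ℕ) (a : Fin n × Fin 2) : Cn n :=
  EuclideanSpace.single a.1 (if a.2 = 0 then 1 else Complex.I)

/-- The Gram matrix of `g` in the standard real basis. -/
def gram {n : ℕ} (Ω : Cn n [⋀^Fin 2]→L[ℝ] ℂ) : Matrix (Fin n × Fin 2) (Fin n × Fin 2) ℝ :=
  Matrix.of fun a b => riem Ω (stdFrame n a) (stdFrame n b)

/-- The pointwise squared norm of a complex-valued `k`-form with respect to `g`: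
`|φ|² = (1/k!) ∑ g^{a₁ b₁} ⋯ g^{a_k b_k} φ_{a₁ … a_k} conj φ_{b₁ … b_k}`, where `(g^{ab})` is the
inverse of the Gram matrix. It is the sum of the `|φ(v_{i₁}, …, v_{i_k})|²`, `i₁ < ⋯ < i_k`, for any
`g`-orthonormal basis `(v_i)`. -/
def normSq {n k : ℕ} (Ω : Cn n [⋀^Fin 2]→L[ℝ] ℂ) (φ : Cn n [⋀^Fin k]→L[ℝ] ℂ) : ℝ :=
  ((k.factorial : ℝ))⁻¹ *
    ∑ a : Fin k → Fin n × Fin 2, ∑ b : Fin k → Fin n × Fin 2,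
      (∏ l, (gram Ω)⁻¹ (a l) (b l)) *
        (φ (fun l => stdFrame n (a l)) * conj (φ (fun l => stdFrame n (b l)))).re

end LinearAlgebra

/-! ### The operators `∂` and `∂̄` in `ℂⁿ` -/

section Flat

variable {n k : ℕ}

/-- Multiplication by `i`, as a real linear map. -/
def mulI (n : ℕ) : Cn n →L[ℝ] Cn n :=
  (Complex.I • ContinuousLinearMap.id ℂ (Cn n)).restrictScalars ℝ

/-- The complex linear part of a real linear map into a complex space. -/
def part10 (A : Cn n →L[ℝ] (Cn n [⋀^Fin k]→L[ℝ] ℂ)) : Cn n →L[ℝ] (Cn n [⋀^Fin k]→L[ℝ] ℂ) :=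
  (1 / 2 : ℂ) • (A - Complex.I • A.comp (mulI n))

/-- The complex antilinear part of a real linear map into a complex space. -/
def part01 (A : Cn n →L[ℝ] (Cn n [⋀^Fin k]→L[ℝ] ℂ)) : Cn n →L[ℝ] (Cn n [⋀^Fin k]→L[ℝ] ℂ) :=
  (1 / 2 : ℂ) • (A + Complex.I • A.comp (mulI n))

/-- `∂φ = ∑_j dz_j ∧ ∂φ/∂z_j` for a form on an open set of `ℂⁿ`. The exterior derivative `dφ` is the
alternatization of the derivative of `φ` (this is `extDeriv`); here only the complex linear
part of the derivative is kept. -/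
def flatDel (φ : Cn n → Cn n [⋀^Fin k]→L[ℝ] ℂ) (z : Cn n) : Cn n [⋀^Fin (k + 1)]→L[ℝ] ℂ :=
  .alternatizeUncurryFin (part10 (fderiv ℝ φ z))

/-- `∂̄φ = ∑_j dz̄_j ∧ ∂φ/∂z̄_j` for a form on an open set of `ℂⁿ`. -/
def flatDelbar (φ : Cn n → Cn n [⋀^Fin k]→L[ℝ] ℂ) (z : Cn n) : Cn n [⋀^Fin (k + 1)]→L[ℝ] ℂ :=
  .alternatizeUncurryFin (part01 (fderiv ℝ φ z))

/-- `d = ∂ + ∂̄`. -/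
theorem flatDel_add_flatDelbar (φ : Cn n → Cn n [⋀^Fin k]→L[ℝ] ℂ) (z : Cn n) :
    flatDel φ z + flatDelbar φ z = extDeriv φ z := by
  rw [flatDel, flatDelbar, extDeriv, ← ContinuousAlternatingMap.alternatizeUncurryFin_add]
  congr 1
  ext v w
  simp [part10, part01]
  ring

/-- `(∂χ ∧ φ)(z)` for a function `χ` and a form `φ` on `ℂⁿ`. -/
def delWedge (χ : Cn n → ℝ) (φ : Cn n → Cn n [⋀^Fin k]→L[ℝ] ℂ) (z : Cn n) :
    Cn n [⋀^Fin (k + 1)]→L[ℝ] ℂ :=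
  .alternatizeUncurryFin (part10 ((fderiv ℝ χ z).smulRight (φ z)))

/-- `(∂̄χ ∧ φ)(z)` for a function `χ` and a form `φ` on `ℂⁿ`. -/
def delbarWedge (χ : Cn n → ℝ) (φ : Cn n → Cn n [⋀^Fin k]→L[ℝ] ℂ) (z : Cn n) :
    Cn n [⋀^Fin (k + 1)]→L[ℝ] ℂ :=
  .alternatizeUncurryFin (part01 ((fderiv ℝ χ z).smulRight (φ z)))

end Flat

/-! ### Forms on complex manifolds -/

section Manifold

variable {n : ℕ} {M : Type*} [TopologicalSpace M] [ChartedSpace (Cn n) M]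

/-- Complex-valued (not necessarily continuous) differential `k`-forms on a complex manifold modelled
on `ℂⁿ`. (In Mathlib, the tangent space at `x` is a copy of the model space `ℂⁿ`, identified through
the preferred chart at `x`.) -/
abbrev Form (n : ℕ) (M : Type*) [TopologicalSpace M] [ChartedSpace (Cn n) M] (k : ℕ) : Type _ :=
  (x : M) → TangentSpace 𝓘(ℂ, Cn n) x [⋀^Fin k]→L[ℝ] ℂ

variable {k : ℕ}

/-- The pull-back `f^*φ` of a form by a holomorphic map. -/
def pullback {N : Type*} [TopologicalSpace N] [ChartedSpace (Cn n) N] (f : N → M)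
    (φ : Form n M k) : Form n N k := fun x =>
  (φ (f x)).compContinuousLinearMap
    ((mfderiv 𝓘(ℂ, Cn n) 𝓘(ℂ, Cn n) f x).restrictScalars ℝ)

/-- The expression of a form in the chart `e`: the form `(e⁻¹)^*φ` on the open set `e.target ⊆ ℂⁿ`
(its values outside `e.target` are irrelevant). -/
def inChart (e : OpenPartialHomeomorph M (Cn n)) (φ : Form n M k) (z : Cn n) :
    Cn n [⋀^Fin k]→L[ℝ] ℂ :=
  (φ (e.symm z)).compContinuousLinearMap
    ((mfderiv 𝓘(ℂ, Cn n) 𝓘(ℂ, Cn n) e.symm z).restrictScalars ℝ)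

/-- `C^∞` forms. -/
def IsSmooth (φ : Form n M k) : Prop :=
  ∀ e ∈ atlas (Cn n) M, ContDiffOn ℝ ∞ (inChart e φ) e.target

/-- `∂φ`, computed at each point in the preferred chart there. -/
def del (φ : Form n M k) : Form n M (k + 1) := fun x =>
  (flatDel (inChart (chartAt (Cn n) x) φ) (chartAt (Cn n) x x)).compContinuousLinearMap
    ((mfderiv 𝓘(ℂ, Cn n) 𝓘(ℂ, Cn n) (chartAt (Cn n) x) x).restrictScalars ℝ)

/-- `∂̄φ`, computed at each point in the preferred chart there. -/
def delbar (φ : Form n M k) : Form n M (k + 1) := fun x =>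
  (flatDelbar (inChart (chartAt (Cn n) x) φ) (chartAt (Cn n) x x)).compContinuousLinearMap
    ((mfderiv 𝓘(ℂ, Cn n) 𝓘(ℂ, Cn n) (chartAt (Cn n) x) x).restrictScalars ℝ)

/-- A Hermitian metric, given as a `C^∞` positive definite real `(1,1)`-form. -/
structure IsHermitianMetric (Ω : Form n M 2) : Prop where
  smooth : IsSmooth Ω
  real : ∀ x v, (Ω x v).im = 0
  bidegree : ∀ x, IsBidegree 1 1 (Ω x).toAlternatingMap
  pos : ∀ x (v : TangentSpace 𝓘(ℂ, Cn n) x), v ≠ 0 → 0 < (Ω x ![v, Complex.I • v]).re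

/-- An SKT (pluriclosed) metric: a Hermitian metric with `∂∂̄Ω = 0`. -/
structure IsSKTMetric (Ω : Form n M 2) : Prop extends IsHermitianMetric Ω where
  pluriclosed : ∀ x, del (delbar Ω) x = 0

/-- A form is bounded with respect to the metric `Ω`. -/
def IsBounded (Ω : Form n M 2) (α : Form n M k) : Prop :=
  ∃ C : ℝ, ∀ x, normSq (n := n) (Ω x) (α x) ≤ C

/-- `π : N → M` is a universal covering of complex manifolds: a covering map which is a local
biholomorphism, with simply connected total space. -/
structure IsUniversalCover {N : Type*} [TopologicalSpace N] [ChartedSpace (Cn n) N]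
    (π : N → M) : Prop where
  isCoveringMap : IsCoveringMap π
  isLocalBiholomorphism : IsLocalDiffeomorph 𝓘(ℂ, Cn n) 𝓘(ℂ, Cn n) ω π
  simplyConnected : SimplyConnectedSpace N

/-- A form `φ` of degree `k + 1` on `M` is `(∂ + ∂̄)~`-bounded with respect to the metric `Ω` if on
the universal cover `π^*φ = ∂α + ∂̄β` with `C^∞` forms `α`, `β` bounded with respect to `π^*Ω`. -/
def IsTildeBounded {N : Type*} [TopologicalSpace N] [ChartedSpace (Cn n) N] (π : N → M)
    (Ω : Form n M 2) (φ : Form n M (k + 1)) : Prop :=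
  ∃ α β : Form n N k, IsSmooth α ∧ IsSmooth β ∧
    IsBounded (pullback π Ω) α ∧ IsBounded (pullback π Ω) β ∧
    ∀ x, pullback π φ x = del α x + delbar β x

/-- An SKT hyperbolic metric: an SKT metric which, as a form, is `(∂ + ∂̄)~`-bounded with respect to
itself. Here `π` is the universal cover. -/
structure IsSKTHyperbolicMetric {N : Type*} [TopologicalSpace N] [ChartedSpace (Cn n) N] (π : N → M)
    (Ω : Form n M 2) : Prop extends IsSKTMetric Ω where
  tildeBounded : IsTildeBounded (k := 1) π Ω Ω

/-! ### The volume measure and `L²` forms -/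

variable [MeasurableSpace M]

/-- The Riemannian volume measure of the part of the manifold covered by the chart `e`: the image
of the measure `√(det g) dλ` on `e.target`, with `λ` the Lebesgue measure of `ℂⁿ`. -/
def chartVolume (Ω : Form n M 2) (e : OpenPartialHomeomorph M (Cn n)) : Measure M :=
  (((volume : Measure (Cn n)).restrict e.target).withDensity
    fun z => ENNReal.ofReal (Real.sqrt (gram (inChart e Ω z)).det)).map e.symm

/-- The Riemannian volume measure `dV_Ω = Ω^n / n!` of a Hermitian metric. The measures of the
charts agree on the overlaps, and the volume measure is obtained by gluing them; on a second
countable manifold this is their supremum in the lattice of measures. -/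
def vol (Ω : Form n M 2) : Measure M :=
  ⨆ e ∈ atlas (Cn n) M, chartVolume Ω e

/-- An `L²` form: measurable coefficients and `∫ |φ|² dV < ∞`. -/
structure IsL2 (Ω : Form n M 2) (φ : Form n M k) : Prop where
  measurable : ∀ e ∈ atlas (Cn n) M,
    AEStronglyMeasurable (inChart e φ) ((volume : Measure (Cn n)).restrict e.target)
  finite : ∫⁻ x, ENNReal.ofReal (normSq (n := n) (Ω x) (φ x)) ∂(vol Ω) < ⊤

/-- `∂φ = 0` in the sense of distributions, for a form `φ` with locally integrable coefficients: in
each chart, `∫ ∂χ ∧ φ = 0` (coefficientwise) for all real test functions `χ`. -/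
def WeakDelZero (φ : Form n M k) : Prop :=
  ∀ e ∈ atlas (Cn n) M, ∀ χ : Cn n → ℝ, ContDiff ℝ ∞ χ → HasCompactSupport χ →
    tsupport χ ⊆ e.target → ∫ z in e.target, delWedge χ (inChart e φ) z = 0

/-- `∂̄φ = 0` in the sense of distributions, for a form `φ` with locally integrable coefficients. -/
def WeakDelbarZero (φ : Form n M k) : Prop :=
  ∀ e ∈ atlas (Cn n) M, ∀ χ : Cn n → ℝ, ContDiff ℝ ∞ χ → HasCompactSupport χ →
    tsupport χ ⊆ e.target → ∫ z in e.target, delbarWedge χ (inChart e φ) z = 0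

end Manifold

end SKT

end

open scoped Manifold ContDiff ComplexConjugate
open MeasureTheory

noncomputable section

namespace SKT

/-! Write `ω̃` for the pulled-back metric. Everything rests on the top-degree form `φ ∧ φ̄ ∧ ω̃`.
For a primitive form of bidegree `(p, q)` with `p + q = n - 1`, the Hodge–Riemann relation says that
this form is a nonzero constant depending only on `p` and `q`, times a nonnegative multiple of the
volume form that vanishes only where `φ` does (`IsPositive.hodge_riemann`). So it suffices that its
integral over the cover is zero (`integral_formDensity_self_eq_zero`).

Since `φ` and `φ̄` are both `∂`- and `∂̄`-closed and `ω̃ = ∂α + ∂̄β`, the form is formally exact.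
For a compactly supported cut-off `χ`, Stokes gives `∫ χ φ ∧ φ̄ ∧ ω̃ = -∫ φ ∧ φ̄ ∧ (∂χ ∧ α + ∂̄χ ∧
β)` (`integral_smul_formDensity_of_hasCompactSupport`). Two things need care: `φ` is only `L²` and
weakly closed, and the cover need not be compact.

Regularity is handled by `integral_trilinear_eq_zero`. One of the two copies of `φ` is translated by
`h` and the resulting pairing is averaged against a bump in `h`. The average is a double integral in
which the weak equation can be used in each variable separately, and it vanishes. The pairing is
continuous at `h = 0` because translation is continuous in `L²`, so its value at `0` vanishes as
well.

Noncompactness is handled without an exhaustion of the cover. Let `f` be a smooth function on the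
compact base supported in an evenly covered open set. Then `f ∘ π` splits into one cut-off per
sheet, each of compact support, and the Stokes identities can be summed over the countably many
sheets: `|φ|²` is integrable, `α` and `β` are bounded, and the gradient of `f ∘ π` is bounded
because it comes from the base (`integral_comp_smul_formDensity`). Applying this to a partition of
unity `ρ_i` on the image of `π`, the left sides add up to the whole integral, and the right sides
add up to zero because `∑ d(ρ_i ∘ π) = d1 = 0`.

The Hodge–Riemann relation is proved by direct computation in the exterior algebra. In a unitary
frame the metric is `∑ dx_j ∧ dy_j`, and forms are expanded in monomials made of factors `dz_j`,
`dz̄_j`, `dx_j ∧ dy_j`. Wedging with `exp ω = ∏ (1 + dx_j ∧ dy_j)` makes top coefficients factor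
over the coordinates. For a fixed odd part, primitivity and a degree count say that the sums of the
coefficients `c M` over the sets `M` disjoint from a small set `R` vanish. Inclusion-exclusion
(`sum_disjoint_eq_sign_smul`) then shows that the sum over `M` disjoint from `K` is `± c K`, so the
quadratic form is diagonal with a constant sign. -/

/-! ### Alternating forms inside the complex exterior algebra -/

/-- Indices of the standard real frame of `ℂⁿ`. -/
abbrev Idx (n : ℕ) : Type := Fin n × Fin 2

/-- The complexified exterior algebra on the dual of the real frame. -/
abbrev Ext (n : ℕ) : Type := ExteriorAlgebra ℂ (Idx n → ℂ)

open ExteriorAlgebra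

variable {n : ℕ}

/-- The standard real frame as a basis. -/
def stdBasis (n : ℕ) : Module.Basis (Idx n) ℝ (Cn n) :=
  (Complex.basisOneI.smulTower' (EuclideanSpace.basisFun (Fin n) ℂ).toBasis)

theorem stdBasis_apply (a : Idx n) : stdBasis n a = stdFrame n a := by
  rcases a with ⟨j, s⟩
  rw [stdBasis, Module.Basis.smulTower'_apply]
  fin_cases s
  · simp [stdFrame]
  · ext i
    simp [stdFrame]

/-- The element of the exterior algebra attached to a covector. -/
def covec (c : Cn n →ₗ[ℝ] ℂ) : Ext n := ι ℂ (fun a => c (stdFrame n a))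

/-- The basis covectors. -/
def coframe (a : Idx n) : Ext n := ι ℂ (Pi.single a 1)

/-- The product of basis covectors. -/
def coframes {k : ℕ} (a : Fin k → Idx n) : Ext n := ιMulti ℂ k (fun l => Pi.single (a l) (1 : ℂ))

theorem coframes_cons {k : ℕ} (a : Fin (k + 1) → Idx n) :
    coframes a = coframe (a 0) * coframes (fun l => a l.succ) := by
  simp [coframes, coframe, Matrix.vecTail, Function.comp_def]

theorem coframes_append {j k : ℕ} (a : Fin j → Idx n) (b : Fin k → Idx n) :
    coframes (Fin.append a b) = coframes a * coframes b := by
  simp only [coframes]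
  rw [ιMulti_mul_ιMulti]
  congr 1
  ext l : 1
  refine Fin.addCases (fun i => ?_) (fun i => ?_) l <;> simp

theorem coframes_comp_perm {k : ℕ} (a : Fin k → Idx n) (σ : Equiv.Perm (Fin k)) :
    coframes (a ∘ σ) = (Equiv.Perm.sign σ : ℤ) • coframes a := by
  have := (ιMulti ℂ k).map_perm (fun l => (Pi.single (a l) (1 : ℂ) : Idx n → ℂ)) σ
  simpa [coframes, Function.comp_def, Units.smul_def] using this

/-- An alternating form as an element of the exterior algebra. -/
def toExt (n k : ℕ) : (Cn n [⋀^Fin k]→ₗ[ℝ] ℂ) →ₗ[ℂ] Ext n where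
  toFun φ := ((k.factorial : ℂ))⁻¹ •
    ∑ a : Fin k → Idx n, φ (fun l => stdFrame n (a l)) • coframes a
  map_add' φ ψ := by
    simp [add_smul, Finset.sum_add_distrib]
  map_smul' c φ := by
    simp_rw [AlternatingMap.smul_apply, smul_assoc, ← Finset.smul_sum]
    exact smul_comm _ _ _

theorem toExt_apply {k : ℕ} (φ : Cn n [⋀^Fin k]→ₗ[ℝ] ℂ) : toExt n k φ = ((k.factorial : ℂ))⁻¹ •
    ∑ a : Fin k → Idx n, φ (fun l => stdFrame n (a l)) • coframes a := rfl

/-- Each shuffle coset contains `j! k!` permutations with equal contributions. Clearing that factor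
gives a sum over all permutations, which is easier to reindex. -/
theorem wedge_apply {V : Type*} [AddCommGroup V] [Module ℝ V] {j k : ℕ}
    (a : V [⋀^Fin j]→ₗ[ℝ] ℂ) (b : V [⋀^Fin k]→ₗ[ℝ] ℂ) (v : Fin (j + k) → V) :
    ((j.factorial * k.factorial : ℕ) : ℂ) * wedge a b v =
      ∑ σ : Equiv.Perm (Fin j ⊕ Fin k), (Equiv.Perm.sign σ : ℤ) •
        (a (fun i => v (finSumFinEquiv (σ (Sum.inl i)))) *
          b (fun i => v (finSumFinEquiv (σ (Sum.inr i))))) := by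
  have h := congrArg (fun m : AlternatingMap ℝ V (TensorProduct ℝ ℂ ℂ) (Fin j ⊕ Fin k) =>
    LinearMap.mul' ℝ ℂ (m (fun i => v (finSumFinEquiv i))))
    (MultilinearMap.domCoprod_alternization_eq a b)
  simp only [Fintype.card_fin, AlternatingMap.smul_apply, map_nsmul] at h
  rw [wedge, AlternatingMap.domDomCongr_apply]
  simp only [LinearMap.compAlternatingMap_apply, Function.comp_def]
  rw [nsmul_eq_mul] at h
  rw [← h, MultilinearMap.alternatization_apply, map_sum]
  refine Finset.sum_congr rfl fun σ _ => ?_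
  rw [Units.smul_def, map_zsmul]
  simp [MultilinearMap.domCoprod_apply]

theorem units_smul_smul_smul (u : ℤˣ) (x y : ℂ) (P Q : Ext n) :
    ((u : ℤ) • (x * y)) • ((u : ℤ) • (P * Q)) = (x • P) * (y • Q) := by
  rw [smul_mul_smul_comm]
  rcases Int.units_eq_one_or u with rfl | rfl
  · simp only [Units.val_one, one_smul]
  · simp only [Units.val_neg, Units.val_one, neg_smul, one_smul, smul_neg, neg_neg]

/-- Reindexing the frame indices along `σ` produces the sign of `σ` a second time, from reordering
the coframe product, and the two signs cancel. Every permutation therefore contributes the full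
product of the two factors, and their number cancels `1/(j+k)!`. -/
theorem toExt_wedge {j k : ℕ} (a : Cn n [⋀^Fin j]→ₗ[ℝ] ℂ) (b : Cn n [⋀^Fin k]→ₗ[ℝ] ℂ) :
    toExt n (j + k) (wedge a b) = toExt n j a * toExt n k b := by
  have hj : (j.factorial : ℂ) ≠ 0 := by exact_mod_cast j.factorial_ne_zero
  have hk : (k.factorial : ℂ) ≠ 0 := by exact_mod_cast k.factorial_ne_zero
  have hjk : ((j + k).factorial : ℂ) ≠ 0 := by exact_mod_cast (j + k).factorial_ne_zero
  have key : ∀ σ : Equiv.Perm (Fin j ⊕ Fin k),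
      ∑ c : Fin (j + k) → Idx n, ((Equiv.Perm.sign σ : ℤ) •
        (a (fun i => stdFrame n (c (finSumFinEquiv (σ (Sum.inl i))))) *
          b (fun i => stdFrame n (c (finSumFinEquiv (σ (Sum.inr i))))))) • coframes c =
      (∑ c : Fin j → Idx n, a (fun l => stdFrame n (c l)) • coframes c) *
        ∑ c : Fin k → Idx n, b (fun l => stdFrame n (c l)) • coframes c := by
    intro σ
    let e : ((Fin j → Idx n) × (Fin k → Idx n)) ≃ (Fin (j + k) → Idx n) :=
      (Equiv.sumArrowEquivProdArrow _ _ _).symm.trans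
        (Equiv.arrowCongr (σ.trans finSumFinEquiv) (Equiv.refl _))
    rw [← Equiv.sum_comp e, Finset.sum_mul_sum, Fintype.sum_prod_type]
    refine Finset.sum_congr rfl fun c _ => Finset.sum_congr rfl fun d _ => ?_
    have h1 : ∀ i, e (c, d) (finSumFinEquiv (σ i)) = Sum.elim c d i := by
      intro i
      simp [e, Equiv.sumArrowEquivProdArrow, Equiv.arrowCongr]
    have h2 : e (c, d) = Fin.append c d ∘ (finSumFinEquiv.permCongr σ).symm := by
      ext1 l
      obtain ⟨i, rfl⟩ := (finSumFinEquiv.permCongr σ).surjective l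
      obtain ⟨i, rfl⟩ := finSumFinEquiv.surjective i
      have : (finSumFinEquiv.permCongr σ) (finSumFinEquiv i) = finSumFinEquiv (σ i) := by
        simp [Equiv.permCongr_apply]
      rw [Function.comp, Equiv.symm_apply_apply, this, h1]
      rcases i with i | i <;> simp
    have h3 : coframes (e (c, d)) = (Equiv.Perm.sign σ : ℤ) • (coframes c * coframes d) := by
      rw [h2, coframes_comp_perm, coframes_append]
      simp
    rw [h3]
    simp only [h1, Sum.elim_inl, Sum.elim_inr]
    exact units_smul_smul_smul _ _ _ _ _
  have hw : ∀ v, wedge a b v = ((j.factorial : ℂ) * k.factorial)⁻¹ *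
      (((j.factorial * k.factorial : ℕ) : ℂ) * wedge a b v) := by
    intro v
    rw [← mul_assoc]
    push_cast
    rw [inv_mul_cancel₀ (mul_ne_zero hj hk), one_mul]
  rw [toExt_apply, toExt_apply, toExt_apply, smul_mul_smul_comm]
  have hterm : ∀ c : Fin (j + k) → Idx n, wedge a b (fun l => stdFrame n (c l)) • coframes c =
      ((j.factorial : ℂ) * k.factorial)⁻¹ • ∑ σ : Equiv.Perm (Fin j ⊕ Fin k),
        ((Equiv.Perm.sign σ : ℤ) • (a (fun i => stdFrame n (c (finSumFinEquiv (σ (Sum.inl i))))) *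
          b (fun i => stdFrame n (c (finSumFinEquiv (σ (Sum.inr i))))))) • coframes c := by
    intro c
    rw [hw, wedge_apply, mul_smul, Finset.sum_smul]
  simp_rw [hterm]
  rw [← Finset.smul_sum, Finset.sum_comm]
  simp_rw [key]
  rw [Finset.sum_const, Finset.card_univ, Fintype.card_perm, Fintype.card_sum, Fintype.card_fin,
    Fintype.card_fin, ← Nat.cast_smul_eq_nsmul ℂ, smul_smul, smul_smul]
  congr 1
  field_simp

theorem toExt_wedgePow {k : ℕ} (Ω : Cn n [⋀^Fin 2]→ₗ[ℝ] ℂ) (φ : Cn n [⋀^Fin k]→ₗ[ℝ] ℂ) (m : ℕ) :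
    toExt n _ (wedgePow Ω φ m) = toExt n k φ * toExt n 2 Ω ^ m := by
  induction m with
  | zero => simp [wedgePow]
  | succ m ih => rw [pow_succ, ← mul_assoc, ← ih]; exact toExt_wedge (wedgePow Ω φ m) Ω

theorem coframes_removeNth {k : ℕ} (a : Fin (k + 1) → Idx n) (i : Fin (k + 1)) :
    coframes a = (-1 : ℂ) ^ (i : ℕ) • (coframe (a i) * coframes (i.removeNth a)) := by
  have h := (ιMulti ℂ (k + 1)).neg_one_pow_smul_map_insertNth i
    (Pi.single (a i) (1 : ℂ) : Idx n → ℂ)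
    (fun l => Pi.single (i.removeNth a l) (1 : ℂ))
  have h2 : (i.insertNth (Pi.single (a i) (1 : ℂ) : Idx n → ℂ)
      (fun l => Pi.single (i.removeNth a l) (1 : ℂ)) : Fin (k + 1) → Idx n → ℂ) =
      fun l => Pi.single (a l) 1 := by
    ext1 l
    refine Fin.succAboveCases i ?_ (fun l => ?_) l
    · simp
    · simp [Fin.removeNth]
  rw [h2] at h
  have h3 : coframe (a i) * coframes (i.removeNth a) = (-1 : ℤ) ^ (i : ℕ) • coframes a := by
    rw [coframes, coframes, h]
    simp [coframe, Matrix.vecTail, Function.comp_def]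
  rw [h3]
  rcases neg_one_pow_eq_or ℤ (i : ℕ) with hi | hi <;>
  rcases Nat.even_or_odd (i : ℕ) with hj | hj <;> simp [hj.neg_one_pow]

/-- Moving the `i`-th covector to the front costs `(-1)^i`, the same sign as in the alternatization,
so the `k + 1` summands agree. This turns first-order operators such as `∂` and `∂̄` into left
multiplication by covectors. -/
theorem toExt_alternatizeUncurryFin {k : ℕ} (A : Cn n →ₗ[ℝ] (Cn n [⋀^Fin k]→ₗ[ℝ] ℂ)) :
    toExt n (k + 1) (AlternatingMap.alternatizeUncurryFin A) =
      ∑ b, coframe b * toExt n k (A (stdFrame n b)) := by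
  have hk : (k.factorial : ℂ) ≠ 0 := by exact_mod_cast k.factorial_ne_zero
  have hk1 : ((k + 1).factorial : ℂ) ≠ 0 := by exact_mod_cast (k + 1).factorial_ne_zero
  rw [toExt_apply]
  simp only [AlternatingMap.alternatizeUncurryFin_apply, Finset.sum_smul]
  rw [Finset.sum_comm]
  have key : ∀ i : Fin (k + 1), ∑ c : Fin (k + 1) → Idx n,
      ((-1 : ℤ) ^ (i : ℕ) • A (stdFrame n (c i)) (i.removeNth fun l => stdFrame n (c l))) •
        coframes c = ∑ b, coframe b * ∑ c : Fin k → Idx n,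
          A (stdFrame n b) (fun l => stdFrame n (c l)) • coframes c := by
    intro i
    rw [← (Fin.insertNthEquiv (fun _ => Idx n) i).sum_comp, Fintype.sum_prod_type]
    refine Finset.sum_congr rfl fun b _ => ?_
    rw [Finset.mul_sum]
    refine Finset.sum_congr rfl fun c _ => ?_
    rw [coframes_removeNth _ i]
    have : (i.removeNth fun l => stdFrame n ((Fin.insertNthEquiv (fun _ => Idx n) i) (b, c) l)) =
        fun l => stdFrame n (c l) := by
      ext1 l; simp [Fin.removeNth]
    rw [this]
    have h2 : i.removeNth ((Fin.insertNthEquiv (fun _ => Idx n) i) (b, c)) = c := by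
      ext1 l; simp [Fin.removeNth]
    rw [h2]
    simp only [Fin.insertNthEquiv_apply, Fin.insertNth_apply_same]
    rw [smul_smul, mul_smul_comm]
    congr 1
    rcases Nat.even_or_odd (i : ℕ) with hj | hj <;> simp [hj.neg_one_pow]
  simp_rw [key]
  rw [Finset.sum_const, Finset.card_univ, Fintype.card_fin, ← Nat.cast_smul_eq_nsmul ℂ, smul_smul,
    Finset.smul_sum]
  refine Finset.sum_congr rfl fun b _ => ?_
  rw [toExt_apply, mul_smul_comm]
  congr 1
  rw [Nat.factorial_succ]
  have : ((k + 1 : ℕ) : ℂ) ≠ 0 := by exact_mod_cast k.succ_ne_zero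
  push_cast at this ⊢
  field_simp

/-- The action on covectors of a real endomorphism, by precomposition. -/
def transpose (A : Cn n →ₗ[ℝ] Cn n) : (Idx n → ℂ) →ₗ[ℂ] (Idx n → ℂ) :=
  Matrix.toLin' ((LinearMap.toMatrix (stdBasis n) (stdBasis n) A).transpose.map Complex.ofReal)

/-- Pull-back on the exterior algebra. -/
def pull (A : Cn n →ₗ[ℝ] Cn n) : Ext n →ₐ[ℂ] Ext n := ExteriorAlgebra.map (transpose A)

theorem apply_stdFrame (A : Cn n →ₗ[ℝ] Cn n) (a : Idx n) :
    A (stdFrame n a) =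
      ∑ b, LinearMap.toMatrix (stdBasis n) (stdBasis n) A b a • stdFrame n b := by
  simp_rw [← stdBasis_apply]
  rw [← (stdBasis n).sum_repr (A (stdBasis n a))]
  simp [LinearMap.toMatrix_apply]

theorem pull_covec (A : Cn n →ₗ[ℝ] Cn n) (c : Cn n →ₗ[ℝ] ℂ) :
    pull A (covec c) = covec (c ∘ₗ A) := by
  rw [pull, covec, ExteriorAlgebra.map_apply_ι, covec]
  congr 1
  ext a
  simp only [LinearMap.comp_apply, apply_stdFrame A a, map_sum, transpose, Matrix.toLin'_apply,
    Matrix.mulVec, dotProduct, Matrix.map_apply, Matrix.transpose_apply, map_smul,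
    Complex.real_smul]

theorem pull_coframes {k : ℕ} (A : Cn n →ₗ[ℝ] Cn n) (b : Fin k → Idx n) :
    pull A (coframes b) = ∑ a : Fin k → Idx n,
      (∏ l, (LinearMap.toMatrix (stdBasis n) (stdBasis n) A (b l) (a l) : ℂ)) • coframes a := by
  set M := LinearMap.toMatrix (stdBasis n) (stdBasis n) A
  rw [pull, coframes, ExteriorAlgebra.map_apply_ιMulti]
  have : (transpose A ∘ fun l => (Pi.single (b l) (1 : ℂ) : Idx n → ℂ)) =
      fun l => ∑ a, (M (b l) a : ℂ) • (Pi.single a (1 : ℂ) : Idx n → ℂ) := by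
    ext l c
    simp [transpose, M, Pi.single_apply]
  rw [this]
  rw [← AlternatingMap.coe_multilinearMap, MultilinearMap.map_sum]
  refine Finset.sum_congr rfl fun a _ => ?_
  rw [MultilinearMap.map_smul_univ]
  rfl

theorem toExt_compLinearMap {k : ℕ} (φ : Cn n [⋀^Fin k]→ₗ[ℝ] ℂ) (A : Cn n →ₗ[ℝ] Cn n) :
    toExt n k (φ.compLinearMap A) = pull A (toExt n k φ) := by
  rw [toExt_apply, toExt_apply, map_smul, map_sum]
  congr 1
  simp_rw [map_smul, pull_coframes, Finset.smul_sum]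
  rw [Finset.sum_comm]
  refine Finset.sum_congr rfl fun a _ => ?_
  simp_rw [smul_smul, ← Finset.sum_smul]
  congr 1
  simp only [AlternatingMap.compLinearMap_apply, apply_stdFrame A]
  rw [← AlternatingMap.coe_multilinearMap, MultilinearMap.map_sum]
  refine Finset.sum_congr rfl fun b _ => ?_
  rw [MultilinearMap.map_smul_univ, AlternatingMap.coe_multilinearMap, mul_comm]
  simp

/-- The top degree coefficient. -/
def top (n : ℕ) : Ext n →ₗ[ℂ] ℂ :=
  liftAlternating (Pi.single (n * 2)
    ((Matrix.detRowAlternating (R := ℂ) (n := Idx n)).domDomCongr finProdFinEquiv))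

/-- `top` is a determinant in full degree and zero elsewhere, and determinants multiply. With
diagonal maps this becomes a weight argument that kills unwanted top coefficients; with frames it is
the change of variables for densities. -/
theorem top_pull (A : Cn n →ₗ[ℝ] Cn n) (y : Ext n) :
    top n (pull A y) = (LinearMap.det A : ℝ) * top n y := by
  have : top n ∘ₗ (pull A).toLinearMap = ((LinearMap.det A : ℝ) : ℂ) • top n := by
    ext k v
    simp only [LinearMap.compAlternatingMap_apply, LinearMap.comp_apply, pull, top,
      AlgHom.toLinearMap_apply, ExteriorAlgebra.map_apply_ιMulti, liftAlternating_apply_ιMulti,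
      LinearMap.smul_apply]
    by_cases hk : k = n * 2
    · subst hk
      simp only [Pi.single_eq_same, AlternatingMap.domDomCongr_apply]
      set M := LinearMap.toMatrix (stdBasis n) (stdBasis n) A with hM
      have h1 : (fun i => (transpose A ∘ v) (finProdFinEquiv i)) =
          (Matrix.of fun i => v (finProdFinEquiv i)) * M.map Complex.ofReal := by
        ext i j
        simp [transpose, Matrix.mulVec, dotProduct, Matrix.mul_apply, M, mul_comm]
      have h2 : (M.map Complex.ofReal).det = ((LinearMap.det A : ℝ) : ℂ) := by
        rw [← LinearMap.det_toMatrix (stdBasis n) A]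
        exact (RingHom.map_det Complex.ofRealHom M).symm
      change Matrix.det _ = _ • Matrix.det _
      have h3 := congrArg Matrix.det h1
      rw [Matrix.det_mul, h2] at h3
      exact h3.trans (mul_comm _ _)
    · rw [Pi.single_eq_of_ne hk]
      simp
  exact LinearMap.congr_fun this y

theorem top_coframes : top n (coframes (finProdFinEquiv.symm : Fin (n * 2) → Idx n)) = 1 := by
  rw [top, coframes, liftAlternating_apply_ιMulti]
  simp only [Pi.single_eq_same, AlternatingMap.domDomCongr_apply]
  have : (Matrix.of fun i => Pi.single (finProdFinEquiv.symm (finProdFinEquiv i)) 1) =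
      (1 : Matrix (Idx n) (Idx n) ℂ) := by
    ext i j
    rw [Matrix.of_apply, Equiv.symm_apply_apply, Matrix.one_eq_pi_single]
  exact (congrArg Matrix.det this).trans (Matrix.det_one (n := Idx n) (R := ℂ))

/-- The `k × k` minor with columns `a` is a linear functional on the exterior algebra. On the image
of `φ` every permutation of `a` contributes `φ(e_a)`, so up to nonzero factors it returns that
value. -/
theorem toExt_injective {k : ℕ} : Function.Injective (toExt n k) := by
  rw [← LinearMap.ker_eq_bot, LinearMap.ker_eq_bot']
  intro φ hφ
  have hk : (k.factorial : ℂ) ≠ 0 := by exact_mod_cast k.factorial_ne_zero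
  refine (stdBasis n).ext_alternating fun a ha => ?_
  let D : (Idx n → ℂ) [⋀^Fin k]→ₗ[ℂ] ℂ :=
    (Matrix.detRowAlternating (R := ℂ) (n := Fin k)).compLinearMap (LinearMap.funLeft ℂ ℂ a)
  have h := congrArg (liftAlternating (R := ℂ) (Pi.single k D)) hφ
  rw [toExt_apply, map_smul, map_sum, map_zero, smul_eq_zero_iff_right (inv_ne_zero hk)] at h
  simp only [map_smul, coframes, liftAlternating_apply_ιMulti, Pi.single_eq_same] at h
  have hD : ∀ b : Fin k → Idx n, D (fun l => Pi.single (b l) (1 : ℂ)) =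
      ∑ σ : Equiv.Perm (Fin k), if b = a ∘ σ then ((Equiv.Perm.sign σ : ℤ) : ℂ) else 0 := by
    intro b
    refine (Matrix.det_transpose (Matrix.of fun i j => (Pi.single (b i) (1 : ℂ) : Idx n → ℂ)
      (a j))).symm.trans ?_
    rw [Matrix.det_apply]
    refine Finset.sum_congr rfl fun σ _ => ?_
    split_ifs with hb
    · rw [Finset.prod_eq_one]
      · simp [Units.smul_def]
      · intro i _
        simp [hb]
    · obtain ⟨i, hi⟩ : ∃ i, b i ≠ a (σ i) := by
        by_contra! hh; exact hb (funext hh)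
      rw [Finset.prod_eq_zero (Finset.mem_univ i), smul_zero]
      simp [Pi.single_apply, hi.symm]
  simp_rw [hD, Finset.smul_sum] at h
  rw [Finset.sum_comm] at h
  have h2 : ∀ σ : Equiv.Perm (Fin k), ∑ b : Fin k → Idx n, (φ fun l => stdFrame n (b l)) •
      (if b = a ∘ σ then ((Equiv.Perm.sign σ : ℤ) : ℂ) else 0) = φ fun l => stdFrame n (a l) := by
    intro σ
    rw [Finset.sum_eq_single (a ∘ σ)]
    · rw [if_pos rfl]
      have := φ.map_perm (fun l => stdFrame n (a l)) σ
      simp only [Function.comp_def] at this ⊢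
      rw [this]
      rcases Int.units_eq_one_or (Equiv.Perm.sign σ) with h | h <;> simp [h]
    · intro b _ hb; simp [hb]
    · simp
  simp_rw [h2] at h
  simp only [Finset.sum_const, Finset.card_univ, nsmul_eq_mul, mul_eq_zero] at h
  rcases h with h | h
  · simp [Fintype.card_perm, Nat.factorial_ne_zero] at h
  · simpa [stdBasis_apply] using h

open ExteriorAlgebra

variable {n : ℕ}

/-! ### Ordered products -/

section OrderedProducts

variable {A : Type*} [Ring A]

/-- The ordered product of a finite family. -/
def oprod {n : ℕ} (y : Fin n → A) : A := (List.ofFn y).prod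

theorem oprod_succ {n : ℕ} (y : Fin (n + 1) → A) : oprod y = y 0 * oprod (fun i => y i.succ) := by
  simp [oprod, List.ofFn_succ]

variable [Algebra ℂ A]

theorem oprod_smul {n : ℕ} (c : Fin n → ℂ) (y : Fin n → A) :
    oprod (fun i => c i • y i) = (∏ i, c i) • oprod y := by
  have := (MultilinearMap.mkPiAlgebraFin ℂ n A).map_smul_univ c y
  simpa [oprod, MultilinearMap.mkPiAlgebraFin_apply] using this

theorem oprod_eq_zero {n : ℕ} (y : Fin n → A) (i : Fin n) (h : y i = 0) : oprod y = 0 :=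
  (MultilinearMap.mkPiAlgebraFin ℂ n A).map_coord_zero i h

theorem mul_oprod_of_skew {n : ℕ} (θ : A) (y : Fin n → A) (s : Fin n → ℂ) (j : Fin n)
    (h : ∀ i, i ≠ j → θ * y i = s i • (y i * θ)) :
    θ * oprod y = (∏ i with i < j, s i) • oprod (Function.update y j (θ * y j)) := by
  induction n with
  | zero => exact j.elim0
  | succ n ih =>
    rw [oprod_succ, oprod_succ]
    refine Fin.cases (fun _ => ?_) (fun j h => ?_) j h
    · simp [Function.update_of_ne, mul_assoc, Fin.succ_ne_zero]
    · have hs : (∏ i with i < j.succ, s i) = s 0 * ∏ i with i < j, s i.succ := by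
        rw [Finset.prod_filter, Fin.prod_univ_succ, Finset.prod_filter]
        simp
      have hu : (fun i : Fin n => Function.update y j.succ (θ * y j.succ) i.succ) =
          Function.update (fun i : Fin n => y i.succ) j (θ * y j.succ) := by
        ext i
        by_cases hi : i = j
        · subst hi; simp
        · rw [Function.update_of_ne hi, Function.update_of_ne (by simpa using hi)]
      rw [hs, hu, Function.update_of_ne (Fin.succ_ne_zero j).symm, ← mul_assoc,
        h 0 (Fin.succ_ne_zero j).symm, smul_mul_assoc, mul_assoc,
        ih (fun i => y i.succ) (fun i => s i.succ) j (fun i hi => h i.succ (by simpa using hi)),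
        mul_smul_comm, smul_smul]

theorem oprod_mul_of_skew {n : ℕ} (q : A) (p : Fin n → A) (ε : Fin n → ℕ) (δ : ℕ)
    (h : ∀ i, p i * q = (-1 : ℂ) ^ (ε i * δ) • (q * p i)) :
    oprod p * q = (-1 : ℂ) ^ ((∑ i, ε i) * δ) • (q * oprod p) := by
  induction n with
  | zero => simp [oprod]
  | succ n ih =>
    rw [oprod_succ, mul_assoc, ih _ (fun i => ε i.succ) (fun i => h i.succ), mul_smul_comm,
      ← mul_assoc, h 0, smul_mul_assoc, smul_smul, Fin.sum_univ_succ, add_mul, pow_add, mul_assoc]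
    congr 1
    ring

/-- The sign of the permutation reversing `r` letters. -/
def revSign (r : ℕ) : ℂ := (-1) ^ (r * (r - 1) / 2)

theorem revSign_succ (r : ℕ) : revSign (r + 1) = (-1) ^ r * revSign r := by
  rw [revSign, revSign, ← pow_add]
  congr 1
  rw [Nat.triangle_succ, add_comm]

/-- Merges the sign `(-1)^m` coming from inclusion-exclusion with the sign of the odd part into one
sign that depends only on the total degree. -/
theorem revSign_add_two_mul (r m : ℕ) : revSign (r + 2 * m) = (-1) ^ m * revSign r := by
  induction m with
  | zero => simp
  | succ m ih =>
    rw [show r + 2 * (m + 1) = r + 2 * m + 1 + 1 by ring, revSign_succ, revSign_succ, ih,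
      pow_succ, pow_succ, pow_add, pow_mul]
    rcases neg_one_pow_eq_or ℂ r with h | h <;> simp [h]

theorem revSign_ne_zero (r : ℕ) : revSign r ≠ 0 := by simp [revSign]

/-- Interleaving two ordered products with `r` odd letters each moves the odd letters past one
another `r (r - 1) / 2` times. -/
theorem oprod_mul_oprod {n : ℕ} (p q : Fin n → A) (ε : Fin n → ℕ) (hε : ∀ i, ε i ≤ 1)
    (h : ∀ i j, i ≠ j → p i * q j = (-1 : ℂ) ^ (ε i * ε j) • (q j * p i)) :
    oprod p * oprod q = revSign (∑ i, ε i) • oprod (fun i => p i * q i) := by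
  induction n with
  | zero => simp [oprod, revSign]
  | succ n ih =>
    rw [oprod_succ p, oprod_succ q, oprod_succ, mul_assoc, ← mul_assoc _ (q 0),
      oprod_mul_of_skew (q 0) (fun i => p i.succ) (fun i => ε i.succ) (ε 0)
        (fun i => h _ _ (Fin.succ_ne_zero i)), smul_mul_assoc, mul_assoc,
      ih (fun i => p i.succ) (fun i => q i.succ) (fun i => ε i.succ) (fun i => hε _)
        (fun i j hij => h _ _ (by simpa using hij)), mul_smul_comm, mul_smul_comm, mul_smul_comm,
      smul_smul, ← mul_assoc, Fin.sum_univ_succ]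
    congr 1
    have h0 := hε 0
    interval_cases h1 : ε 0
    · simp
    · rw [add_comm, revSign_succ, mul_one]

theorem oprod_mul_of_commute {n : ℕ} (p q : Fin n → A)
    (h : ∀ i j, i ≠ j → p i * q j = q j * p i) :
    oprod p * oprod q = oprod (fun i => p i * q i) := by
  simpa [revSign] using oprod_mul_oprod p q (fun _ => 0) (by simp) (by simpa using h)

end OrderedProducts

/-! ### The holomorphic coframe -/

/-- `dz_j` (for `b = false`) and `dz̄_j` (for `b = true`). -/
def cz (b : Bool) (j : Fin n) : Ext n :=
  coframe (j, 0) + (if b then -Complex.I else Complex.I) • coframe (j, 1)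

/-- `dx_j ∧ dy_j`. -/
def area (j : Fin n) : Ext n := coframe (j, 0) * coframe (j, 1)

theorem coframe_mul_self (a : Idx n) : coframe a * coframe a = 0 := ι_sq_zero _

theorem coframe_mul_coframe (a b : Idx n) : coframe a * coframe b = -(coframe b * coframe a) :=
  eq_neg_of_add_eq_zero_left (ι_add_mul_swap _ _)

theorem cz_eq_ι (b : Bool) (j : Fin n) : cz b j = ι ℂ (Pi.single (j, 0) 1 +
    (if b then -Complex.I else Complex.I) • Pi.single (j, 1) 1) := by
  cases b <;> simp [cz, coframe]

theorem cz_mul_cz (b c : Bool) (i j : Fin n) : cz b i * cz c j = -(cz c j * cz b i) := by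
  rw [cz_eq_ι, cz_eq_ι]
  exact eq_neg_of_add_eq_zero_left (ι_add_mul_swap _ _)

theorem cz_mul_self (b : Bool) (j : Fin n) : cz b j * cz b j = 0 := by
  rw [cz_eq_ι, ι_sq_zero]

theorem cz_mul_cz_not (b : Bool) (j : Fin n) :
    cz b j * cz (!b) j = (if b then 2 * Complex.I else -2 * Complex.I) • area j := by
  have h0 := coframe_mul_self (j, (0 : Fin 2))
  have h1 := coframe_mul_self (j, (1 : Fin 2))
  have h2 := coframe_mul_coframe (j, (1 : Fin 2)) (j, 0)
  cases b <;>
  · simp only [cz, area, add_mul, mul_add, smul_mul_assoc, mul_smul_comm, h0, h1, h2]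
    simp only [Bool.not_true, Bool.not_false, if_true, if_false, Bool.false_eq_true]
    module

theorem coframe_zero_eq (j : Fin n) :
    (coframe (j, 0) : Ext n) = (1 / 2 : ℂ) • cz false j + (1 / 2 : ℂ) • cz true j := by
  simp only [cz, if_true, if_false, Bool.false_eq_true]
  module

theorem coframe_one_eq (j : Fin n) : (coframe (j, 1) : Ext n) =
    (-Complex.I / 2 : ℂ) • cz false j + (Complex.I / 2 : ℂ) • cz true j := by
  simp only [cz, if_true, if_false, Bool.false_eq_true, smul_add, smul_smul]
  have : -Complex.I / 2 * Complex.I = 1 / 2 := by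
    linear_combination (-1 / 2 : ℂ) * Complex.I_mul_I
  have h2 : Complex.I / 2 * -Complex.I = 1 / 2 := by
    linear_combination (-1 / 2 : ℂ) * Complex.I_mul_I
  rw [this, h2]
  module

theorem ι_mul_area (w : Idx n → ℂ) (j : Fin n) : ι ℂ w * area j = area j * ι ℂ w := by
  have h : ∀ v : Idx n → ℂ, ι ℂ w * ι ℂ v = -(ι ℂ v * ι ℂ w) := fun v =>
    eq_neg_of_add_eq_zero_left (ι_add_mul_swap _ _)
  rw [area, coframe, coframe, ← mul_assoc, h, neg_mul, mul_assoc, h, mul_neg, neg_neg, mul_assoc]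

theorem area_comm (j : Fin n) (y : Ext n) : area j * y = y * area j := by
  induction y using ExteriorAlgebra.induction with
  | algebraMap r => exact (Algebra.commutes r _).symm
  | ι w => exact (ι_mul_area w j).symm
  | mul a b ha hb => rw [← mul_assoc, ha, mul_assoc, hb, mul_assoc]
  | add a b ha hb => rw [mul_add, add_mul, ha, hb]

theorem cz_mul_area_self (b : Bool) (j : Fin n) : cz b j * area j = 0 := by
  have h : area j = (if b then 2 * Complex.I else -2 * Complex.I)⁻¹ • (cz b j * cz (!b) j) := by
    rw [cz_mul_cz_not, smul_smul, inv_mul_cancel₀, one_smul]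
    cases b <;> simp
  rw [h, mul_smul_comm, ← mul_assoc, cz_mul_self, zero_mul, smul_zero]

theorem area_mul_self (j : Fin n) : area j * area j = 0 := by
  rw [area, mul_assoc, ← mul_assoc (coframe (j, 1)), coframe_mul_coframe (j, 1), neg_mul,
    mul_assoc, coframe_mul_self]
  simp

/-- The elements `1`, `dz_j`, `dz̄_j`; with the last two exchanged if `b` is true. -/
def oddPart (b : Bool) (t : Fin 3) (j : Fin n) : Ext n :=
  if t = 0 then 1 else if t = 1 then cz b j else cz (!b) j

/-- The monomials `⋀_j (dz_j or dz̄_j or 1) ⋀_{j ∈ M} dx_j ∧ dy_j`, and their conjugates. -/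
def mono (b : Bool) (h : Fin n → Fin 3) (M : Finset (Fin n)) : Ext n :=
  oprod fun j => oddPart b (h j) j * if j ∈ M then area j else 1

/-! ### Diagonal maps -/

/-- The diagonal map with entries `c_j`. -/
def diagMap (c : Fin n → ℂ) : Cn n →ₗ[ℝ] Cn n :=
  (Matrix.toLin (EuclideanSpace.basisFun (Fin n) ℂ).toBasis
    (EuclideanSpace.basisFun (Fin n) ℂ).toBasis (Matrix.diagonal c)).restrictScalars ℝ

theorem diagMap_apply (c : Fin n → ℂ) (v : Cn n) (j : Fin n) : diagMap c v j = c j * v j := by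
  rw [diagMap, LinearMap.restrictScalars_apply, Matrix.toLin_apply]
  simp [Matrix.mulVec_diagonal, Pi.single_apply]

theorem det_diagMap (c : Fin n → ℂ) :
    LinearMap.det (diagMap c) = ∏ j, Complex.normSq (c j) := by
  rw [diagMap, LinearMap.det_restrictScalars, LinearMap.det_toLin, Matrix.det_diagonal,
    Algebra.norm_complex_eq, ← map_prod]
  rfl

theorem cz_eq_covec (b : Bool) (j : Fin n) : cz b j = covec
    ((if b then Complex.conjAe.toLinearMap else LinearMap.id) ∘ₗ
      (EuclideanSpace.proj (𝕜 := ℂ) j).toLinearMap.restrictScalars ℝ) := by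
  rw [cz_eq_ι, covec]
  congr 1
  ext ⟨i, s⟩
  by_cases hij : i = j
  · subst hij
    cases b <;> fin_cases s <;> simp [stdFrame]
  · have hji : j ≠ i := Ne.symm hij
    cases b <;> fin_cases s <;> simp [stdFrame, hij, hji]

theorem covec_smul (c : ℂ) (f : Cn n →ₗ[ℝ] ℂ) : covec (c • f) = c • covec f := by
  rw [covec, covec, ← map_smul]
  rfl

theorem pull_diagMap_cz (c : Fin n → ℂ) (b : Bool) (j : Fin n) :
    pull (diagMap c) (cz b j) = (if b then conj (c j) else c j) • cz b j := by
  rw [cz_eq_covec, pull_covec, ← covec_smul]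
  congr 1
  ext v
  cases b <;> simp [diagMap_apply]

theorem pull_diagMap_area (c : Fin n → ℂ) (j : Fin n) :
    pull (diagMap c) (area j) = (Complex.normSq (c j) : ℂ) • area j := by
  have h : (area j : Ext n) = (-2 * Complex.I)⁻¹ • (cz false j * cz true j) := by
    have := cz_mul_cz_not false j
    simp only [Bool.not_false, Bool.false_eq_true, if_false] at this
    rw [this, smul_smul, inv_mul_cancel₀ (by simp), one_smul]
  rw [h, map_smul, map_mul, pull_diagMap_cz, pull_diagMap_cz]
  simp only [Bool.false_eq_true, if_false, if_true]
  rw [smul_mul_smul_comm, Complex.mul_conj, smul_comm]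

/-- The weight of `oddPart` under the diagonal action. -/
def wt (b : Bool) (t : Fin 3) (c : ℂ) : ℂ :=
  if t = 0 then 1 else if t = 1 then (if b then conj c else c) else (if b then c else conj c)

theorem pull_diagMap_oddPart (c : Fin n → ℂ) (b : Bool) (t : Fin 3) (j : Fin n) :
    pull (diagMap c) (oddPart b t j) = wt b t (c j) • oddPart b t j := by
  fin_cases t
  · simp [oddPart, wt]
  · simp [oddPart, wt, pull_diagMap_cz]
  · cases b <;> simp [oddPart, wt, pull_diagMap_cz]

theorem pull_diagMap_mono (c : Fin n → ℂ) (b : Bool) (h : Fin n → Fin 3) (M : Finset (Fin n)) :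
    pull (diagMap c) (mono b h M) =
      (∏ j, wt b (h j) (c j) * if j ∈ M then (Complex.normSq (c j) : ℂ) else 1) • mono b h M := by
  rw [mono, oprod, map_list_prod, List.map_ofFn]
  refine Eq.trans ?_ (oprod_smul _ _)
  rw [oprod]
  congr 2
  ext1 j
  simp only [Function.comp_apply, map_mul, pull_diagMap_oddPart]
  split_ifs
  · rw [pull_diagMap_area, smul_mul_smul_comm]
  · simp

/-! ### Evaluation of top degree products -/

/-- Expanding the product, only the term that takes the area factor in every coordinate has full
degree. -/
theorem top_oprod (α β : Fin n → ℂ) :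
    top n (oprod fun j => algebraMap ℂ _ (α j) + β j • area j) = ∏ j, β j := by
  have h1 := (MultilinearMap.mkPiAlgebraFin ℂ n (Ext n)).map_add_univ
    (fun j => algebraMap ℂ (Ext n) (α j)) (fun j => β j • area j)
  simp only [MultilinearMap.mkPiAlgebraFin_apply] at h1
  change top n (List.prod (List.ofFn _)) = _
  have h1' := h1
  simp only [Pi.add_def] at h1'
  rw [h1', map_sum, Finset.sum_eq_single ∅]
  · rw [Finset.piecewise_empty]
    change top n (oprod _) = _
    rw [oprod_smul, map_smul]
    have : oprod (fun j => (area j : Ext n)) =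
        coframes (finProdFinEquiv.symm : Fin (n * 2) → Idx n) := by
      rw [coframes, ιMulti_apply, oprod, List.ofFn_mul, List.prod_flatten, List.map_ofFn]
      congr 2
      ext j
      simp [area, coframe, List.ofFn_succ]
      have h0 : finProdFinEquiv.symm (⟨j * 2, by omega⟩ : Fin (n * 2)) = (j, (0 : Fin 2)) := by
        rw [Equiv.symm_apply_eq]
        ext
        simp [mul_comm]
      have h1 : finProdFinEquiv.symm (⟨j * 2 + 1, by omega⟩ : Fin (n * 2)) =
          (j, (1 : Fin 2)) := by
        rw [Equiv.symm_apply_eq]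
        ext
        simp [mul_comm, add_comm]
      simp only [finProdFinEquiv_symm_apply] at h0 h1
      rw [h0, h1]
    rw [this, top_coframes]
    simp
  · intro S _ hS
    obtain ⟨j, hj⟩ := Finset.nonempty_iff_ne_empty.mpr hS
    set y := S.piecewise (fun j => algebraMap ℂ (Ext n) (α j)) (fun j => β j • area j)
    -- This term contains no differential in direction `j`, so doubling that coordinate fixes it.
    -- The real determinant of the dilation is `4`, so the top coefficient equals four times itself.
    have hy : pull (diagMap (Function.update 1 j 2)) (List.ofFn y).prod = (List.ofFn y).prod := by
      rw [map_list_prod, List.map_ofFn]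
      congr 2
      ext1 i
      by_cases hi : i ∈ S
      · simp [y, hi]
      · have : i ≠ j := fun h => hi (h ▸ hj)
        simp [y, hi, pull_diagMap_area, Function.update_of_ne this]
    have h2 := top_pull (diagMap (Function.update 1 j 2)) (List.ofFn y).prod
    rw [hy, det_diagMap, Finset.prod_eq_single j] at h2
    · simp only [Function.update_self] at h2
      norm_num [Complex.normSq] at h2
      have h3 : (3 : ℂ) * top n (List.ofFn y).prod = 0 := by linear_combination (-1 : ℂ) * h2
      simpa using h3
    · intro i _ hi; simp [Function.update_of_ne hi]
    · simp
  · simp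

open ExteriorAlgebra

variable {n : ℕ}

/-! ### Inclusion-exclusion -/

/-- A first inclusion-exclusion turns the hypothesis into the vanishing of the sums over `M ⊇ T` for
every `T ⊆ S` with fewer than `m` elements. In a second one, over `T ⊆ K`, only `T = K` survives,
and there `M ⊇ K` with equal cardinality forces `M = K`. -/
theorem sum_disjoint_eq_sign_smul {ι : Type*} [Fintype ι] [DecidableEq ι] {m : ℕ}
    (S : Finset ι) (c : Finset ι → ℂ) (hc : ∀ M, c M ≠ 0 → M.card = m)
    (h : ∀ R ⊆ S, R.card < m → ∑ M, (if Disjoint M R then c M else 0) = 0)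
    (K : Finset ι) (hK : K ⊆ S) (hKm : K.card = m) :
    ∑ M, (if Disjoint M K then c M else 0) = (-1) ^ m * c K := by
  have ie : ∀ A : Finset ι, (if A = ∅ then (1 : ℂ) else 0) = ∑ R ∈ A.powerset, (-1) ^ R.card := by
    intro A
    have := congrArg (Int.cast : ℤ → ℂ) (Finset.sum_powerset_neg_one_pow_card (x := A))
    push_cast at this
    exact this.symm
  have split : ∀ (A B : Finset ι) (p : Finset ι → Prop) [DecidablePred p],
      (∀ R, R ∈ B.powerset ↔ R ∈ A.powerset ∧ p R) →
      ∑ R ∈ B.powerset, (-1 : ℂ) ^ R.card =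
        ∑ R ∈ A.powerset, (-1 : ℂ) ^ R.card * if p R then 1 else 0 := by
    intro A B p _ hB
    have : B.powerset = A.powerset.filter p := by
      ext R; rw [hB R, Finset.mem_filter]
    rw [this, Finset.sum_filter]
    refine Finset.sum_congr rfl fun R _ => ?_
    split_ifs <;> simp
  have hE : ∀ T ⊆ S, T.card < m → ∑ M, (if T ⊆ M then c M else 0) = 0 := by
    intro T hTS hTm
    have h1 : ∀ M : Finset ι, (if T ⊆ M then c M else 0) =
        ∑ R ∈ T.powerset, (-1) ^ R.card * if Disjoint M R then c M else 0 := by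
      intro M
      have := split T (T \ M) (fun R => Disjoint M R) (fun R => by
        simp only [Finset.mem_powerset]
        rw [Finset.subset_sdiff, disjoint_comm])
      rw [← ie] at this
      have h2 : T \ M = ∅ ↔ T ⊆ M := Finset.sdiff_eq_empty_iff_subset
      simp only [h2] at this
      have h3 := congrArg (· * c M) this
      simp only [ite_mul, one_mul, zero_mul, Finset.sum_mul, mul_assoc] at h3
      exact h3
    simp_rw [h1]
    rw [Finset.sum_comm]
    refine Finset.sum_eq_zero fun R hR => ?_
    have hRT := Finset.mem_powerset.mp hR
    rw [← Finset.mul_sum, h R (hRT.trans hTS) ((Finset.card_le_card hRT).trans_lt hTm), mul_zero]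
  have h1 : ∀ M : Finset ι, (if Disjoint M K then c M else 0) =
      ∑ T ∈ K.powerset, (-1) ^ T.card * if T ⊆ M then c M else 0 := by
    intro M
    have := split K (M ∩ K) (fun T => T ⊆ M) (fun R => by
      simp only [Finset.mem_powerset, Finset.subset_inter_iff, and_comm])
    rw [← ie] at this
    simp only [← Finset.disjoint_iff_inter_eq_empty] at this
    have h3 := congrArg (· * c M) this
    simp only [ite_mul, one_mul, zero_mul, Finset.sum_mul, mul_assoc] at h3
    exact h3
  simp_rw [h1]
  rw [Finset.sum_comm, Finset.sum_eq_single K]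
  · rw [← Finset.mul_sum, hKm]
    congr 1
    rw [Finset.sum_eq_single K]
    · simp
    · intro M _ hMK
      split_ifs with hKM
      · by_contra hcM
        exact hMK (Finset.eq_of_subset_of_card_le hKM (by rw [hc M hcM, hKm])).symm
      · rfl
    · simp
  · intro T hT hTK
    have hTK' := Finset.mem_powerset.mp hT
    rw [← Finset.mul_sum, hE T (hTK'.trans hK), mul_zero]
    rw [← hKm]
    exact Finset.card_lt_card (lt_of_le_of_ne hTK' hTK)
  · simp

/-! ### Pairings of monomials -/

/-- The set of indices with no odd factor. -/
def evenSet (h : Fin n → Fin 3) : Finset (Fin n) := Finset.univ.filter fun j => h j = 0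

/-- The parity of `oddPart`. -/
def par (t : Fin 3) : ℕ := if t = 0 then 0 else 1

theorem oddPart_mul_oddPart (b c : Bool) (s t : Fin 3) (i j : Fin n) :
    oddPart b s i * oddPart c t j =
      (-1 : ℂ) ^ (par s * par t) • (oddPart c t j * oddPart b s i) := by
  fin_cases s <;> fin_cases t <;> simp [oddPart, par] <;> exact cz_mul_cz _ _ _ _

theorem commute_evenFactor (M : Finset (Fin n)) (j : Fin n) (y : Ext n) :
    (if j ∈ M then area j else 1) * y = y * (if j ∈ M then area j else 1) := by
  split_ifs
  · exact area_comm j y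
  · simp

/-- The product of the even elements `α_j + β_j dx_j ∧ dy_j`. -/
def evenProd (α β : Fin n → ℂ) : Ext n := oprod fun j => algebraMap ℂ _ (α j) + β j • area j

theorem evenFactor_comm (a b : ℂ) (j : Fin n) (y : Ext n) :
    (algebraMap ℂ (Ext n) a + b • area j) * y = y * (algebraMap ℂ (Ext n) a + b • area j) := by
  rw [add_mul, mul_add, Algebra.commutes, smul_mul_assoc, mul_smul_comm, area_comm]

theorem evenProd_comm (α β : Fin n → ℂ) (y : Ext n) :
    evenProd α β * y = y * evenProd α β := by
  have := oprod_mul_of_skew y (fun j => algebraMap ℂ (Ext n) (α j) + β j • area j) (fun _ => 0) 0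
    (fun i => by simpa using evenFactor_comm _ _ _ _)
  simpa [evenProd] using this

/-- Multiplication by `i` in a coordinate where `h` and `h'` differ has real determinant one. The
types `1`, `dz`, `dz̄` have weights `1`, `i`, `-i`, and a type multiplied by the conjugate of
another has weight one only if the two agree. So the coefficient equals itself times a number
different from one. -/
theorem top_mono_mul_mono_of_ne {h h' : Fin n → Fin 3} (hne : h ≠ h') (M M' : Finset (Fin n))
    (α β : Fin n → ℂ) : top n (mono false h M * mono true h' M' * evenProd α β) = 0 := by
  obtain ⟨j, hj⟩ := Function.ne_iff.mp hne
  set D := diagMap (Function.update (1 : Fin n → ℂ) j Complex.I) with hD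
  have hns : ∀ i, Complex.normSq (Function.update (1 : Fin n → ℂ) j Complex.I i) = 1 := by
    intro i
    by_cases hi : i = j
    · subst hi; simp
    · simp [Function.update_of_ne hi]
  have hw : ∀ (b : Bool) (h : Fin n → Fin 3) (M : Finset (Fin n)),
      pull D (mono b h M) = wt b (h j) Complex.I • mono b h M := by
    intro b h M
    rw [hD, pull_diagMap_mono]
    congr 1
    rw [Finset.prod_eq_single j]
    · simp [Complex.normSq_I]
    · intro i _ hi
      rw [Function.update_of_ne hi]
      simp [wt]
    · simp
  have he : pull D (evenProd α β) = evenProd α β := by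
    rw [evenProd, oprod, map_list_prod, List.map_ofFn]
    congr 2
    ext1 i
    simp [hD, pull_diagMap_area, hns]
  have h1 := top_pull D (mono false h M * mono true h' M' * evenProd α β)
  rw [map_mul (pull D), map_mul (pull D), hw, hw, he, hD, det_diagMap, smul_mul_smul_comm, smul_mul_assoc,
    map_smul] at h1
  simp only [hns, Finset.prod_const_one, Complex.ofReal_one, one_mul, smul_eq_mul] at h1
  have h2 : wt false (h j) Complex.I * wt true (h' j) Complex.I ≠ 1 := by
    generalize h j = s at hj ⊢
    generalize h' j = t at hj ⊢
    fin_cases s <;> fin_cases t <;> simp [wt, Complex.ext_iff] at hj ⊢ <;> norm_num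
  have h3 : (wt false (h j) Complex.I * wt true (h' j) Complex.I - 1) *
      top n (mono false h M * mono true h' M' * evenProd α β) = 0 := by linear_combination h1
  exact (mul_eq_zero.mp h3).resolve_left (sub_ne_zero.mpr h2)

/-- The coefficient of `dx_j ∧ dy_j` in the product of an odd part and its conjugate. -/
def oddCoeff (t : Fin 3) : ℂ :=
  if t = 0 then 1 else if t = 1 then -2 * Complex.I else 2 * Complex.I

/-- After interleaving, the coordinates decouple: in each one either the odd parts combine to a
multiple of the area, or the area must come from exactly one of `M`, `M'` and the even product. -/
theorem top_mono_mul_mono (h : Fin n → Fin 3) (M M' : Finset (Fin n))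
    (hM : M ⊆ evenSet h) (hM' : M' ⊆ evenSet h) (α β : Fin n → ℂ) :
    top n (mono false h M * mono true h M' * evenProd α β) =
      revSign (∑ j, par (h j)) * ∏ j, (if h j = 0 then
        (if j ∈ M then (if j ∈ M' then 0 else α j) else if j ∈ M' then α j else β j)
        else oddCoeff (h j) * α j) := by
  rw [mono, mono, oprod_mul_oprod _ _ (fun j => par (h j)), smul_mul_assoc, map_smul, smul_eq_mul,
    evenProd, oprod_mul_of_commute]
  · congr 1
    rw [← top_oprod (fun j => if h j = 0 then
        (if j ∈ M then 0 else if j ∈ M' then 0 else α j) else 0)]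
    congr 2
    ext1 j
    by_cases h0 : h j = 0
    · have h1 : ∀ b, oddPart b (h j) j = (1 : Ext n) := fun b => by simp [oddPart, h0]
      rw [h1, h1]
      by_cases hjM : j ∈ M <;> by_cases hjM' : j ∈ M' <;>
        simp [h0, hjM, hjM', mul_add, area_mul_self, ← mul_assoc, Algebra.smul_def,
          Algebra.commutes]
    · have hjM : j ∉ M := fun hh => h0 (by simpa [evenSet] using hM hh)
      have hjM' : j ∉ M' := fun hh => h0 (by simpa [evenSet] using hM' hh)
      have h1 : oddPart false (h j) j * oddPart true (h j) j = oddCoeff (h j) • area j := by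
        generalize h j = s at h0 ⊢
        fin_cases s
        · simp at h0
        · have := cz_mul_cz_not false j
          simpa [oddPart, oddCoeff] using this
        · have := cz_mul_cz_not true j
          simpa [oddPart, oddCoeff] using this
      simp only [hjM, hjM', if_false, mul_one, h1, h0, map_zero, zero_add]
      rw [mul_add, smul_mul_smul_comm, area_mul_self, smul_zero, add_zero,
        ← Algebra.commutes, ← Algebra.smul_def, smul_smul, mul_comm]
  · intro i j _
    exact (evenFactor_comm _ _ _ _).symm
  · intro i; simp only [par]; split_ifs <;> simp
  · intro i j _
    have hh : ∀ (N N' : Finset (Fin n)) (k l : Fin n) (X Y : Ext n),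
        X * (if k ∈ N then area k else 1) * (Y * if l ∈ N' then area l else 1) =
        X * Y * ((if k ∈ N then area k else 1) * if l ∈ N' then area l else 1) := by
      intro N N' k l X Y
      rw [mul_assoc, ← mul_assoc _ Y, commute_evenFactor N k Y, mul_assoc, mul_assoc]
    rw [hh, hh, oddPart_mul_oddPart, smul_mul_assoc,
      commute_evenFactor M i (if j ∈ M' then area j else 1)]

open ExteriorAlgebra

variable {n : ℕ}

/-! ### Expansion in monomials -/

/-- The complex conjugate of a form. -/
def conjForm {k : ℕ} (φ : Cn n [⋀^Fin k]→ₗ[ℝ] ℂ) : Cn n [⋀^Fin k]→ₗ[ℝ] ℂ :=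
  Complex.conjAe.toLinearMap.compAlternatingMap φ

theorem conjForm_apply {k : ℕ} (φ : Cn n [⋀^Fin k]→ₗ[ℝ] ℂ) (v : Fin k → Cn n) :
    conjForm φ v = conj (φ v) := rfl

/-- Conjugation for `b = true`, the identity otherwise. -/
def conjIf (b : Bool) (c : ℂ) : ℂ := if b then conj c else c

/-- `F` and `F'` are conjugate: they have conjugate expansions in conjugate monomials. -/
def IsConjPair (F : Bool → Ext n) : Prop :=
  ∃ c : (Fin n → Fin 3) → Finset (Fin n) → ℂ, ∀ b,
    F b = ∑ h, ∑ M, conjIf b (c h M) • mono b h M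

theorem isConjPair_mono (c : ℂ) (h : Fin n → Fin 3) (M : Finset (Fin n)) :
    IsConjPair fun b => conjIf b c • mono b h M := by
  classical
  refine ⟨fun h' M' => if h' = h ∧ M' = M then c else 0, fun b => ?_⟩
  rw [Finset.sum_eq_single h, Finset.sum_eq_single M]
  · simp
  · intro M' _ hM'; cases b <;> simp [hM', conjIf]
  · simp
  · intro h' _ hh'
    refine Finset.sum_eq_zero fun M' _ => ?_
    cases b <;> simp [hh', conjIf]
  · simp

theorem IsConjPair.add {F G : Bool → Ext n} (hF : IsConjPair F) (hG : IsConjPair G) :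
    IsConjPair fun b => F b + G b := by
  obtain ⟨c, hc⟩ := hF
  obtain ⟨d, hd⟩ := hG
  refine ⟨fun h M => c h M + d h M, fun b => ?_⟩
  have : ∀ x y, conjIf b (x + y) = conjIf b x + conjIf b y := by
    intro x y; cases b <;> simp [conjIf]
  simp only [hc, hd, this, add_smul, Finset.sum_add_distrib]

theorem IsConjPair.smul {F : Bool → Ext n} (hF : IsConjPair F) (a : ℂ) :
    IsConjPair fun b => conjIf b a • F b := by
  obtain ⟨c, hc⟩ := hF
  refine ⟨fun h M => a * c h M, fun b => ?_⟩
  have : ∀ x y, conjIf b (x * y) = conjIf b x * conjIf b y := by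
    intro x y; cases b <;> simp [conjIf]
  simp only [hc, this, mul_smul, Finset.smul_sum]

theorem isConjPair_zero : IsConjPair fun _ => (0 : Ext n) :=
  ⟨fun _ _ => 0, fun b => by cases b <;> simp [conjIf]⟩

theorem IsConjPair.sum {ι : Type*} (s : Finset ι) {F : ι → Bool → Ext n}
    (hF : ∀ i, IsConjPair (F i)) : IsConjPair fun b => ∑ i ∈ s, F i b := by
  classical
  induction s using Finset.induction_on with
  | empty => simpa using isConjPair_zero
  | insert i s hi ih =>
    simp only [Finset.sum_insert hi]
    exact (hF i).add ih

/-- The multiplication table in one coordinate: squares vanish, `dz ∧ dz̄` is a multiple of the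
area, and the area annihilates odd factors. A single constant serves both values of `b`, since the
constant for the conjugate product is the conjugate. -/
theorem oddPart_mul_local (t s : Fin 3) (ht : t ≠ 0) (a : Prop) [Decidable a] (j : Fin n) :
    ∃ (c : ℂ) (t' : Fin 3) (a' : Bool), ∀ b,
      oddPart b t j * (oddPart b s j * if a then area j else 1) =
        conjIf b c • (oddPart b t' j * if a' then area j else (1 : Ext n)) := by
  by_cases ha : a
  · refine ⟨0, 0, false, fun b => ?_⟩
    have : ∀ b : Bool, cz b j * area j = (0 : Ext n) := fun b => cz_mul_area_self b j
    have h2 : oddPart b t j * area j = 0 := by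
      fin_cases t
      · simp at ht
      · simp [oddPart, this]
      · simp [oddPart, this]
    rw [if_pos ha, ← area_comm, ← mul_assoc, h2]
    cases b <;> simp [conjIf]
  · simp only [if_neg ha, mul_one]
    by_cases hs : s = 0
    · refine ⟨1, t, false, fun b => ?_⟩
      subst hs
      cases b <;> simp [conjIf, oddPart]
    · by_cases hst : s = t
      · refine ⟨0, 0, false, fun b => ?_⟩
        subst hst
        have h2 : oddPart b s j * oddPart b s j = (0 : Ext n) := by
          fin_cases s
          · simp at hs
          · simp [oddPart, cz_mul_self]
          · simp [oddPart, cz_mul_self]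
        rw [h2]
        cases b <;> simp [conjIf]
      · refine ⟨oddCoeff t, 0, true, fun b => ?_⟩
        have h1 := fun b => cz_mul_cz_not b j
        have hf := h1 false
        have htr := h1 true
        have h2 : conj (2 : ℂ) = 2 := map_ofNat _ 2
        simp only [Bool.not_true, Bool.not_false, Bool.false_eq_true, if_true, if_false] at hf htr
        fin_cases s <;> fin_cases t <;> simp at hs ht hst ⊢ <;> cases b <;>
          simp [oddPart, conjIf, oddCoeff, hf, htr, h2]

theorem oddPart_mul_mono (t : Fin 3) (ht : t ≠ 0) (j : Fin n) (h : Fin n → Fin 3)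
    (M : Finset (Fin n)) : ∃ (c : ℂ) (h' : Fin n → Fin 3) (M' : Finset (Fin n)), ∀ b,
      oddPart b t j * mono b h M = conjIf b c • mono b h' M' := by
  classical
  obtain ⟨c, t', a', hc⟩ := oddPart_mul_local t (h j) ht (j ∈ M) j
  refine ⟨(∏ i with i < j, (-1 : ℂ) ^ (par t * par (h i))) * c, Function.update h j t',
    if a' then insert j M else M.erase j, fun b => ?_⟩
  have hsgn : conjIf b ((∏ i with i < j, (-1 : ℂ) ^ (par t * par (h i))) * c) =
      (∏ i with i < j, (-1 : ℂ) ^ (par t * par (h i))) * conjIf b c := by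
    cases b <;> simp [conjIf, map_prod]
  rw [hsgn, mono, mul_oprod_of_skew _ _ (fun i => (-1 : ℂ) ^ (par t * par (h i))) j]
  · rw [mul_smul, hc b]
    congr 1
    have := (MultilinearMap.mkPiAlgebraFin ℂ n (Ext n)).map_update_smul
      (fun j => oddPart b (h j) j * if j ∈ M then area j else 1) j (conjIf b c)
      (oddPart b t' j * if a' then area j else (1 : Ext n))
    simp only [MultilinearMap.mkPiAlgebraFin_apply] at this
    rw [oprod, this, mono, oprod]
    congr 3
    ext i
    by_cases hi : i = j
    · subst hi
      cases a' <;> simp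
    · rw [Function.update_of_ne hi, Function.update_of_ne hi]
      cases a' <;> simp [hi]
  · intro i _
    rw [← mul_assoc, oddPart_mul_oddPart, smul_mul_assoc, mul_assoc, ← commute_evenFactor,
      ← mul_assoc]

theorem IsConjPair.oddPart_mul {F : Bool → Ext n} (hF : IsConjPair F) (t : Fin 3) (ht : t ≠ 0)
    (j : Fin n) : IsConjPair fun b => oddPart b t j * F b := by
  obtain ⟨c, hc⟩ := hF
  have : (fun b => oddPart b t j * F b) = fun b => ∑ h, ∑ M,
      conjIf b (c h M) • (oddPart b t j * mono b h M) := by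
    ext1 b
    rw [hc b]
    simp only [Finset.mul_sum, mul_smul_comm]
  rw [this]
  refine IsConjPair.sum _ fun h => IsConjPair.sum _ fun M => ?_
  obtain ⟨d, h', M', hd⟩ := oddPart_mul_mono t ht j h M
  simp only [hd]
  exact (isConjPair_mono d h' M').smul (c h M)

/-- Real covectors are their own conjugates: `dx` and `dy` are combinations of `dz` and `dz̄` with
conjugate coefficients. Multiplying them out one at a time keeps the expansions for `b` false and
true conjugate to each other. -/
theorem isConjPair_coframes {k : ℕ} (a : Fin k → Idx n) : IsConjPair fun _ => coframes a := by
  induction k with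
  | zero =>
    convert isConjPair_mono (n := n) 1 0 ∅ using 2 with b
    have : mono b (0 : Fin n → Fin 3) ∅ = 1 := by
      rw [mono, oprod, List.prod_eq_one]
      intro x hx
      obtain ⟨i, rfl⟩ := (List.mem_ofFn' _ _).mp hx
      simp [oddPart]
    rw [this]
    cases b <;> simp [conjIf, coframes]
  | succ k ih =>
    have h1 := (ih (fun l => a l.succ)).oddPart_mul 1 (by simp) (a 0).1
    have h2 := (ih (fun l => a l.succ)).oddPart_mul 2 (by simp) (a 0).1
    rcases ha : a 0 with ⟨j, s⟩
    simp only [ha] at h1 h2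
    fin_cases s
    · convert (h1.smul (1 / 2)).add (h2.smul (1 / 2)) using 2 with b
      rw [coframes_cons, ha]
      simp only [Fin.zero_eta, coframe_zero_eq]
      cases b
      · simp [conjIf, oddPart, add_mul]
      · simp [conjIf, oddPart, add_mul, add_comm, show conj (2 : ℂ) = 2 from map_ofNat _ 2]
    · convert (h1.smul (-Complex.I / 2)).add (h2.smul (Complex.I / 2)) using 2 with b
      rw [coframes_cons, ha]
      simp only [Fin.mk_one, coframe_one_eq]
      cases b
      · simp [conjIf, oddPart, add_mul]
      · simp [conjIf, oddPart, add_mul, add_comm, show conj (2 : ℂ) = 2 from map_ofNat _ 2]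

theorem isConjPair_toExt {k : ℕ} (φ : Cn n [⋀^Fin k]→ₗ[ℝ] ℂ) :
    IsConjPair fun b => toExt n k (if b then conjForm φ else φ) := by
  have := (IsConjPair.sum Finset.univ fun a : Fin k → Idx n =>
    (isConjPair_coframes a).smul (φ fun l => stdFrame n (a l))).smul (k.factorial : ℂ)⁻¹
  convert this using 2 with b
  cases b
  · simp [toExt_apply, conjIf]
  · simp [toExt_apply, conjIf, conjForm_apply]

theorem mono_eq_zero (b : Bool) {h : Fin n → Fin 3} {M : Finset (Fin n)}
    (hM : ¬ M ⊆ evenSet h) : mono b h M = 0 := by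
  obtain ⟨j, hj, hj'⟩ := Finset.not_subset.mp hM
  refine oprod_eq_zero _ j ?_
  have : h j ≠ 0 := by simpa [evenSet] using hj'
  rw [if_pos hj]
  generalize h j = t at this
  fin_cases t
  · simp at this
  · simp [oddPart, cz_mul_area_self]
  · simp [oddPart, cz_mul_area_self]

/-- The expansion only involves monomials that are not trivially zero. -/
theorem exists_expansion {k : ℕ} (φ : Cn n [⋀^Fin k]→ₗ[ℝ] ℂ) :
    ∃ c : (Fin n → Fin 3) → Finset (Fin n) → ℂ, (∀ h M, c h M ≠ 0 → M ⊆ evenSet h) ∧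
      toExt n k φ = ∑ h, ∑ M, c h M • mono false h M ∧
      toExt n k (conjForm φ) = ∑ h, ∑ M, conj (c h M) • mono true h M := by
  classical
  obtain ⟨c, hc⟩ := isConjPair_toExt φ
  refine ⟨fun h M => if M ⊆ evenSet h then c h M else 0, fun h M => ?_, ?_, ?_⟩
  · intro hne
    by_contra hM
    simp [hM] at hne
  · have := hc false
    simp only [Bool.false_eq_true, if_false] at this
    rw [this]
    refine Finset.sum_congr rfl fun h _ => Finset.sum_congr rfl fun M _ => ?_
    by_cases hM : M ⊆ evenSet h
    · simp [hM, conjIf]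
    · simp [mono_eq_zero _ hM]
  · have := hc true
    simp only [if_true] at this
    rw [this]
    refine Finset.sum_congr rfl fun h _ => Finset.sum_congr rfl fun M _ => ?_
    by_cases hM : M ⊆ evenSet h
    · simp [hM, conjIf]
    · simp [mono_eq_zero _ hM]

open ExteriorAlgebra

variable {n : ℕ}

/-! ### The Hodge–Riemann relation -/

/-- The standard Kähler form `∑ dx_j ∧ dy_j`. -/
def stdOmega (n : ℕ) : Ext n := ∑ j, area j

theorem stdOmega_comm (y : Ext n) : stdOmega n * y = y * stdOmega n := by
  simp only [stdOmega, Finset.sum_mul, Finset.mul_sum, area_comm]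

/-- For an element of square zero the exponential is `1 + y`, and exponentials of commuting
nilpotents multiply. -/
theorem oprod_one_add_eq_exp {A : Type*} [Ring A] [Algebra ℚ A] {m : ℕ} (y : Fin m → A)
    (hc : ∀ i j, Commute (y i) (y j)) (hy : ∀ i, y i * y i = 0) :
    IsNilpotent (∑ i, y i) ∧ oprod (fun i => 1 + y i) = IsNilpotent.exp (∑ i, y i) := by
  induction m with
  | zero => simp [oprod, IsNilpotent.exp_zero]
  | succ m ih =>
    obtain ⟨h1, h2⟩ := ih (fun i => y i.succ) (fun i j => hc _ _) (fun i => hy _)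
    have h0 : IsNilpotent (y 0) := ⟨2, by rw [pow_two, hy]⟩
    have hcomm : Commute (y 0) (∑ i : Fin m, y i.succ) :=
      Commute.sum_right _ _ _ fun i _ => hc _ _
    rw [Fin.sum_univ_succ, oprod_succ, h2, IsNilpotent.exp_add_of_commute hcomm h0 h1]
    refine ⟨hcomm.isNilpotent_add h0 h1, ?_⟩
    congr 1
    rw [IsNilpotent.exp_eq_sum (k := 2) (by rw [pow_two, hy])]
    simp [Finset.sum_range_succ]

theorem evenProd_one_zero : evenProd 1 0 = (1 : Ext n) := by
  rw [evenProd, oprod, List.prod_eq_one]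
  intro x hx
  obtain ⟨i, rfl⟩ := (List.mem_ofFn' _ _).mp hx
  simp

/-- The even product is `exp ω`, and primitivity truncates the exponential series after its linear
term. This replaces multiplication by the sum `ω` by multiplication by a product, whose top
coefficients are explicit. -/
theorem mul_evenProd_one_one {F : Ext n} (hF : F * stdOmega n ^ 2 = 0) :
    F * evenProd 1 1 = F + F * stdOmega n := by
  let _ : Algebra ℚ (Ext n) := Algebra.compHom (Ext n) (algebraMap ℚ ℂ)
  obtain ⟨⟨N, hN⟩, h2⟩ := oprod_one_add_eq_exp (fun j : Fin n => (area j : Ext n))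
    (fun i j => area_comm i _) area_mul_self
  have h3 : evenProd 1 1 = oprod (fun j : Fin n => 1 + (area j : Ext n)) := by
    simp [evenProd]
  have hN' : stdOmega n ^ (N + 2) = 0 := by rw [stdOmega, pow_add, hN, zero_mul]
  rw [h3, h2, ← stdOmega, IsNilpotent.exp_eq_sum hN', Finset.mul_sum, Finset.sum_range_succ',
    Finset.sum_range_succ', Finset.sum_eq_zero]
  · simp [add_comm]
  · intro i _
    rw [mul_smul_comm, add_assoc, one_add_one_eq_two, pow_add, ← (Commute.pow_pow_self _ _ _).eq,
      ← mul_assoc, hF, zero_mul, smul_zero]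

/-- The dilation by `2` has real determinant `2^(2n)`, so it detects the degree. -/
theorem top_eq_zero_of_weight {y : Ext n} {d : ℕ}
    (hy : pull (diagMap fun _ => 2) y = (2 : ℂ) ^ d • y) (hd : d ≠ 2 * n) : top n y = 0 := by
  have h := top_pull (diagMap fun _ : Fin n => (2 : ℂ)) y
  rw [hy, map_smul, det_diagMap, smul_eq_mul] at h
  have h4 : (∏ _j : Fin n, Complex.normSq 2) = (2 : ℝ) ^ (2 * n) := by
    rw [Finset.prod_const, Finset.card_univ, Fintype.card_fin, pow_mul]
    congr 1
    norm_num [Complex.normSq_apply]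
  rw [h4] at h
  push_cast at h
  have h5 : ((2 : ℂ) ^ d - 2 ^ (2 * n)) * top n y = 0 := by linear_combination h
  refine (mul_eq_zero.mp h5).resolve_left fun h6 => hd ?_
  have h7 : (2 : ℕ) ^ d = 2 ^ (2 * n) := by exact_mod_cast sub_eq_zero.mp h6
  exact Nat.pow_right_injective le_rfl h7

theorem pull_diagMap_toExt {k : ℕ} (φ : Cn n [⋀^Fin k]→ₗ[ℝ] ℂ) (c a : ℂ)
    (h : ∀ v : Fin k → Cn n, φ (fun i => c • v i) = a * φ v) :
    pull (diagMap fun _ => c) (toExt n k φ) = a • toExt n k φ := by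
  rw [← toExt_compLinearMap, ← map_smul]
  congr 1
  ext v
  have : ∀ w : Cn n, diagMap (fun _ => c) w = c • w := by
    intro w; ext j; simp [diagMap_apply]
  simp only [AlternatingMap.compLinearMap_apply, AlternatingMap.smul_apply, this, smul_eq_mul, h]

theorem pull_two_toExt {k : ℕ} (φ : Cn n [⋀^Fin k]→ₗ[ℝ] ℂ) :
    pull (diagMap fun _ => 2) (toExt n k φ) = (2 : ℂ) ^ k • toExt n k φ := by
  refine pull_diagMap_toExt φ 2 _ fun v => ?_
  have := φ.map_smul_univ (fun _ => (2 : ℝ)) v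
  have h2 : ∀ w : Cn n, (2 : ℂ) • w = (2 : ℝ) • w := fun w => by
    rw [← Complex.coe_smul]; norm_num
  simp only [h2]
  rw [this]
  simp

theorem pull_two_stdOmega : pull (diagMap fun _ => 2) (stdOmega n) = (2 : ℂ) ^ 2 • stdOmega n := by
  simp only [stdOmega, map_sum, pull_diagMap_area, Finset.smul_sum]
  refine Finset.sum_congr rfl fun j _ => ?_
  congr 1
  norm_num [Complex.normSq_apply]

theorem pull_const_mono (c : ℂ) (b : Bool) (h : Fin n → Fin 3) (M : Finset (Fin n)) :
    pull (diagMap fun _ => c) (mono b h M) =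
      ((∏ j, wt b (h j) c) * (Complex.normSq c : ℂ) ^ M.card) • mono b h M := by
  rw [pull_diagMap_mono, Finset.prod_mul_distrib, Finset.prod_ite_mem]
  simp

theorem pull_two_mono (b : Bool) (h : Fin n → Fin 3) (M : Finset (Fin n)) :
    pull (diagMap fun _ => 2) (mono b h M) =
      (2 : ℂ) ^ ((∑ j, par (h j)) + 2 * M.card) • mono b h M := by
  rw [pull_const_mono, pow_add, ← Finset.prod_pow_eq_pow_sum, pow_mul]
  congr 2
  · refine Finset.prod_congr rfl fun j _ => ?_
    generalize h j = t
    have h2 : conj (2 : ℂ) = 2 := map_ofNat _ 2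
    fin_cases t <;> cases b <;> simp [wt, par, h2]
  · norm_num [Complex.normSq_apply]

/-- The constant in the Hodge–Riemann relation. -/
def hrSign (p q : ℕ) : ℂ := revSign (p + q) * ((-Complex.I) ^ p * Complex.I ^ q)

theorem hrSign_ne_zero (p q : ℕ) : hrSign p q ≠ 0 := by
  simp [hrSign, revSign_ne_zero]

theorem card_evenSet_add (h : Fin n → Fin 3) : (evenSet h).card + ∑ j, par (h j) = n := by
  have : (evenSet h).card = ∑ j, if h j = 0 then 1 else 0 := by
    rw [evenSet, Finset.card_filter]
  rw [this, ← Finset.sum_add_distrib]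
  have : ∀ j, (if h j = 0 then 1 else 0) + par (h j) = 1 := by
    intro j; unfold par; split_ifs <;> rfl
  simp [this]

theorem prod_oddCoeff (h : Fin n → Fin 3) :
    ∏ j, oddCoeff (h j) = 2 ^ (∑ j, par (h j)) * ∏ j, wt true (h j) Complex.I := by
  rw [← Finset.prod_pow_eq_pow_sum, ← Finset.prod_mul_distrib]
  refine Finset.prod_congr rfl fun j _ => ?_
  generalize h j = t
  fin_cases t <;> simp [oddCoeff, par, wt]

theorem prod_oddCoeff_ne_zero (h : Fin n → Fin 3) : ∏ j, oddCoeff (h j) ≠ 0 := by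
  refine Finset.prod_ne_zero_iff.mpr fun j _ => ?_
  generalize h j = t
  fin_cases t <;> simp [oddCoeff]

/-- Pairing an expansion with a monomial only sees the monomials with the same odd part. -/
theorem top_expansion_mul (c : (Fin n → Fin 3) → Finset (Fin n) → ℂ)
    (h : Fin n → Fin 3) (K : Finset (Fin n)) (α β : Fin n → ℂ) :
    top n ((∑ h, ∑ M, c h M • mono false h M) * mono true h K * evenProd α β) =
      ∑ M, c h M * top n (mono false h M * mono true h K * evenProd α β) := by
  simp only [Finset.sum_mul, smul_mul_assoc, map_sum, map_smul, smul_eq_mul]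
  rw [Finset.sum_eq_single h]
  · intro h' _ hh'
    exact Finset.sum_eq_zero fun M _ => by rw [top_mono_mul_mono_of_ne hh', mul_zero]
  · simp

/-- With all parameters equal to one, an even coordinate contributes `0` if it lies in both `M` and
`K`, since areas square to zero, and `1` otherwise. -/
theorem top_expansion_mul_disjoint (c : (Fin n → Fin 3) → Finset (Fin n) → ℂ)
    (hc : ∀ h M, c h M ≠ 0 → M ⊆ evenSet h) (h : Fin n → Fin 3) (K : Finset (Fin n))
    (hK : K ⊆ evenSet h) :
    top n ((∑ h, ∑ M, c h M • mono false h M) * mono true h K * evenProd 1 1) =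
      revSign (∑ j, par (h j)) * (∏ j, oddCoeff (h j)) *
        ∑ M, if Disjoint M K then c h M else 0 := by
  rw [top_expansion_mul, Finset.mul_sum]
  refine Finset.sum_congr rfl fun M _ => ?_
  by_cases h0 : c h M = 0
  · simp [h0]
  rw [top_mono_mul_mono _ _ _ (hc h M h0) hK]
  split_ifs with hd
  · rw [mul_comm]
    congr 2
    refine Finset.prod_congr rfl fun j _ => ?_
    by_cases hj : h j = 0
    · by_cases hjM : j ∈ M
      · have := Finset.disjoint_left.mp hd hjM
        simp [hj, hjM, this, oddCoeff]
      · simp [hj, hjM, oddCoeff]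
    · simp [hj]
  · obtain ⟨j, hjM, hjK⟩ := Finset.not_disjoint_iff.mp hd
    have hj : h j = 0 := by simpa [evenSet] using hK hjK
    rw [Finset.prod_eq_zero (Finset.mem_univ j) (by simp [hj, hjM, hjK])]
    simp

/-- Without the even product, every even coordinate must be filled exactly once, so the
complementary monomial picks out a single coefficient of the expansion. -/
theorem top_expansion_mul_compl (c : (Fin n → Fin 3) → Finset (Fin n) → ℂ)
    (hc : ∀ h M, c h M ≠ 0 → M ⊆ evenSet h) (h : Fin n → Fin 3) (K : Finset (Fin n))
    (hK : K ⊆ evenSet h) :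
    top n ((∑ h, ∑ M, c h M • mono false h M) * mono true h (evenSet h \ K)) =
      revSign (∑ j, par (h j)) * (∏ j, oddCoeff (h j)) * c h K := by
  have h1 := top_expansion_mul c h (evenSet h \ K) 1 0
  rw [evenProd_one_zero, mul_one] at h1
  simp only [mul_one] at h1
  rw [h1, Finset.sum_eq_single K]
  · have h2 := top_mono_mul_mono h K (evenSet h \ K) hK Finset.sdiff_subset 1 0
    rw [evenProd_one_zero, mul_one] at h2
    rw [h2, mul_comm]
    congr 2
    refine Finset.prod_congr rfl fun j _ => ?_
    by_cases hj : h j = 0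
    · have hj' : j ∈ evenSet h := by simp [evenSet, hj]
      by_cases hjK : j ∈ K <;> simp [hj, hjK, hj', oddCoeff]
    · simp [hj]
  · intro M _ hMK
    by_cases h0 : c h M = 0
    · simp [h0]
    have h2 := top_mono_mul_mono h M (evenSet h \ K) (hc h M h0) Finset.sdiff_subset 1 0
    rw [evenProd_one_zero, mul_one] at h2
    rw [h2]
    obtain ⟨j, hj⟩ : ∃ j, ¬ (j ∈ M ↔ j ∈ K) := by
      by_contra! hh; exact hMK (Finset.ext hh)
    have hj' : j ∈ evenSet h := by
      by_cases hjM : j ∈ M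
      · exact hc h M h0 hjM
      · exact hK (by tauto)
    have hj0 : h j = 0 := by simpa [evenSet] using hj'
    rw [Finset.prod_eq_zero (Finset.mem_univ j), mul_zero, mul_zero]
    by_cases hjM : j ∈ M <;> by_cases hjK : j ∈ K <;> simp_all
  · simp

/-- The Hodge–Riemann relation for primitive forms of degree `n - 1`. -/
theorem hodge_riemann {p q : ℕ} (hn : p + q + 1 = n) (φ : Cn n [⋀^Fin (p + q)]→ₗ[ℝ] ℂ)
    (hb : IsBidegree p q φ) (hp : toExt n _ φ * stdOmega n ^ 2 = 0) :
    ∃ R : ℝ, 0 ≤ R ∧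
      top n (toExt n _ φ * toExt n _ (conjForm φ) * stdOmega n) = hrSign p q * R ∧
      (R = 0 → φ = 0) := by
  obtain ⟨c, hc, hF, hF'⟩ := exists_expansion φ
  set F := toExt n (p + q) φ with hFdef
  have hE := mul_evenProd_one_one hp
  have hκ : ∀ h : Fin n → Fin 3, revSign (∑ j, par (h j)) * ∏ j, oddCoeff (h j) ≠ 0 := fun h =>
    mul_ne_zero (revSign_ne_zero _) (prod_oddCoeff_ne_zero h)
  have hF2 : pull (diagMap fun _ => 2) F = (2 : ℂ) ^ (p + q) • F := pull_two_toExt φ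
  -- A nonzero coefficient gives a nonzero top pairing with the complementary monomial. Comparing
  -- weights under the dilation by `2` yields the degree; comparing them under multiplication by `i`
  -- yields the part of the bidegree that fixes the sign.
  have hsupp : ∀ h M, c h M ≠ 0 → (∑ j, par (h j)) + 2 * M.card = p + q ∧
      (∏ j, wt true (h j) Complex.I) = (-Complex.I) ^ p * Complex.I ^ q := by
    intro h M hcM
    have hM := hc h M hcM
    have h1 := top_expansion_mul_compl c hc h M hM
    rw [← hF] at h1
    have hne : top n (F * mono true h (evenSet h \ M)) ≠ 0 := by
      rw [h1]; exact mul_ne_zero (hκ h) hcM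
    have hcard := card_evenSet_add h
    have hcardM : (evenSet h \ M).card + M.card = (evenSet h).card :=
      Finset.card_sdiff_add_card_eq_card hM
    constructor
    · by_contra hne'
      refine hne (top_eq_zero_of_weight
        (d := p + q + ((∑ j, par (h j)) + 2 * (evenSet h \ M).card)) ?_ ?_)
      · rw [map_mul, hF2, pull_two_mono, smul_mul_smul_comm, ← pow_add]
      · omega
    · have hFI := pull_diagMap_toExt φ Complex.I _ (hb Complex.I)
      have h2 := top_pull (diagMap fun _ : Fin n => Complex.I) (F * mono true h (evenSet h \ M))
      rw [map_mul, hFI, pull_const_mono, smul_mul_smul_comm, map_smul, det_diagMap] at h2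
      simp only [Complex.normSq_I, Finset.prod_const_one, Complex.ofReal_one, one_pow, mul_one,
        one_mul, smul_eq_mul, Complex.conj_I] at h2
      have h3 := mul_right_cancel₀ hne (h2.trans (one_mul _).symm)
      have h4 : (-Complex.I) ^ p * Complex.I ^ q * (Complex.I ^ p * (-Complex.I) ^ q) = 1 := by
        have : (-Complex.I) ^ p * Complex.I ^ q * (Complex.I ^ p * (-Complex.I) ^ q) =
            (-Complex.I * Complex.I) ^ p * (Complex.I * -Complex.I) ^ q := by
          rw [mul_pow, mul_pow]; ring
        rw [this]
        simp
      calc _ = (-Complex.I) ^ p * Complex.I ^ q * (Complex.I ^ p * (-Complex.I) ^ q) *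
            ∏ j, wt true (h j) Complex.I := by rw [h4, one_mul]
        _ = _ := by rw [mul_assoc, h3, mul_one]
  -- By primitivity, only the degrees of `F ∧ m` and `F ∧ ω ∧ m` occur for the monomial `m`, and
  -- under the bound on `K` both stay below `2n`.
  have hP0 : ∀ (h : Fin n → Fin 3) (K : Finset (Fin n)),
      (∑ j, par (h j)) + 2 * K.card < p + q → top n (F * mono true h K * evenProd 1 1) = 0 := by
    intro h K hK
    rw [mul_assoc, ← evenProd_comm, ← mul_assoc, hE, add_mul, map_add]
    rw [top_eq_zero_of_weight (d := p + q + ((∑ j, par (h j)) + 2 * K.card)),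
      top_eq_zero_of_weight (d := p + q + 2 + ((∑ j, par (h j)) + 2 * K.card)), add_zero]
    · rw [map_mul, map_mul, hF2, pull_two_mono, pull_two_stdOmega, smul_mul_smul_comm,
        smul_mul_smul_comm, ← pow_add, ← pow_add]
    · omega
    · rw [map_mul, hF2, pull_two_mono, smul_mul_smul_comm, ← pow_add]
    · omega
  have hterm : ∀ h K, conj (c h K) * top n (F * mono true h K * evenProd 1 1) =
      hrSign p q * ((2 ^ (∑ j, par (h j)) * Complex.normSq (c h K) : ℝ) : ℂ) := by
    intro h K
    by_cases h0 : c h K = 0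
    · simp [h0]
    obtain ⟨hdeg, hW⟩ := hsupp h K h0
    -- All sets `M` with a nonzero coefficient for this `h` have the same size, because the total
    -- degree is fixed; `hP0` supplies the vanishing for smaller sets.
    have hC := sum_disjoint_eq_sign_smul (m := K.card) (evenSet h) (c h)
      (fun M hM => by have := (hsupp h M hM).1; omega)
      (fun R hR hRm => by
        have h1 := top_expansion_mul_disjoint c hc h R hR
        rw [← hF, hP0 h R (by omega)] at h1
        exact (mul_eq_zero.mp h1.symm).resolve_left (hκ h)) K (hc h K h0) rfl
    have h1 := top_expansion_mul_disjoint c hc h K (hc h K h0)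
    rw [← hF, hC] at h1
    rw [h1, prod_oddCoeff, hW, hrSign, ← hdeg, revSign_add_two_mul]
    have h2 : conj (c h K) * c h K = (Complex.normSq (c h K) : ℂ) := by
      rw [mul_comm, Complex.mul_conj]
    push_cast
    rw [← h2]
    ring
  -- The term without `ω` has degree `2(n - 1)`, so replacing `ω` by `exp ω` does not change the top
  -- coefficient.
  have hQ : top n (F * toExt n _ (conjForm φ) * stdOmega n) =
      top n (F * toExt n _ (conjForm φ) * evenProd 1 1) := by
    have e1 : F * toExt n _ (conjForm φ) * evenProd 1 1 =
        F * toExt n _ (conjForm φ) + F * toExt n _ (conjForm φ) * stdOmega n := by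
      rw [mul_assoc, ← evenProd_comm, ← mul_assoc, hE, add_mul, mul_assoc, mul_assoc F,
        stdOmega_comm]
    rw [e1, map_add, top_eq_zero_of_weight (y := F * toExt n _ (conjForm φ)) (d := p + q + (p + q)), zero_add]
    · rw [map_mul, hF2, pull_two_toExt, smul_mul_smul_comm, ← pow_add]
    · omega
  refine ⟨∑ h, ∑ K, 2 ^ (∑ j, par (h j)) * Complex.normSq (c h K), ?_, ?_, ?_⟩
  · exact Finset.sum_nonneg fun h _ => Finset.sum_nonneg fun K _ =>
      mul_nonneg (by positivity) (Complex.normSq_nonneg _)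
  · rw [hQ, hF']
    simp only [Finset.mul_sum, Finset.sum_mul, mul_smul_comm, smul_mul_assoc, map_sum, map_smul,
      smul_eq_mul]
    push_cast
    simp only [Finset.mul_sum]
    refine Finset.sum_congr rfl fun h _ => Finset.sum_congr rfl fun K _ => ?_
    rw [hterm h K]
    push_cast
    rfl
  · intro hR
    have hz : ∀ h K, c h K = 0 := by
      intro h K
      have h1 := (Finset.sum_eq_zero_iff_of_nonneg fun h _ => Finset.sum_nonneg fun K _ =>
        mul_nonneg (by positivity) (Complex.normSq_nonneg _)).mp hR h (Finset.mem_univ h)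
      have h2 := (Finset.sum_eq_zero_iff_of_nonneg fun K _ =>
        mul_nonneg (by positivity) (Complex.normSq_nonneg _)).mp h1 K (Finset.mem_univ K)
      have h3 := (mul_eq_zero.mp h2).resolve_left (by positivity)
      exact Complex.normSq_eq_zero.mp h3
    refine toExt_injective ?_
    rw [map_zero, ← hFdef, hF]
    simp [hz]

/-! ### Products of weakly closed square integrable functions -/

section WeakProducts

set_option maxSynthPendingDepth 3

open Filter Topology
open scoped ENNReal NNReal

variable {V F : Type*} [NormedAddCommGroup V] [NormedSpace ℝ V] [FiniteDimensional ℝ V]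
  [MeasurableSpace V] [BorelSpace V] (μ : Measure V) [μ.IsAddHaarMeasure]
  [NormedAddCommGroup F] [NormedSpace ℝ F]

theorem aestronglyMeasurable_clm_apply {A G : Type*} [MeasurableSpace A]
    [NormedAddCommGroup G] [NormedSpace ℝ G] {μ : Measure A} {φ : A → F →L[ℝ] G} {f : A → F}
    (hφ : AEStronglyMeasurable φ μ) (hf : AEStronglyMeasurable f μ) :
    AEStronglyMeasurable (fun x => φ x (f x)) μ :=
  (ContinuousLinearMap.id ℝ (F →L[ℝ] G)).aestronglyMeasurable_comp₂ hφ hf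

omit [NormedSpace ℝ F] in
-- Translations preserve the measure and depend continuously on the shift, and composition with such
-- maps is continuous in `L²`.
theorem MemLp.tendsto_translate {f : V → F} (hf : MemLp f 2 μ) :
    Tendsto (fun h => eLpNorm (fun x => f (x + h) - f x) 2 μ) (𝓝 0) (𝓝 0) := by
  have : Fact ((1 : ℝ≥0∞) ≤ 2) := ⟨by norm_num⟩
  let g : V → C(V, V) := fun h => ⟨fun x => x + h, by fun_prop⟩
  have hg : Continuous g := ContinuousMap.continuous_of_continuous_uncurry _ (by
    change Continuous fun p : V × V => p.2 + p.1
    fun_prop)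
  have hgm : ∀ h, MeasurePreserving (g h) μ μ := fun h => measurePreserving_add_right μ h
  have hc : Continuous fun h => Lp.compMeasurePreserving (g h) (hgm h) (hf.toLp f) :=
    continuous_const.compMeasurePreservingLp hg hgm (by norm_num)
  have h1 := hc.tendsto 0
  rw [Lp.tendsto_Lp_iff_tendsto_eLpNorm'] at h1
  refine h1.congr fun h => eLpNorm_congr_ae ?_
  have e1 : ∀ h, Lp.compMeasurePreserving (g h) (hgm h) (hf.toLp f) =ᵐ[μ] fun x => f (x + h) :=
    fun h => (Lp.coeFn_compMeasurePreserving _ (hgm h)).trans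
      ((hgm h).quasiMeasurePreserving.ae_eq_comp hf.coeFn_toLp)
  filter_upwards [e1 h, e1 0] with x hx hx0
  rw [add_zero] at hx0
  exact congrArg₂ (· - ·) hx hx0

theorem tendsto_integral_clm_translate {f : V → F} {g : V → F →L[ℝ] ℂ} (hf : MemLp f 2 μ)
    (hg : MemLp g 2 μ) :
    Tendsto (fun h => ∫ x, g x (f (x + h)) ∂μ) (𝓝 0) (𝓝 (∫ x, g x (f x) ∂μ)) := by
  have hft : ∀ h, MemLp (fun x => f (x + h)) 2 μ := fun h =>
    hf.comp_measurePreserving (measurePreserving_add_right μ h)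
  have hint : ∀ {f : V → F}, MemLp f 2 μ → Integrable (fun x => g x (f x)) μ := by
    intro f hf
    rw [← memLp_one_iff_integrable]
    refine MemLp.of_bilin (p := 2) (q := 2) (fun (a : F) (b : F →L[ℝ] ℂ) => b a) 1 hf hg
      (aestronglyMeasurable_clm_apply hg.1 hf.1) (Eventually.of_forall fun x => ?_)
    rw [one_mul, mul_comm]
    exact (g x).le_opNNNorm (f x)
  refine tendsto_integral_of_L1' _ (hint hf).1 (Eventually.of_forall fun h => hint (hft h)) ?_
  have h0 : Tendsto (fun h => 1 * eLpNorm (fun x => f (x + h) - f x) 2 μ * eLpNorm g 2 μ)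
      (𝓝 0) (𝓝 0) := by
    have := ENNReal.Tendsto.mul_const (b := eLpNorm g 2 μ) (MemLp.tendsto_translate μ hf)
      (Or.inr hg.2.ne)
    simpa using this
  refine tendsto_of_tendsto_of_tendsto_of_le_of_le tendsto_const_nhds h0 (fun _ => zero_le) ?_
  intro h
  have := eLpNorm_le_eLpNorm_mul_eLpNorm_of_nnnorm (p := 2) (q := 2) (r := 1)
    ((hft h).1.sub hf.1) hg.1 (fun (a : F) (b : F →L[ℝ] ℂ) => b a) 1
    (Eventually.of_forall fun x => by
      rw [one_mul, mul_comm]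
      exact (g x).le_opNNNorm _)
  refine le_trans (le_of_eq ?_) this
  refine congrArg (fun k => eLpNorm k 1 μ) ?_
  ext x
  simp

variable {μ}

/-- A Leibniz rule for products of two weakly closed `L²` functions. Mollifying one factor gives the
double integral of `ρ(y - x) T(du(x), f(y), f(x))`. For fixed `y` the weak equation in `x` moves the
derivative from `u` to `ρ`; for fixed `x` the weak equation in `y` then makes the integral vanish.
Continuity of translation in `L²` lets the mollifier concentrate at the origin. -/
theorem integral_trilinear_eq_zero
    (T : (V →L[ℝ] ℝ) →L[ℝ] F →L[ℝ] F →L[ℝ] ℂ) {U : Set V} (hU : IsOpen U) {f : V → F}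
    (hf : ∀ K ⊆ U, IsCompact K → MemLp f 2 (μ.restrict K))
    (h1 : ∀ (g : F) (χ : V → ℝ), ContDiff ℝ ∞ χ → HasCompactSupport χ → tsupport χ ⊆ U →
      ∫ x, T (fderiv ℝ χ x) (f x) g ∂μ = 0)
    (h2 : ∀ (g : F) (χ : V → ℝ), ContDiff ℝ ∞ χ → HasCompactSupport χ → tsupport χ ⊆ U →
      ∫ x, T (fderiv ℝ χ x) g (f x) ∂μ = 0)
    {u : V → ℝ} (hu : ContDiff ℝ ∞ u) (huc : HasCompactSupport u) (huU : tsupport u ⊆ U) :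
    ∫ x, T (fderiv ℝ u x) (f x) (f x) ∂μ = 0 := by
  have hproper : ProperSpace V := FiniteDimensional.proper ℝ V
  obtain ⟨δ, hδ, hδU⟩ := huc.isCompact.exists_cthickening_subset_open hU huU
  -- The room `δ` around the support of `u` keeps translated points inside `U`. Outside `K` the
  -- function may be cut to zero, which makes it globally `L²` and integrable.
  set K := Metric.cthickening δ (tsupport u) with hKdef
  have hKc : IsCompact K := huc.isCompact.cthickening
  have huK : tsupport u ⊆ K := Metric.self_subset_cthickening _
  set f' := K.indicator f with hf'def
  have hf'L2 : MemLp f' 2 μ :=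
    (memLp_indicator_iff_restrict hKc.measurableSet).mpr (hf K hδU hKc)
  have hf'int : Integrable f' μ := by
    rw [hf'def, integrable_indicator_iff hKc.measurableSet]
    have : IsFiniteMeasure (μ.restrict K) := ⟨by simpa using hKc.measure_lt_top⟩
    exact (hf K hδU hKc).integrable (by norm_num)
  have hf'eq : ∀ x ∈ K, f' x = f x := fun x hx => Set.indicator_of_mem hx f
  have hdu : ∀ χ : V → ℝ, tsupport χ ⊆ K → ∀ x, x ∉ K → fderiv ℝ χ x = 0 := fun χ hχ x hx =>
    image_eq_zero_of_notMem_tsupport fun h => hx (hχ (tsupport_fderiv_subset ℝ h))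
  have hu' : Continuous (fderiv ℝ u) := hu.continuous_fderiv (by simp)
  obtain ⟨Cu, hCu⟩ := (huc.fderiv (𝕜 := ℝ)).exists_bound_of_continuous hu'
  obtain ⟨Cu0, hCu0⟩ := huc.exists_bound_of_continuous hu.continuous
  -- the pairing with a translate
  set g : V → F →L[ℝ] ℂ := fun x => (T (fderiv ℝ u x)).flip (f' x) with hgdef
  have hTu : Continuous fun x => (T (fderiv ℝ u x)).flip :=
    (ContinuousLinearMap.flipₗᵢ ℝ F F ℂ).continuous.comp (T.continuous.comp hu')
  have hgL2 : MemLp g 2 μ := by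
    refine MemLp.of_le_mul (c := ‖T‖ * Cu) hf'L2
      (aestronglyMeasurable_clm_apply hTu.aestronglyMeasurable hf'L2.1) (Eventually.of_forall fun x => ?_)
    calc ‖g x‖ ≤ ‖(T (fderiv ℝ u x)).flip‖ * ‖f' x‖ := ContinuousLinearMap.le_opNorm _ _
      _ ≤ ‖T‖ * Cu * ‖f' x‖ := by
        gcongr
        rw [ContinuousLinearMap.opNorm_flip]
        exact (T.le_opNorm _).trans (by gcongr; exact hCu x)
  have hB := tendsto_integral_clm_translate μ hf'L2 hgL2
  set B : V → ℂ := fun h => ∫ x, g x (f' (x + h)) ∂μ with hBdef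
  have hgoal : ∫ x, T (fderiv ℝ u x) (f x) (f x) ∂μ = ∫ x, g x (f' x) ∂μ := by
    refine integral_congr_ae (Eventually.of_forall fun x => ?_)
    by_cases hx : x ∈ K
    · simp [hgdef, hf'eq x hx]
    · simp [hgdef, hdu u huK x hx]
  rw [hgoal]
  have hprod : Integrable (fun z : V × V => ‖f' z.1‖ * ‖f' z.2‖) (μ.prod μ) :=
    hf'int.norm.mul_prod hf'int.norm
  have hf1 : AEStronglyMeasurable (fun z : V × V => f' z.1) (μ.prod μ) :=
    hf'L2.1.comp_fst
  have hf2 : AEStronglyMeasurable (fun z : V × V => f' z.2) (μ.prod μ) :=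
    hf'L2.1.comp_snd
  -- the averaged pairing vanishes
  have hmain : ∀ ρ : V → ℝ, ContDiff ℝ ∞ ρ → HasCompactSupport ρ →
      tsupport ρ ⊆ Metric.closedBall 0 δ →
      Integrable (fun h => (ρ h : ℂ) * B h) μ ∧ ∫ h, (ρ h : ℂ) * B h ∂μ = 0 := by
    intro ρ hρ hρc hρδ
    have hρ' : Continuous (fderiv ℝ ρ) := hρ.continuous_fderiv (by simp)
    obtain ⟨Cρ, hCρ⟩ := hρc.exists_bound_of_continuous hρ.continuous
    obtain ⟨Cρ', hCρ'⟩ := (hρc.fderiv (𝕜 := ℝ)).exists_bound_of_continuous hρ'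
    set G : V × V → ℂ := fun z => T (ρ (z.2 - z.1) • fderiv ℝ u z.1) (f' z.2) (f' z.1) with hG
    set G' : V × V → ℂ := fun z => T (u z.1 • fderiv ℝ ρ (z.2 - z.1)) (f' z.2) (f' z.1) with hG'
    have hTb : ∀ (ξ : V →L[ℝ] ℝ) (c : ℝ), ‖ξ‖ ≤ c → ∀ a b : F,
        ‖T ξ a b‖ ≤ ‖T‖ * c * (‖b‖ * ‖a‖) := by
      intro ξ c hc a b
      calc ‖T ξ a b‖ ≤ ‖T ξ a‖ * ‖b‖ := ContinuousLinearMap.le_opNorm _ _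
        _ ≤ (‖T ξ‖ * ‖a‖) * ‖b‖ := by gcongr; exact ContinuousLinearMap.le_opNorm _ _
        _ ≤ (‖T‖ * c * ‖a‖) * ‖b‖ := by
          gcongr
          exact (T.le_opNorm _).trans (by gcongr)
        _ = _ := by ring
    have hGi : Integrable G (μ.prod μ) := by
      refine (hprod.const_mul (‖T‖ * (Cρ * Cu))).mono' ?_ (Eventually.of_forall fun z => ?_)
      · have : Continuous fun z : V × V => T (ρ (z.2 - z.1) • fderiv ℝ u z.1) := by
          have := hρ.continuous
          fun_prop
        exact aestronglyMeasurable_clm_apply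
          (aestronglyMeasurable_clm_apply this.aestronglyMeasurable hf2) hf1
      · refine hTb _ _ ?_ _ _
        rw [norm_smul]
        have := hCρ (z.2 - z.1)
        have h' := hCu z.1
        have := (norm_nonneg _).trans this
        gcongr
    have hG'i : Integrable G' (μ.prod μ) := by
      refine (hprod.const_mul (‖T‖ * (Cu0 * Cρ'))).mono' ?_ (Eventually.of_forall fun z => ?_)
      · have : Continuous fun z : V × V => T (u z.1 • fderiv ℝ ρ (z.2 - z.1)) := by
          have := hu.continuous
          fun_prop
        exact aestronglyMeasurable_clm_apply
          (aestronglyMeasurable_clm_apply this.aestronglyMeasurable hf2) hf1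
      · refine hTb _ _ ?_ _ _
        rw [norm_smul]
        have := hCu0 z.1
        have h' := hCρ' (z.2 - z.1)
        have := (norm_nonneg _).trans this
        gcongr
    -- slices in the first variable
    have hslice : ∀ y, Integrable (fun x => G (x, y)) μ → Integrable (fun x => G' (x, y)) μ →
        ∫ x, G (x, y) ∂μ = ∫ x, G' (x, y) ∂μ := by
      intro y hy hy'
      rw [← sub_eq_zero, ← integral_sub hy hy']
      -- Testing with this product, the derivative in `x` is `ρ(y - x) du(x) - u(x) dρ(y - x)`,
      -- which is exactly the difference of the two integrands.
      set χ : V → ℝ := fun x => ρ (y - x) * u x with hχ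
      have hχs : ContDiff ℝ ∞ χ := (hρ.comp (contDiff_const.sub contDiff_id)).mul hu
      have hχsub : tsupport χ ⊆ tsupport u := tsupport_mul_subset_right
      have hχc : HasCompactSupport χ := huc.mono' (subset_closure.trans hχsub)
      rw [← h2 (f' y) χ hχs hχc (hχsub.trans huU)]
      refine integral_congr_ae (Eventually.of_forall fun x => ?_)
      have hfd : fderiv ℝ χ x = ρ (y - x) • fderiv ℝ u x - u x • fderiv ℝ ρ (y - x) := by
        have hd1 : HasFDerivAt (fun x => ρ (y - x)) (-(fderiv ℝ ρ (y - x))) x := by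
          have hd := (hρ.differentiable (by simp) (y - x)).hasFDerivAt
          have := hd.comp x ((hasFDerivAt_id x).const_sub y)
          rw [ContinuousLinearMap.comp_neg, ContinuousLinearMap.comp_id] at this
          exact this
        have hd2 := (hu.differentiable (by simp) x).hasFDerivAt
        have hd3 : HasFDerivAt χ _ x := hd1.mul hd2
        rw [hd3.fderiv]
        ext v
        simp
        ring
      by_cases hx : x ∈ K
      · simp only [hG, hG', hfd, map_sub, sub_apply, hf'eq x hx]
      · have e1 := hdu u huK x hx
        have e2 : u x = 0 := image_eq_zero_of_notMem_tsupport fun h => hx (huK h)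
        simp [hG, hG', hfd, e1, e2]
    -- slices in the second variable
    have hslice' : ∀ x, ∫ y, G' (x, y) ∂μ = 0 := by
      intro x
      by_cases hx : x ∈ tsupport u
      · set χ : V → ℝ := fun y => ρ (y - x) with hχ
        have hχs : ContDiff ℝ ∞ χ := hρ.comp (contDiff_id.sub contDiff_const)
        have hχeq : χ = ρ ∘ (Homeomorph.addRight (-x)) := by
          ext y; simp [hχ, sub_eq_add_neg]
        have hχt : tsupport χ = (Homeomorph.addRight (-x)) ⁻¹' tsupport ρ := by
          rw [hχeq, tsupport_comp_eq_preimage]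
        have hχc : HasCompactSupport χ := by
          rw [hχeq]; exact hρc.comp_homeomorph _
        have hχK : tsupport χ ⊆ K := by
          intro y hy
          rw [hχt] at hy
          have hy' := hρδ hy
          refine Metric.mem_cthickening_of_dist_le y x δ _ hx ?_
          simpa [dist_eq_norm, sub_eq_add_neg] using hy'
        have h3 := h1 (f' x) χ hχs hχc (hχK.trans hδU)
        have hfd : ∀ y, fderiv ℝ χ y = fderiv ℝ ρ (y - x) := fun y => by
          simpa using fderiv_comp_sub (𝕜 := ℝ) (f := ρ) (x := y) x
        have : ∀ y, G' (x, y) = u x • T (fderiv ℝ χ y) (f y) (f' x) := by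
          intro y
          by_cases hy : y ∈ K
          · simp [hG', hf'eq y hy, hfd]
          · have e1 := hdu χ hχK y hy
            have e2 := e1
            rw [hfd] at e2
            simp [hG', e1, e2]
        simp_rw [this]
        rw [integral_smul, h3, smul_zero]
      · have e2 : u x = 0 := image_eq_zero_of_notMem_tsupport hx
        simp [hG', e2]
    have hGG' : ∫ z, G z ∂(μ.prod μ) = 0 := by
      rw [integral_prod_symm _ hGi]
      have : ∫ y, ∫ x, G (x, y) ∂μ ∂μ = ∫ y, ∫ x, G' (x, y) ∂μ ∂μ := by
        refine integral_congr_ae ?_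
        filter_upwards [hGi.prod_left_ae, hG'i.prod_left_ae] with y hy hy'
        exact hslice y hy hy'
      rw [this, ← integral_prod_symm _ hG'i, integral_prod _ hG'i]
      simp [hslice']
    -- The shear `(x, h) ↦ (x, x + h)` rewrites the double integral as the average of the translated
    -- pairing against `ρ`.
    have hmp := measurePreserving_prod_add μ μ
    have hGc : Integrable (fun z : V × V => G (z.1, z.1 + z.2)) (μ.prod μ) :=
      hmp.integrable_comp_of_integrable hGi
    have hGcB : ∀ h, ∫ x, G (x, x + h) ∂μ = (ρ h : ℂ) * B h := by
      intro h
      rw [hBdef, ← integral_const_mul]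
      refine integral_congr_ae (Eventually.of_forall fun x => ?_)
      simp [hG, hgdef]
    constructor
    · have := hGc.integral_prod_right
      simpa only [hGcB] using this
    · have h5 : ∫ z : V × V, G (z.1, z.1 + z.2) ∂(μ.prod μ) = 0 := by
        rw [← hGG']
        exact hmp.integral_comp (MeasurableEquiv.shearAddRight V).measurableEmbedding G
      rw [integral_prod_symm _ hGc] at h5
      simpa only [hGcB] using h5
  -- conclude by letting the averages concentrate
  by_contra hne
  set b0 := ∫ x, g x (f' x) ∂μ with hb0
  have hpos : 0 < ‖b0‖ := norm_pos_iff.mpr hne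
  obtain ⟨ε, hε, hεB⟩ := Metric.eventually_nhds_iff_ball.mp
    (hB.eventually (Metric.ball_mem_nhds b0 (half_pos hpos)))
  -- The outer radius is at most `δ`, so that the averages vanish, and below `ε`, so that the
  -- pairing stays within `‖b0‖ / 2` of `b0` on the support. Together these bound `‖b0‖` by half of
  -- itself.
  let bump : ContDiffBump (0 : V) :=
    { rIn := min ε δ / 2 / 2, rOut := min ε δ / 2, rIn_pos := by positivity,
      rIn_lt_rOut := half_lt_self (by positivity) }
  set ρ := bump.normed μ with hρdef
  have hρs : ContDiff ℝ ∞ ρ := bump.contDiff_normed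
  have hsup : tsupport ρ = Metric.closedBall 0 (min ε δ / 2) := bump.tsupport_normed_eq
  have hmin : min ε δ / 2 ≤ δ := by
    have := min_le_right ε δ
    have := (lt_min hε hδ)
    linarith
  have hmin' : min ε δ / 2 < ε := by
    have := min_le_left ε δ
    have := (lt_min hε hδ)
    linarith
  obtain ⟨hi, hz⟩ := hmain ρ hρs bump.hasCompactSupport_normed
    (hsup ▸ Metric.closedBall_subset_closedBall hmin)
  have hρi : Integrable ρ μ := bump.integrable_normed
  have hρ1 : ∫ h, ρ h ∂μ = 1 := bump.integral_normed
  have hρ0 : ∀ h, 0 ≤ ρ h := bump.nonneg_normed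
  have hρic : Integrable (fun h => (ρ h : ℂ) * b0) μ := hρi.ofReal.mul_const b0
  have e1 : ∫ h, ((ρ h : ℂ) * b0 - (ρ h : ℂ) * B h) ∂μ = b0 := by
    rw [integral_sub hρic hi, hz, sub_zero, integral_mul_const, integral_complex_ofReal, hρ1]
    simp
  have e2 : ‖b0‖ ≤ ∫ h, ρ h * (‖b0‖ / 2) ∂μ := by
    conv_lhs => rw [← e1]
    refine norm_integral_le_of_norm_le (hρi.mul_const _) (Eventually.of_forall fun h => ?_)
    rw [← mul_sub, norm_mul, Complex.norm_real, Real.norm_of_nonneg (hρ0 h)]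
    by_cases hh : h ∈ Metric.closedBall (0 : V) (min ε δ / 2)
    · have := hεB h (Metric.closedBall_subset_ball hmin' hh)
      rw [dist_comm, dist_eq_norm] at this
      gcongr
      exact hρ0 h
    · have : ρ h = 0 := image_eq_zero_of_notMem_tsupport (hsup ▸ hh)
      simp [this]
  rw [integral_mul_const, hρ1, one_mul] at e2
  linarith

end WeakProducts

/-! ### Dolbeault components -/

section Dolbeault

set_option maxSynthPendingDepth 3

/-- Continuous complex-valued alternating forms on `ℂⁿ`. -/
abbrev Alt (n k : ℕ) : Type := Cn n [⋀^Fin k]→L[ℝ] ℂ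

variable {n k : ℕ}

instance finiteDimensional_alt : FiniteDimensional ℝ (Alt n k) := by
  let L : Alt n k →ₗ[ℝ] MultilinearMap ℝ (fun _ : Fin k => Cn n) ℂ :=
    { toFun := fun f => f.toContinuousMultilinearMap.toMultilinearMap
      map_add' := fun _ _ => rfl
      map_smul' := fun _ _ => rfl }
  refine FiniteDimensional.of_injective L fun f g h => ?_
  ext v
  exact congrArg (fun m => m v) h

/-- For `c = i` the complex linear part, for `c = -i` the complex antilinear part. -/
def typePart (c : ℂ) : (Cn n →L[ℝ] Alt n k) →ₗ[ℝ] (Cn n →L[ℝ] Alt n k) where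
  toFun A := (1 / 2 : ℂ) • (A - c • A.comp (mulI n))
  map_add' A B := by
    ext v w
    simp
    ring
  map_smul' r A := by
    ext v w
    simp
    ring

theorem typePart_apply (c : ℂ) (A : Cn n →L[ℝ] Alt n k) (v : Cn n) :
    typePart c A v = (1 / 2 : ℂ) • (A v - c • A (Complex.I • v)) := rfl

theorem part01_eq (A : Cn n →L[ℝ] Alt n k) : part01 A = typePart (-Complex.I) A := by
  ext v w
  simp [part01, typePart]

/-- For `c = i` the operator `∂`, for `c = -i` the operator `∂̄`, in terms of the derivative. -/
def dolb (c : ℂ) : (Cn n →L[ℝ] Alt n k) →ₗ[ℝ] Alt n (k + 1) where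
  toFun A := .alternatizeUncurryFin (typePart c A)
  map_add' A B := by
    rw [map_add, ContinuousAlternatingMap.alternatizeUncurryFin_add]
  map_smul' r A := by
    rw [map_smul, ContinuousAlternatingMap.alternatizeUncurryFin_smul]
    rfl

theorem flatDelbar_eq (φ : Cn n → Alt n k) (z : Cn n) :
    flatDelbar φ z = dolb (-Complex.I) (fderiv ℝ φ z) := by
  rw [flatDelbar, part01_eq]
  rfl

/-- The wedge product of the `c`-component of the real covector `ξ` with `θ`. -/
def dolbWedge (c : ℂ) : (Cn n →L[ℝ] ℝ) →ₗ[ℝ] Alt n k →ₗ[ℝ] Alt n (k + 1) :=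
  LinearMap.mk₂ ℝ (fun ξ θ => dolb c (ξ.smulRight θ))
    (fun ξ ξ' θ => by
      rw [← map_add]
      congr 1
      ext v w
      simp [add_mul])
    (fun r ξ θ => by
      rw [← map_smul]
      congr 1
      ext v w
      simp [mul_assoc])
    (fun ξ θ θ' => by
      rw [← map_add]
      congr 1
      ext v w
      simp)
    (fun r ξ θ => by
      rw [← map_smul]
      congr 1
      ext v w
      simp
      ring)

theorem dolbWedge_apply (c : ℂ) (ξ : Cn n →L[ℝ] ℝ) (θ : Alt n k) :
    dolbWedge c ξ θ = dolb c (ξ.smulRight θ) := rfl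

theorem delWedge_eq (χ : Cn n → ℝ) (φ : Cn n → Alt n k) (z : Cn n) :
    delWedge χ φ z = dolbWedge Complex.I (fderiv ℝ χ z) (φ z) := rfl

theorem delbarWedge_eq (χ : Cn n → ℝ) (φ : Cn n → Alt n k) (z : Cn n) :
    delbarWedge χ φ z = dolbWedge (-Complex.I) (fderiv ℝ χ z) (φ z) := by
  rw [delbarWedge, part01_eq]
  rfl

/-- The `c`-component of a real covector. -/
def covecPart (c : ℂ) (ξ : Cn n →L[ℝ] ℝ) : Cn n →ₗ[ℝ] ℂ where
  toFun v := (1 / 2 : ℂ) * (ξ v - c * ξ (Complex.I • v))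
  map_add' v w := by
    simp only [smul_add, map_add]
    push_cast
    ring
  map_smul' r v := by
    rw [smul_comm Complex.I r v, map_smul, map_smul]
    simp
    ring

/-- The image of a form in the exterior algebra, as a real linear map. -/
def ext (n k : ℕ) : Alt n k →ₗ[ℝ] Ext n where
  toFun φ := toExt n k φ.toAlternatingMap
  map_add' φ ψ := map_add (toExt n k) φ.toAlternatingMap ψ.toAlternatingMap
  map_smul' r φ := by
    have : (r • φ).toAlternatingMap = (r : ℂ) • φ.toAlternatingMap := by
      ext v
      simp
    rw [this, map_smul]
    rfl

theorem ext_apply (φ : Alt n k) : ext n k φ = toExt n k φ.toAlternatingMap := rfl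

theorem ext_smul (c : ℂ) (φ : Alt n k) : ext n k (c • φ) = c • ext n k φ :=
  map_smul (toExt n k) c φ.toAlternatingMap

theorem ext_real_smul (r : ℝ) (φ : Alt n k) : ext n k (r • φ) = (r : ℂ) • ext n k φ := by
  have : r • φ = (r : ℂ) • φ := by
    ext v
    simp
  rw [this, ext_smul]

theorem covec_eq_sum (c : Cn n →ₗ[ℝ] ℂ) : covec c = ∑ b, c (stdFrame n b) • coframe b := by
  rw [covec]
  conv_lhs => rw [pi_eq_sum_univ' (fun a => c (stdFrame n a))]
  rw [map_sum]
  exact Finset.sum_congr rfl fun b _ => map_smul _ _ _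

theorem ext_dolb (c : ℂ) (A : Cn n →L[ℝ] Alt n k) :
    ext n (k + 1) (dolb c A) = ∑ b, coframe b * ext n k (typePart c A (stdFrame n b)) := by
  let A' : Cn n →ₗ[ℝ] (Cn n [⋀^Fin k]→ₗ[ℝ] ℂ) :=
    { toFun := fun v => (typePart c A v).toAlternatingMap
      map_add' := fun v w => by rw [map_add]; rfl
      map_smul' := fun r v => by rw [map_smul]; rfl }
  have : (dolb c A).toAlternatingMap = AlternatingMap.alternatizeUncurryFin A' := by
    ext v
    simp [dolb, ContinuousAlternatingMap.alternatizeUncurryFin_apply,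
      AlternatingMap.alternatizeUncurryFin_apply, A']
  rw [ext_apply, this, toExt_alternatizeUncurryFin]
  rfl

theorem ext_dolbWedge (c : ℂ) (ξ : Cn n →L[ℝ] ℝ) (θ : Alt n k) :
    ext n (k + 1) (dolbWedge c ξ θ) = covec (covecPart c ξ) * ext n k θ := by
  rw [dolbWedge_apply, ext_dolb, covec_eq_sum, Finset.sum_mul]
  refine Finset.sum_congr rfl fun b _ => ?_
  have : typePart c (ξ.smulRight θ) (stdFrame n b) = covecPart c ξ (stdFrame n b) • θ := by
    ext w
    simp [typePart_apply, covecPart]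
    ring
  rw [this, ext_smul, smul_mul_assoc, mul_smul_comm]

theorem coframes_mul_coframe (a : Fin k → Idx n) (b : Idx n) :
    coframes a * coframe b = (-1 : ℂ) ^ k • (coframe b * coframes a) := by
  induction k with
  | zero => simp [coframes]
  | succ k ih =>
    obtain ⟨b', a', rfl⟩ : ∃ b' a', a = Fin.cons b' a' := ⟨a 0, Fin.tail a, by simp⟩
    rw [coframes_cons, mul_assoc, ih, mul_smul_comm, ← mul_assoc, coframe_mul_coframe, neg_mul,
      mul_assoc, smul_neg, pow_succ]
    simp

theorem ext_mul_coframe (θ : Alt n k) (b : Idx n) :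
    ext n k θ * coframe b = (-1 : ℂ) ^ k • (coframe b * ext n k θ) := by
  rw [ext_apply, toExt_apply]
  simp only [Finset.mul_sum, Finset.sum_mul, Finset.smul_sum, smul_mul_assoc, mul_smul_comm,
    coframes_mul_coframe]
  refine Finset.sum_congr rfl fun a _ => ?_
  simp only [smul_smul]
  congr 1
  ring

theorem ext_mul_covec (θ : Alt n k) (c : Cn n →ₗ[ℝ] ℂ) :
    ext n k θ * covec c = (-1 : ℂ) ^ k • (covec c * ext n k θ) := by
  simp only [covec_eq_sum, Finset.mul_sum, Finset.sum_mul, Finset.smul_sum, smul_mul_assoc,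
    mul_smul_comm, ext_mul_coframe]
  exact Finset.sum_congr rfl fun b _ => smul_comm _ _ _

theorem ext_mul_ext_one (θ : Alt n k) (η : Alt n 1) :
    ext n k θ * ext n 1 η = (-1 : ℂ) ^ k • (ext n 1 η * ext n k θ) := by
  have h : ∀ a : Fin 1 → Idx n, coframes a = coframe (a 0) := fun a => by
    simp [coframes, coframe]
  rw [ext_apply η, toExt_apply]
  simp only [h, Finset.mul_sum, Finset.sum_mul, Finset.smul_sum, smul_mul_assoc, mul_smul_comm,
    ext_mul_coframe]
  refine Finset.sum_congr rfl fun a _ => ?_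
  simp only [smul_smul]
  congr 1
  ring

/-- An element of degree two is central: it passes a `k`-form with sign `(-1)^(2k)`. -/
theorem commute_covec_mul_ext_one (θ : Alt n k) (c : Cn n →ₗ[ℝ] ℂ) (η : Alt n 1) :
    ext n k θ * (covec c * ext n 1 η) = covec c * ext n 1 η * ext n k θ := by
  rw [← mul_assoc, ext_mul_covec, smul_mul_assoc, mul_assoc, ext_mul_ext_one, mul_smul_comm,
    smul_smul, ← mul_pow]
  simp [mul_assoc]

/-- Complex conjugation of forms. -/
def conjAlt : Alt n k →ₗ[ℝ] Alt n k where
  toFun φ := Complex.conjCLE.toContinuousLinearMap.compContinuousAlternatingMap φ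
  map_add' φ ψ := by ext v; simp
  map_smul' r φ := by ext v; simp

theorem conjAlt_apply (φ : Alt n k) (v : Fin k → Cn n) : conjAlt φ v = conj (φ v) := rfl

/-- Conjugation exchanges `∂` and `∂̄`, because the covector `ξ` is real. Hence `∂χ ∧ φ̄` is
controlled by the weak equation for `∂̄φ`. -/
theorem conjAlt_dolbWedge (c : ℂ) (ξ : Cn n →L[ℝ] ℝ) (θ : Alt n k) :
    conjAlt (dolbWedge c ξ θ) = dolbWedge (conj c) ξ (conjAlt θ) := by
  ext v
  simp [dolbWedge_apply, dolb, ContinuousAlternatingMap.alternatizeUncurryFin_apply, conjAlt_apply,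
    typePart_apply, map_ofNat]

end Dolbeault

/-! ### Multilinear maps between finite-dimensional spaces -/

section FiniteDimensional

set_option maxSynthPendingDepth 3

variable {E₁ E₂ E₃ G : Type*} [NormedAddCommGroup E₁] [NormedSpace ℝ E₁] [FiniteDimensional ℝ E₁]
  [NormedAddCommGroup E₂] [NormedSpace ℝ E₂] [FiniteDimensional ℝ E₂]
  [NormedAddCommGroup E₃] [NormedSpace ℝ E₃] [FiniteDimensional ℝ E₃]
  [NormedAddCommGroup G] [NormedSpace ℝ G]

/-- A bilinear map between finite-dimensional spaces is continuous. -/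
def toCLM₂ (B : E₁ →ₗ[ℝ] E₂ →ₗ[ℝ] G) : E₁ →L[ℝ] E₂ →L[ℝ] G :=
  LinearMap.toContinuousLinearMap
    ((LinearMap.toContinuousLinearMap (𝕜 := ℝ) (E := E₂) (F' := G)).toLinearMap ∘ₗ B)

/-- A trilinear map between finite-dimensional spaces is continuous. -/
def toCLM₃ (B : E₁ →ₗ[ℝ] E₂ →ₗ[ℝ] E₃ →ₗ[ℝ] G) : E₁ →L[ℝ] E₂ →L[ℝ] E₃ →L[ℝ] G :=
  toCLM₂ (LinearMap.mk₂ ℝ (fun x y => LinearMap.toContinuousLinearMap (B x y))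
    (fun x x' y => by ext; simp) (fun r x y => by ext; simp)
    (fun x y y' => by ext; simp) (fun r x y => by ext; simp))

end FiniteDimensional

/-! ### The top coefficient of `f ∧ conj g ∧ w` -/

section Pairing

set_option maxSynthPendingDepth 3

variable {n k : ℕ}

/-- The coefficient of the top form `f ∧ conj g ∧ w`. -/
def pairing (n k : ℕ) : Alt n 2 →L[ℝ] Alt n k →L[ℝ] Alt n k →L[ℝ] ℂ :=
  toCLM₃
    { toFun := fun w => LinearMap.mk₂ ℝ
        (fun f g => top n (ext n k f * ext n k (conjAlt g) * ext n 2 w))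
        (fun f f' g => by simp only [map_add, add_mul])
        (fun r f g => by
          rw [ext_real_smul, smul_mul_assoc, smul_mul_assoc, map_smul, Complex.coe_smul])
        (fun f g g' => by simp only [map_add, add_mul, mul_add])
        (fun r f g => by
          rw [map_smul conjAlt, ext_real_smul, mul_smul_comm, smul_mul_assoc, map_smul,
            Complex.coe_smul])
      map_add' := fun w w' => by
        ext f g
        simp [mul_add]
      map_smul' := fun r w => by
        ext f g
        simp only [LinearMap.mk₂_apply, LinearMap.smul_apply, RingHom.id_apply]
        rw [ext_real_smul, mul_smul_comm, map_smul, Complex.coe_smul] }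

theorem pairing_apply (w : Alt n 2) (f g : Alt n k) :
    pairing n k w f g = top n (ext n k f * ext n k (conjAlt g) * ext n 2 w) := rfl

end Pairing

/-! ### Integration by parts in an open set of `ℂⁿ` -/

section Flat

set_option maxSynthPendingDepth 3

variable {n k : ℕ} {U : Set (Cn n)} {f : Cn n → Alt n k}

theorem integrable_pairing (hf : ∀ K ⊆ U, IsCompact K → MemLp f 2 (volume.restrict K))
    {w : Cn n → Alt n 2} (hw : Continuous w) (hwc : HasCompactSupport w) (hwU : tsupport w ⊆ U) :
    Integrable (fun z => pairing n k (w z) (f z) (f z)) := by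
  have hK : IsCompact (tsupport w) := hwc
  rw [← integrableOn_iff_integrable_of_support_subset (s := tsupport w)]
  · obtain ⟨C, hC⟩ := hwc.exists_bound_of_continuous hw
    have hf2 := hf _ hwU hK
    have hi := hf2.integrable_norm_pow (by norm_num)
    refine (hi.const_mul (‖pairing n k‖ * C)).mono' ?_ (Filter.Eventually.of_forall fun z => ?_)
    · have : Continuous fun z => pairing n k (w z) := (pairing n k).continuous.comp hw
      exact aestronglyMeasurable_clm_apply
        (aestronglyMeasurable_clm_apply this.aestronglyMeasurable hf2.1) hf2.1
    · calc ‖pairing n k (w z) (f z) (f z)‖ ≤ ‖pairing n k (w z) (f z)‖ * ‖f z‖ :=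
            ContinuousLinearMap.le_opNorm _ _
        _ ≤ (‖pairing n k (w z)‖ * ‖f z‖) * ‖f z‖ := by
          gcongr; exact ContinuousLinearMap.le_opNorm _ _
        _ ≤ ((‖pairing n k‖ * C) * ‖f z‖) * ‖f z‖ := by
          gcongr
          exact ((pairing n k).le_opNorm _).trans (by gcongr; exact hC z)
        _ = _ := by
          ring
  · intro z hz
    refine subset_tsupport w fun h => hz ?_
    simp [h]

theorem setIntegral_eq_integral_of_tsupport {E : Type*} [NormedAddCommGroup E] [NormedSpace ℝ E]
    {χ : Cn n → ℝ} (hχ : tsupport χ ⊆ U) (L : (Cn n →L[ℝ] ℝ) → Cn n → E) (hL : ∀ z, L 0 z = 0) :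
    ∫ z in U, L (fderiv ℝ χ z) z = ∫ z, L (fderiv ℝ χ z) z := by
  refine setIntegral_eq_integral_of_forall_compl_eq_zero fun z hz => ?_
  have : fderiv ℝ χ z = 0 :=
    image_eq_zero_of_notMem_tsupport fun h => hz (hχ (tsupport_fderiv_subset ℝ h))
  rw [this, hL]

theorem integrable_dolbWedge (hf : ∀ K ⊆ U, IsCompact K → MemLp f 2 (volume.restrict K)) (c : ℂ)
    {χ : Cn n → ℝ} (hχ : ContDiff ℝ ∞ χ) (hχc : HasCompactSupport χ) (hχU : tsupport χ ⊆ U) :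
    Integrable fun z => dolbWedge c (fderiv ℝ χ z) (f z) := by
  have hK : IsCompact (tsupport χ) := hχc
  have hfin : IsFiniteMeasure (volume.restrict (tsupport χ)) := ⟨by simpa using hK.measure_lt_top⟩
  have hχ' : Continuous (fderiv ℝ χ) := hχ.continuous_fderiv (by simp)
  rw [← integrableOn_iff_integrable_of_support_subset (s := tsupport χ)]
  · obtain ⟨C, hC⟩ := (hχc.fderiv (𝕜 := ℝ)).exists_bound_of_continuous hχ'
    have hf2 := hf _ hχU hK
    have hi : Integrable f (volume.restrict (tsupport χ)) := hf2.integrable (by norm_num)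
    let D : (Cn n →L[ℝ] ℝ) →L[ℝ] Alt n k →L[ℝ] Alt n (k + 1) := toCLM₂ (dolbWedge c)
    refine (hi.norm.const_mul (‖D‖ * C)).mono' ?_ (Filter.Eventually.of_forall fun z => ?_)
    · have : Continuous fun z => D (fderiv ℝ χ z) := D.continuous.comp hχ'
      change AEStronglyMeasurable (fun z => D (fderiv ℝ χ z) (f z)) _
      exact aestronglyMeasurable_clm_apply this.aestronglyMeasurable hf2.1
    · change ‖D (fderiv ℝ χ z) (f z)‖ ≤ _
      calc _ ≤ ‖D (fderiv ℝ χ z)‖ * ‖f z‖ := ContinuousLinearMap.le_opNorm _ _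
        _ ≤ _ := by
          gcongr
          exact (D.le_opNorm _).trans (by gcongr; exact hC z)
  · intro z hz
    refine tsupport_fderiv_subset ℝ (subset_tsupport (fderiv ℝ χ) fun h => hz ?_)
    simp [h]

/-- Both Dolbeault components of the derivative of `f` vanish weakly on `U`. -/
def WeaklyClosed (U : Set (Cn n)) (f : Cn n → Alt n k) : Prop :=
  ∀ c : ℂ, c = Complex.I ∨ c = -Complex.I → ∀ χ : Cn n → ℝ, ContDiff ℝ ∞ χ → HasCompactSupport χ →
    tsupport χ ⊆ U → ∫ z, dolbWedge c (fderiv ℝ χ z) (f z) = 0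

/-- Up to sign, the covector can be moved next to `f`. The integrand is then a fixed linear
functional of `∂χ ∧ f` or `∂̄χ ∧ f`, whose integral vanishes by weak closedness. -/
theorem integral_pairing_dolbWedge_left
    (hf : ∀ K ⊆ U, IsCompact K → MemLp f 2 (volume.restrict K))
    (hw : WeaklyClosed U f) {c : ℂ} (hc : c = Complex.I ∨ c = -Complex.I) (θ : Alt n 1) (g : Alt n k)
    {χ : Cn n → ℝ} (hχ : ContDiff ℝ ∞ χ) (hχc : HasCompactSupport χ) (hχU : tsupport χ ⊆ U) :
    ∫ z, pairing n k (dolbWedge c (fderiv ℝ χ z) θ) (f z) g = 0 := by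
  let L : Alt n (k + 1) →ₗ[ℝ] ℂ :=
    { toFun := fun u => top n (ext n 1 θ * ext n (k + 1) u * ext n k (conjAlt g))
      map_add' := fun u v => by simp only [map_add, mul_add, add_mul]
      map_smul' := fun r u => by
        rw [ext_real_smul, mul_smul_comm, smul_mul_assoc, map_smul, Complex.coe_smul]; rfl }
  have key : ∀ z, pairing n k (dolbWedge c (fderiv ℝ χ z) θ) (f z) g =
      (-1 : ℂ) * LinearMap.toContinuousLinearMap L (dolbWedge c (fderiv ℝ χ z) (f z)) := by
    intro z
    rw [pairing_apply]
    change _ = -1 * top n (ext n 1 θ * ext n (k + 1) (dolbWedge c (fderiv ℝ χ z) (f z)) *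
      ext n k (conjAlt g))
    simp only [ext_dolbWedge]
    rw [mul_assoc (ext n k (f z)), commute_covec_mul_ext_one, ← mul_assoc,
      commute_covec_mul_ext_one, ← neg_neg (covec _ * ext n 1 θ)]
    have h := ext_mul_covec θ (covecPart c (fderiv ℝ χ z))
    rw [pow_one, neg_smul, one_smul] at h
    rw [← h]
    simp [mul_assoc]
  simp_rw [key]
  rw [integral_const_mul, ContinuousLinearMap.integral_comp_comm _
    (integrable_dolbWedge hf c hχ hχc hχU), hw c hc χ hχ hχc hχU, map_zero, mul_zero]

/-- Here `f` enters through its conjugate, so the covector is moved next to `f̄` and the weak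
equation for the conjugate operator is used. This is where both Dolbeault equations are needed at
once. -/
theorem integral_pairing_dolbWedge_right
    (hf : ∀ K ⊆ U, IsCompact K → MemLp f 2 (volume.restrict K))
    (hw : WeaklyClosed U f) {c : ℂ} (hc : c = Complex.I ∨ c = -Complex.I) (θ : Alt n 1) (g : Alt n k)
    {χ : Cn n → ℝ} (hχ : ContDiff ℝ ∞ χ) (hχc : HasCompactSupport χ) (hχU : tsupport χ ⊆ U) :
    ∫ z, pairing n k (dolbWedge c (fderiv ℝ χ z) θ) g (f z) = 0 := by
  let L : Alt n (k + 1) →ₗ[ℝ] ℂ :=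
    { toFun := fun u => top n (ext n 1 θ * ext n k g * ext n (k + 1) (conjAlt u))
      map_add' := fun u v => by simp only [map_add, mul_add]
      map_smul' := fun r u => by
        rw [map_smul, ext_real_smul, mul_smul_comm, map_smul, Complex.coe_smul]; rfl }
  have hc' : conj c = Complex.I ∨ conj c = -Complex.I := by
    rcases hc with rfl | rfl <;> simp
  have key : ∀ z, pairing n k (dolbWedge c (fderiv ℝ χ z) θ) g (f z) =
      -(-1 : ℂ) ^ k * LinearMap.toContinuousLinearMap L
        (dolbWedge (conj c) (fderiv ℝ χ z) (f z)) := by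
    intro z
    rw [pairing_apply]
    change _ = -(-1 : ℂ) ^ k * top n (ext n 1 θ * ext n k g *
      ext n (k + 1) (conjAlt (dolbWedge (conj c) (fderiv ℝ χ z) (f z))))
    rw [conjAlt_dolbWedge, Complex.conj_conj]
    simp only [ext_dolbWedge]
    rw [mul_assoc (ext n k g), commute_covec_mul_ext_one, ← mul_assoc,
      commute_covec_mul_ext_one, ← neg_neg (covec _ * ext n 1 θ)]
    have h := ext_mul_covec θ (covecPart c (fderiv ℝ χ z))
    rw [pow_one, neg_smul, one_smul] at h
    have h' := ext_mul_covec g (covecPart c (fderiv ℝ χ z))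
    rw [← h, mul_assoc (ext n 1 θ) (ext n k g), ← mul_assoc (ext n k g), h']
    have : ((-1 : ℂ) ^ k) * (-1) ^ k = 1 := by rw [← mul_pow]; simp
    simp only [smul_mul_assoc, mul_smul_comm, map_smul, smul_eq_mul, neg_mul, map_neg, mul_assoc]
    rw [← mul_assoc ((-1 : ℂ) ^ k) ((-1) ^ k), this, one_mul]
  simp_rw [key]
  rw [integral_const_mul, ContinuousLinearMap.integral_comp_comm _
    (integrable_dolbWedge hf _ hχ hχc hχU), hw _ hc' χ hχ hχc hχU, map_zero, mul_zero]

/-- Stokes with a compactly supported smooth `1`-form `γ`: formally `f ∧ f̄` is closed under both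
operators. -/
theorem integral_pairing_dolb (hU : IsOpen U)
    (hf : ∀ K ⊆ U, IsCompact K → MemLp f 2 (volume.restrict K))
    (hw : WeaklyClosed U f) {c : ℂ} (hc : c = Complex.I ∨ c = -Complex.I) {γ : Cn n → Alt n 1}
    (hγ : ContDiff ℝ ∞ γ) (hγc : HasCompactSupport γ) (hγU : tsupport γ ⊆ U) :
    ∫ z, pairing n k (dolb c (fderiv ℝ γ z)) (f z) (f z) = 0 := by
  -- Writing `γ = ∑ u_i b_i` with constant forms `b_i`, only the scalar functions `u_i` are
  -- differentiated, and the trilinear statement applies to each of them.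
  let b := Module.finBasis ℝ (Alt n 1)
  let co := fun i => LinearMap.toContinuousLinearMap (b.coord i)
  let u := fun i z => co i (γ z)
  have hu : ∀ i, ContDiff ℝ ∞ (u i) := fun i => (co i).contDiff.comp hγ
  have hsub : ∀ i, tsupport (u i) ⊆ tsupport γ := fun i =>
    closure_mono fun z hz h => hz (by simp [u, h])
  have huc : ∀ i, HasCompactSupport (u i) := fun i =>
    HasCompactSupport.of_support_subset_isCompact hγc ((subset_tsupport _).trans (hsub i))
  have huU : ∀ i, tsupport (u i) ⊆ U := fun i => (hsub i).trans hγU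
  have hd : ∀ z, fderiv ℝ γ z = ∑ i, (fderiv ℝ (u i) z).smulRight (b i) := by
    intro z
    have h1 : ∀ i, fderiv ℝ (u i) z = (co i).comp (fderiv ℝ γ z) := fun i =>
      ((co i).hasFDerivAt.comp z (hγ.differentiable (by simp) z).hasFDerivAt).fderiv
    ext1 v
    simp only [h1, sum_apply, ContinuousLinearMap.smulRight_apply]
    exact (b.sum_repr _).symm
  have hint : ∀ i, Integrable fun z =>
      pairing n k (dolbWedge c (fderiv ℝ (u i) z) (b i)) (f z) (f z) := by
    intro i
    let D : (Cn n →L[ℝ] ℝ) →L[ℝ] Alt n 1 →L[ℝ] Alt n 2 := toCLM₂ (dolbWedge c)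
    have hsup : tsupport (fun z => D (fderiv ℝ (u i) z) (b i)) ⊆ tsupport (u i) :=
      by
      refine Set.Subset.trans (closure_mono (t := Function.support (fderiv ℝ (u i))) ?_)
        (tsupport_fderiv_subset ℝ)
      intro z hz h
      exact hz (by simp only [h, map_zero, zero_apply])
    refine integrable_pairing (w := fun z => D (fderiv ℝ (u i) z) (b i)) hf ?_ ?_
      (hsup.trans (huU i))
    · have : Continuous (fderiv ℝ (u i)) := (hu i).continuous_fderiv (by simp)
      fun_prop
    · exact HasCompactSupport.of_support_subset_isCompact (huc i)
        ((subset_tsupport _).trans hsup)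
  have key : ∀ z, pairing n k (dolb c (fderiv ℝ γ z)) (f z) (f z) =
      ∑ i, pairing n k (dolbWedge c (fderiv ℝ (u i) z) (b i)) (f z) (f z) := by
    intro z
    rw [hd z, map_sum, map_sum]
    simp only [sum_apply]
    rfl
  simp_rw [key]
  rw [integral_finsetSum _ fun i _ => hint i]
  refine Finset.sum_eq_zero fun i _ => ?_
  let T : (Cn n →L[ℝ] ℝ) →L[ℝ] Alt n k →L[ℝ] Alt n k →L[ℝ] ℂ :=
    (pairing n k).comp (LinearMap.toContinuousLinearMap ((dolbWedge c).flip (b i)))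
  exact integral_trilinear_eq_zero T hU hf
    (fun g χ => integral_pairing_dolbWedge_left hf hw hc (b i) g)
    (fun g χ => integral_pairing_dolbWedge_right hf hw hc (b i) g) (hu i) (huc i) (huU i)

/-- Integration by parts for `∂` and `∂̄` against a weakly closed form. -/
theorem integral_smul_pairing_dolb (hU : IsOpen U)
    (hf : ∀ K ⊆ U, IsCompact K → MemLp f 2 (volume.restrict K))
    (hw : WeaklyClosed U f) {c : ℂ} (hc : c = Complex.I ∨ c = -Complex.I) {γ : Cn n → Alt n 1}
    (hγ : ContDiffOn ℝ ∞ γ U) {χ : Cn n → ℝ} (hχ : ContDiff ℝ ∞ χ) (hχc : HasCompactSupport χ)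
    (hχU : tsupport χ ⊆ U) :
    Integrable (fun z => pairing n k (χ z • dolb c (fderiv ℝ γ z)) (f z) (f z)) ∧
    Integrable (fun z => pairing n k (dolbWedge c (fderiv ℝ χ z) (γ z)) (f z) (f z)) ∧
    ∫ z, pairing n k (χ z • dolb c (fderiv ℝ γ z)) (f z) (f z) =
      -∫ z, pairing n k (dolbWedge c (fderiv ℝ χ z) (γ z)) (f z) (f z) := by
  -- Regularity on `U` becomes global for anything vanishing off the support of `χ`, since extension
  -- by zero is regular there.
  have hcd : ∀ {E : Type} [NormedAddCommGroup E] [NormedSpace ℝ E] {h : Cn n → E} {m : WithTop ℕ∞},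
      ContDiffOn ℝ m h U → (∀ z, z ∉ tsupport χ → h z = 0) → ContDiff ℝ m h := by
    intro E _ _ h m h1 h2
    rw [contDiff_iff_contDiffAt]
    intro z
    by_cases hz : z ∈ U
    · exact h1.contDiffAt (hU.mem_nhds hz)
    · have : z ∉ tsupport χ := fun h => hz (hχU h)
      refine contDiffAt_const (c := (0 : E)).congr_of_eventuallyEq ?_
      filter_upwards [(isClosed_tsupport χ).isOpen_compl.mem_nhds this] with y hy
      exact h2 y hy
  have hts : ∀ {E : Type} [NormedAddCommGroup E] {h : Cn n → E},
      (∀ z, z ∉ tsupport χ → h z = 0) → tsupport h ⊆ tsupport χ := by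
    intro E _ h h2
    exact closure_minimal (fun z hz => by_contra fun h' => hz (h2 z h')) (isClosed_tsupport χ)
  have hcs : ∀ {E : Type} [NormedAddCommGroup E] {h : Cn n → E},
      (∀ z, z ∉ tsupport χ → h z = 0) → HasCompactSupport h := fun h2 =>
    HasCompactSupport.of_support_subset_isCompact hχc ((subset_tsupport _).trans (hts h2))
  have hχ0 : ∀ z, z ∉ tsupport χ → χ z = 0 := fun z => image_eq_zero_of_notMem_tsupport
  have hχ0' : ∀ z, z ∉ tsupport χ → fderiv ℝ χ z = 0 := fun z hz =>
    image_eq_zero_of_notMem_tsupport fun h => hz (tsupport_fderiv_subset ℝ h)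
  set δ : Cn n → Alt n 1 := fun z => χ z • γ z with hδ
  have hδ0 : ∀ z, z ∉ tsupport χ → δ z = 0 := fun z hz => by simp [hδ, hχ0 z hz]
  have hδs : ContDiff ℝ ∞ δ := hcd (hχ.contDiffOn.smul hγ) hδ0
  have hfd : ContDiffOn ℝ 0 (fun z => fderiv ℝ γ z) U :=
    hγ.fderiv_of_isOpen hU (by simp)
  let D : (Cn n →L[ℝ] ℝ) →L[ℝ] Alt n 1 →L[ℝ] Alt n 2 := toCLM₂ (dolbWedge c)
  let D' : (Cn n →L[ℝ] Alt n 1) →L[ℝ] Alt n 2 := LinearMap.toContinuousLinearMap (dolb c)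
  have e1 : ∀ z, z ∉ tsupport χ → χ z • dolb c (fderiv ℝ γ z) = 0 := fun z hz => by
    simp [hχ0 z hz]
  have e2 : ∀ z, z ∉ tsupport χ → dolbWedge c (fderiv ℝ χ z) (γ z) = 0 := fun z hz => by
    simp [hχ0' z hz]
  have c1 : ContDiff ℝ 0 fun z => χ z • dolb c (fderiv ℝ γ z) :=
    hcd ((hχ.of_le (by simp)).contDiffOn.smul (D'.contDiff.comp_contDiffOn hfd)) e1
  have c2 : ContDiff ℝ 0 fun z => dolbWedge c (fderiv ℝ χ z) (γ z) := by
    refine hcd ?_ e2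
    have h1 : ContDiff ℝ 0 (fderiv ℝ χ) := hχ.fderiv_right (by simp)
    exact (D.contDiff.comp h1).contDiffOn.clm_apply (hγ.of_le (by simp))
  have i1 := integrable_pairing hf c1.continuous (hcs e1) ((hts e1).trans hχU)
  have i2 := integrable_pairing hf c2.continuous (hcs e2) ((hts e2).trans hχU)
  refine ⟨i1, i2, ?_⟩
  rw [eq_neg_iff_add_eq_zero, ← integral_add i1 i2,
    ← integral_pairing_dolb hU hf hw hc hδs (hcs hδ0) ((hts hδ0).trans hχU)]
  refine integral_congr_ae (Filter.Eventually.of_forall fun z => ?_)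
  -- The Leibniz rule for `χ γ`; its two terms are the two integrands of the claim.
  have : dolb c (fderiv ℝ δ z) = χ z • dolb c (fderiv ℝ γ z) + dolbWedge c (fderiv ℝ χ z) (γ z) := by
    by_cases hz : z ∈ tsupport χ
    · have hd : HasFDerivAt δ _ z := (hχ.differentiable (by simp) z).hasFDerivAt.smul
        ((hγ.contDiffAt (hU.mem_nhds (hχU hz))).differentiableAt (by simp)).hasFDerivAt
      rw [hd.fderiv, map_add, map_smul]
      rfl
    · have : fderiv ℝ δ z = 0 := image_eq_zero_of_notMem_tsupport fun h =>
        hz (hts hδ0 (tsupport_fderiv_subset ℝ h))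
      rw [this, e1 z hz, e2 z hz, map_zero, add_zero]
  simp only [this, map_add, add_apply]

end Flat

/-! ### Unitary frames of a positive `(1,1)`-form -/

section Metric

set_option maxSynthPendingDepth 3

variable {n k : ℕ}

/-- A positive definite real `(1,1)`-form on `ℂⁿ`. -/
structure IsPositive (Ω : Alt n 2) : Prop where
  real : ∀ v, (Ω v).im = 0
  bidegree : IsBidegree 1 1 Ω.toAlternatingMap
  pos : ∀ v : Cn n, v ≠ 0 → 0 < riem Ω v v

theorem alt_two_swap (Ω : Alt n 2) (v w : Cn n) : Ω ![v, w] = -Ω ![w, v] := by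
  have := Ω.toAlternatingMap.map_swap ![w, v] (i := 0) (j := 1) (by decide)
  have e : (![w, v] : Fin 2 → Cn n) ∘ Equiv.swap (0 : Fin 2) 1 = ![v, w] := by
    ext1 i
    fin_cases i <;> rfl
  rw [e] at this
  exact this

theorem alt_two_add_left (Ω : Alt n 2) (v v' w : Cn n) :
    Ω ![v + v', w] = Ω ![v, w] + Ω ![v', w] :=
  Ω.toAlternatingMap.toMultilinearMap.cons_add ![w] v v'

theorem alt_two_smul_left (Ω : Alt n 2) (r : ℝ) (v w : Cn n) :
    Ω ![r • v, w] = r • Ω ![v, w] :=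
  Ω.toAlternatingMap.toMultilinearMap.cons_smul ![w] r v

namespace IsPositive

variable {Ω : Alt n 2} (hΩ : IsPositive Ω)

include hΩ

theorem apply_I_I (v w : Cn n) : Ω ![Complex.I • v, Complex.I • w] = Ω ![v, w] := by
  have := hΩ.bidegree Complex.I ![v, w]
  have e : (fun i => Complex.I • (![v, w] : Fin 2 → Cn n) i) = ![Complex.I • v, Complex.I • w] := by
    ext1 i
    fin_cases i <;> rfl
  rw [e] at this
  simpa using this

theorem apply_I_left (v w : Cn n) : Ω ![Complex.I • v, w] = -Ω ![v, Complex.I • w] := by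
  have := hΩ.apply_I_I v (Complex.I • w)
  rw [← this, smul_smul, Complex.I_mul_I, neg_one_smul, alt_two_swap, alt_two_swap Ω _ (-w)]
  have h := alt_two_smul_left Ω (-1) w (Complex.I • v)
  rw [neg_one_smul, neg_one_smul] at h
  rw [h, neg_neg]

theorem riem_comm (v w : Cn n) : riem Ω v w = riem Ω w v := by
  rw [riem, riem, alt_two_swap, hΩ.apply_I_left, neg_neg]

theorem riem_I_left (v w : Cn n) : riem Ω (Complex.I • v) w = (Ω ![v, w]).re := by
  rw [riem, hΩ.apply_I_I]

/-- The Hermitian inner product attached to a positive `(1,1)`-form. -/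
@[reducible]
def core : InnerProductSpace.Core ℂ (Cn n) where
  inner v w := ⟨riem Ω v w, (Ω ![v, w]).re⟩
  conj_inner_symm v w := by
    refine Complex.ext ?_ ?_
    · exact hΩ.riem_comm w v
    · change -(Ω ![w, v]).re = _
      rw [alt_two_swap, Complex.neg_re, neg_neg]
  re_inner_nonneg v := by
    change 0 ≤ riem Ω v v
    by_cases hv : v = 0
    · have := alt_two_smul_left Ω 0 0 (Complex.I • (0 : Cn n))
      rw [zero_smul, zero_smul] at this
      rw [hv, riem, this]
      simp
    · exact (hΩ.pos v hv).le
  add_left v v' w := by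
    refine Complex.ext ?_ ?_
    · simp [riem, alt_two_add_left]
    · simp [alt_two_add_left]
  smul_left v w r := by
    have hr : r • v = r.re • v + r.im • (Complex.I • v) := by
      conv_lhs => rw [← Complex.re_add_im r]
      rw [add_smul, mul_smul, Complex.coe_smul, Complex.coe_smul]
    have h1 : riem Ω (r • v) w = r.re * riem Ω v w + r.im * (Ω ![v, w]).re := by
      rw [hr, ← hΩ.riem_I_left]
      simp [riem, alt_two_add_left, alt_two_smul_left]
    have h2 : (Ω ![r • v, w]).re = r.re * (Ω ![v, w]).re - r.im * riem Ω v w := by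
      rw [hr, alt_two_add_left, alt_two_smul_left, alt_two_smul_left, hΩ.apply_I_left, riem]
      simp
      ring
    refine Complex.ext ?_ ?_
    · simp [h1]
    · simp [h2]
      ring
  definite v h := by
    by_contra hv
    exact (hΩ.pos v hv).ne' (congrArg Complex.re h)

end IsPositive

/-- Keeping `V` abstract separates the inner product built from `c` from the Euclidean one on `Cn
n`, the space it is applied to. -/
theorem exists_linearEquiv_of_core {V : Type*} [AddCommGroup V] [Module ℂ V]
    [FiniteDimensional ℂ V] (hV : Module.finrank ℂ V = n) (c : InnerProductSpace.Core ℂ V) :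
    ∃ A : Cn n ≃ₗ[ℂ] V, ∀ v w, c.inner (A v) (A w) = inner ℂ v w := by
  let _ : NormedAddCommGroup V := c.toNormedAddCommGroup
  let _ : InnerProductSpace ℂ V := InnerProductSpace.ofCore c.toCore
  let b := (stdOrthonormalBasis ℂ V).reindex (finCongr hV)
  exact ⟨b.repr.symm.toLinearEquiv, fun v w => b.repr.symm.inner_map_map v w⟩

/-- `A` is a unitary frame for `Ω`. -/
def IsUnitary (Ω : Alt n 2) (A : Cn n ≃L[ℂ] Cn n) : Prop :=
  ∀ v w, riem Ω (A v) (A w) = (inner ℂ v w).re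

theorem IsPositive.exists_isUnitary {Ω : Alt n 2} (hΩ : IsPositive Ω) :
    ∃ A : Cn n ≃L[ℂ] Cn n, IsUnitary Ω A := by
  obtain ⟨A, hA⟩ := exists_linearEquiv_of_core (n := n) (by simp) hΩ.core
  refine ⟨A.toContinuousLinearEquiv, fun v w => ?_⟩
  have h := congrArg Complex.re (hA v w)
  exact h

/-- The pull-back of a form by a complex linear map. -/
def Alt.comp (φ : Alt n k) (B : Cn n →L[ℂ] Cn n) : Alt n k :=
  φ.compContinuousLinearMap (B.restrictScalars ℝ)

theorem Alt.comp_apply (φ : Alt n k) (B : Cn n →L[ℂ] Cn n) (v : Fin k → Cn n) :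
    φ.comp B v = φ fun l => B (v l) := rfl

theorem Alt.comp_comp (φ : Alt n k) (B C : Cn n →L[ℂ] Cn n) :
    (φ.comp B).comp C = φ.comp (B.comp C) := rfl

theorem riem_comp (Ω : Alt n 2) (B : Cn n →L[ℂ] Cn n) (v w : Cn n) :
    riem (Ω.comp B) v w = riem Ω (B v) (B w) := by
  have : (fun l => B ((![v, Complex.I • w] : Fin 2 → Cn n) l)) = ![B v, Complex.I • B w] := by
    ext1 i
    fin_cases i
    · rfl
    · exact B.map_smul _ _
  rw [riem, riem, Alt.comp_apply, this]

theorem IsUnitary.comp {Ω : Alt n 2} {A : Cn n ≃L[ℂ] Cn n} (hA : IsUnitary Ω A)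
    (B : Cn n ≃L[ℂ] Cn n) : IsUnitary (Ω.comp (B : Cn n →L[ℂ] Cn n)) (A.trans B.symm) := by
  intro v w
  rw [riem_comp, ← hA]
  simp

theorem IsPositive.comp {Ω : Alt n 2} (hΩ : IsPositive Ω) (B : Cn n ≃L[ℂ] Cn n) :
    IsPositive (Ω.comp (B : Cn n →L[ℂ] Cn n)) where
  real v := hΩ.real _
  bidegree c v := by
    have := hΩ.bidegree c fun l => B (v l)
    change Ω (fun l => B (c • v l)) = _
    simp only [map_smul]
    exact this
  pos v hv := by
    rw [riem_comp]
    exact hΩ.pos _ (by simpa using hv)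

/-- The real determinant of a complex linear map. -/
def rdet (A : Cn n →L[ℂ] Cn n) : ℝ := LinearMap.det (A.toLinearMap.restrictScalars ℝ)

theorem rdet_pos (A : Cn n ≃L[ℂ] Cn n) : 0 < rdet (A : Cn n →L[ℂ] Cn n) := by
  rw [rdet, LinearMap.det_restrictScalars, Algebra.norm_complex_eq]
  refine Complex.normSq_pos.mpr ?_
  exact (LinearEquiv.isUnit_det' A.toLinearEquiv).ne_zero

theorem rdet_comp (A B : Cn n →L[ℂ] Cn n) : rdet (A.comp B) = rdet A * rdet B := by
  rw [rdet, rdet, rdet, ← LinearMap.det_comp]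
  rfl

/-- The matrix of a complex linear map in the standard real basis. -/
def rmat (A : Cn n →L[ℂ] Cn n) : Matrix (Idx n) (Idx n) ℝ :=
  LinearMap.toMatrix (stdBasis n) (stdBasis n) (A.toLinearMap.restrictScalars ℝ)

theorem det_rmat (A : Cn n →L[ℂ] Cn n) : (rmat A).det = rdet A := LinearMap.det_toMatrix _ _

theorem map_stdFrame_eq_sum (A : Cn n →L[ℂ] Cn n) (c : Idx n) :
    A (stdFrame n c) = ∑ a, rmat A a c • stdFrame n a := by
  have := (stdBasis n).sum_repr (A (stdFrame n c))
  conv_lhs => rw [← this]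
  refine Finset.sum_congr rfl fun a _ => ?_
  rw [stdBasis_apply, rmat, LinearMap.toMatrix_apply, stdBasis_apply]
  rfl

theorem re_inner_stdFrame (a b : Idx n) :
    (inner ℂ (stdFrame n a) (stdFrame n b)).re = if a = b then 1 else 0 := by
  obtain ⟨j, s⟩ := a
  obtain ⟨l, t⟩ := b
  by_cases h : j = l
  · subst h
    fin_cases s <;> fin_cases t <;> simp [stdFrame, EuclideanSpace.inner_single_left]
  · simp [stdFrame, EuclideanSpace.inner_single_left, h]

theorem riem_sum {ι : Type*} [Fintype ι] (Ω : Alt n 2) (x y : ι → ℝ) (e : ι → Cn n) :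
    riem Ω (∑ a, x a • e a) (∑ b, y b • e b) = ∑ a, ∑ b, x a * riem Ω (e a) (e b) * y b := by
  classical
  have h1 : ∀ w, riem Ω (∑ a, x a • e a) w = ∑ a, x a * riem Ω (e a) w := by
    intro w
    have : ∀ s : Finset ι, riem Ω (∑ a ∈ s, x a • e a) w = ∑ a ∈ s, x a * riem Ω (e a) w := by
      intro s
      induction s using Finset.induction_on with
      | empty =>
        have := alt_two_smul_left Ω 0 0 (Complex.I • w)
        rw [zero_smul, zero_smul] at this
        rw [Finset.sum_empty, riem, this]
        simp
      | insert a s ha ih =>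
        rw [Finset.sum_insert ha, Finset.sum_insert ha, ← ih]
        simp [riem, alt_two_add_left, alt_two_smul_left]
    exact this _
  have h2 : ∀ v, riem Ω v (∑ b, y b • e b) = ∑ b, riem Ω v (e b) * y b := by
    intro v
    have : ∀ s : Finset ι, riem Ω v (∑ a ∈ s, y a • e a) = ∑ a ∈ s, riem Ω v (e a) * y a := by
      intro s
      induction s using Finset.induction_on with
      | empty =>
        have := alt_two_smul_left Ω 0 0 v
        rw [zero_smul, zero_smul] at this
        rw [Finset.sum_empty, riem, smul_zero, alt_two_swap, this]
        simp
      | insert a s ha ih =>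
        rw [Finset.sum_insert ha, Finset.sum_insert ha, ← ih]
        simp only [riem, smul_add, smul_comm Complex.I (y _ : ℝ)]
        rw [alt_two_swap, alt_two_add_left, alt_two_smul_left, alt_two_swap Ω v,
          alt_two_swap Ω v]
        simp
        ring
    exact this _
  simp only [h1, h2, Finset.mul_sum, mul_assoc]

theorem gram_eq {Ω : Alt n 2} {A : Cn n ≃L[ℂ] Cn n} (hA : IsUnitary Ω A) :
    (rmat (A : Cn n →L[ℂ] Cn n)).transpose * gram Ω * rmat (A : Cn n →L[ℂ] Cn n) = 1 := by
  ext c d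
  have h := hA (stdFrame n c) (stdFrame n d)
  have e := fun c => map_stdFrame_eq_sum (A : Cn n →L[ℂ] Cn n) c
  simp only [ContinuousLinearEquiv.coe_coe] at e
  rw [e, e, riem_sum, re_inner_stdFrame] at h
  rw [Matrix.one_apply, ← h, Matrix.mul_apply, Finset.sum_comm]
  refine Finset.sum_congr rfl fun b _ => ?_
  rw [Matrix.mul_apply, Finset.sum_mul]
  rfl

theorem gram_inv_eq {Ω : Alt n 2} {A : Cn n ≃L[ℂ] Cn n} (hA : IsUnitary Ω A) :
    (gram Ω)⁻¹ = rmat (A : Cn n →L[ℂ] Cn n) * (rmat (A : Cn n →L[ℂ] Cn n)).transpose := by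
  refine Matrix.inv_eq_right_inv ?_
  have h := gram_eq hA
  rw [Matrix.mul_assoc] at h
  have h' := mul_eq_one_comm.mp h
  rwa [Matrix.mul_assoc] at h'

/-- A unitary frame `P` satisfies `Pᵀ G P = 1`. Its real determinant is positive because the frame
is complex linear, so the square root has no sign ambiguity. -/
theorem sqrt_det_gram {Ω : Alt n 2} {A : Cn n ≃L[ℂ] Cn n} (hA : IsUnitary Ω A) :
    Real.sqrt (gram Ω).det = (rdet (A : Cn n →L[ℂ] Cn n))⁻¹ := by
  have h := congrArg Matrix.det (gram_eq hA)
  rw [Matrix.det_mul, Matrix.det_mul, Matrix.det_transpose, det_rmat, Matrix.det_one] at h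
  have hp := rdet_pos A
  rw [Real.sqrt_eq_iff_mul_self_eq_of_pos (inv_pos.mpr hp)]
  field_simp
  linarith

theorem apply_comp_stdFrame (φ : Alt n k) (A : Cn n →L[ℂ] Cn n) (c : Fin k → Idx n) :
    φ.comp A (fun l => stdFrame n (c l)) =
      ∑ a : Fin k → Idx n, (∏ l, rmat A (a l) (c l) : ℝ) • φ fun l => stdFrame n (a l) := by
  rw [Alt.comp_apply]
  simp only [map_stdFrame_eq_sum]
  have := φ.toAlternatingMap.toMultilinearMap.map_sum
    (fun l (a : Idx n) => rmat A a (c l) • stdFrame n a)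
  refine this.trans (Finset.sum_congr rfl fun a _ => ?_)
  exact φ.toAlternatingMap.toMultilinearMap.map_smul_univ _ _

/-- Since `G⁻¹ = P Pᵀ` for a unitary frame `P`, contracting with the inverse Gram matrix is summing
squares over that frame. Estimates in terms of `normSq` thereby reduce to the Euclidean case, with
constants independent of the metric. -/
theorem normSq_eq {Ω : Alt n 2} {A : Cn n ≃L[ℂ] Cn n} (hA : IsUnitary Ω A) (φ : Alt n k) :
    normSq Ω φ = (k.factorial : ℝ)⁻¹ * ∑ c : Fin k → Idx n,
      Complex.normSq (φ.comp (A : Cn n →L[ℂ] Cn n) fun l => stdFrame n (c l)) := by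
  rw [normSq, gram_inv_eq hA]
  congr 1
  set P := rmat (A : Cn n →L[ℂ] Cn n)
  have h1 : ∀ c : Fin k → Idx n,
      Complex.normSq (φ.comp (A : Cn n →L[ℂ] Cn n) fun l => stdFrame n (c l)) =
      ∑ a : Fin k → Idx n, ∑ b : Fin k → Idx n, ((∏ l, P (a l) (c l)) * ∏ l, P (b l) (c l)) *
        (φ (fun l => stdFrame n (a l)) * conj (φ (fun l => stdFrame n (b l)))).re := by
    intro c
    have : Complex.normSq (φ.comp (A : Cn n →L[ℂ] Cn n) fun l => stdFrame n (c l)) =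
        ((φ.comp (A : Cn n →L[ℂ] Cn n) fun l => stdFrame n (c l)) *
          conj (φ.comp (A : Cn n →L[ℂ] Cn n) fun l => stdFrame n (c l))).re := by
      rw [Complex.mul_conj, Complex.ofReal_re]
    rw [this, apply_comp_stdFrame, map_sum, Finset.sum_mul_sum, Complex.re_sum]
    refine Finset.sum_congr rfl fun a _ => ?_
    rw [Complex.re_sum]
    refine Finset.sum_congr rfl fun b _ => ?_
    simp only [Complex.real_smul, map_mul, Complex.conj_ofReal]
    rw [← Complex.re_ofReal_mul]
    congr 1
    push_cast
    ring
  simp only [h1]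
  refine Eq.trans (Finset.sum_congr rfl fun a _ => ?_) Finset.sum_comm
  refine Eq.trans (Finset.sum_congr rfl fun b _ => ?_) Finset.sum_comm
  rw [← Finset.sum_mul]
  congr 1
  simp only [Matrix.mul_apply, Matrix.transpose_apply, ← Finset.prod_mul_distrib]
  rw [Finset.prod_univ_sum, Fintype.piFinset_univ]

theorem Alt.comp_symm (φ : Alt n k) (B : Cn n ≃L[ℂ] Cn n) :
    (φ.comp (B : Cn n →L[ℂ] Cn n)).comp (B.symm : Cn n →L[ℂ] Cn n) = φ := by
  ext v
  simp [Alt.comp_apply]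

theorem normSq_comp {Ω : Alt n 2} (hΩ : IsPositive Ω) (B : Cn n ≃L[ℂ] Cn n) (φ : Alt n k) :
    normSq (Ω.comp (B : Cn n →L[ℂ] Cn n)) (φ.comp (B : Cn n →L[ℂ] Cn n)) = normSq Ω φ := by
  obtain ⟨A, hA⟩ := hΩ.exists_isUnitary
  rw [normSq_eq hA, normSq_eq (hA.comp B)]
  simp [Alt.comp_apply]

theorem ext_comp (φ : Alt n k) (B : Cn n →L[ℂ] Cn n) :
    ext n k (φ.comp B) = pull (B.toLinearMap.restrictScalars ℝ) (ext n k φ) :=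
  toExt_compLinearMap φ.toAlternatingMap (B.toLinearMap.restrictScalars ℝ)

theorem conjAlt_comp (φ : Alt n k) (B : Cn n →L[ℂ] Cn n) :
    conjAlt (φ.comp B) = (conjAlt φ).comp B := rfl

theorem pairing_comp (w : Alt n 2) (f g : Alt n k) (B : Cn n →L[ℂ] Cn n) :
    pairing n k (w.comp B) (f.comp B) (g.comp B) = rdet B * pairing n k w f g := by
  rw [pairing_apply, conjAlt_comp, ext_comp, ext_comp, ext_comp, ← map_mul, ← map_mul, top_pull]
  rfl

theorem dolb_comp (c : ℂ) (A : Cn n →L[ℝ] Alt n k) (B : Cn n →L[ℂ] Cn n)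
    (A' : Cn n →L[ℝ] Alt n k) (h : ∀ v, A' v = (A (B v)).comp B) :
    (dolb c A).comp B = dolb c A' := by
  ext v
  simp [dolb, Alt.comp_apply, ContinuousAlternatingMap.alternatizeUncurryFin_apply,
    typePart_apply, h]
  rfl

theorem dolbWedge_comp (c : ℂ) (ξ : Cn n →L[ℝ] ℝ) (θ : Alt n k) (B : Cn n →L[ℂ] Cn n) :
    (dolbWedge c ξ θ).comp B = dolbWedge c (ξ.comp (B.restrictScalars ℝ)) (θ.comp B) :=
  dolb_comp c _ B _ fun _ => rfl

/-- The density of the top form `f ∧ conj f ∧ w` with respect to the volume form of `Ω`. -/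
def density (Ω w : Alt n 2) (f : Alt n k) : ℂ :=
  pairing n k w f f / Real.sqrt (gram Ω).det

theorem density_eq {Ω : Alt n 2} {A : Cn n ≃L[ℂ] Cn n} (hA : IsUnitary Ω A) (w : Alt n 2)
    (f : Alt n k) : density Ω w f = pairing n k (w.comp (A : Cn n →L[ℂ] Cn n))
      (f.comp (A : Cn n →L[ℂ] Cn n)) (f.comp (A : Cn n →L[ℂ] Cn n)) := by
  rw [pairing_comp, density, sqrt_det_gram hA]
  simp [mul_comm]

theorem sqrt_det_gram_pos {Ω : Alt n 2} (hΩ : IsPositive Ω) : 0 < Real.sqrt (gram Ω).det := by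
  obtain ⟨A, hA⟩ := hΩ.exists_isUnitary
  rw [sqrt_det_gram hA]
  exact inv_pos.mpr (rdet_pos A)

theorem sqrt_det_gram_comp {Ω : Alt n 2} (hΩ : IsPositive Ω) (B : Cn n ≃L[ℂ] Cn n) :
    Real.sqrt (gram (Ω.comp (B : Cn n →L[ℂ] Cn n))).det =
      rdet (B : Cn n →L[ℂ] Cn n) * Real.sqrt (gram Ω).det := by
  obtain ⟨A, hA⟩ := hΩ.exists_isUnitary
  rw [sqrt_det_gram hA, sqrt_det_gram (hA.comp B)]
  have : (A : Cn n →L[ℂ] Cn n) = (B : Cn n →L[ℂ] Cn n).comp (A.trans B.symm : Cn n →L[ℂ] Cn n) := by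
    ext1 v
    simp
  have h := rdet_comp (B : Cn n →L[ℂ] Cn n) (A.trans B.symm : Cn n →L[ℂ] Cn n)
  rw [← this] at h
  have h1 := (rdet_pos B).ne'
  have h2 := (rdet_pos (A.trans B.symm)).ne'
  rw [h]
  field_simp

/-- Numerator and denominator both scale by the positive real determinant of `B`. So the density is
a well-defined function on a manifold. -/
theorem density_comp {Ω : Alt n 2} (hΩ : IsPositive Ω) (B : Cn n ≃L[ℂ] Cn n) (w : Alt n 2)
    (f : Alt n k) : density (Ω.comp (B : Cn n →L[ℂ] Cn n)) (w.comp (B : Cn n →L[ℂ] Cn n))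
      (f.comp (B : Cn n →L[ℂ] Cn n)) = density Ω w f := by
  have h := rdet_pos B
  rw [density, density, pairing_comp, sqrt_det_gram_comp hΩ]
  push_cast
  rw [mul_div_mul_left]
  exact_mod_cast h.ne'

theorem density_add (Ω w w' : Alt n 2) (f : Alt n k) :
    density Ω (w + w') f = density Ω w f + density Ω w' f := by
  simp [density, add_div]

/-! ### Bounds in terms of the pointwise norm -/

/-- Evaluation on the standard frame is an injective linear map out of a finite-dimensional space,
hence bounded below. -/
theorem exists_norm_sq_le_sum (n k : ℕ) : ∃ C : ℝ, 0 ≤ C ∧ ∀ ψ : Alt n k, ‖ψ‖ ^ 2 ≤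
    C * ((k.factorial : ℝ)⁻¹ * ∑ c : Fin k → Idx n,
      Complex.normSq (ψ fun l => stdFrame n (c l))) := by
  let L : Alt n k →ₗ[ℝ] EuclideanSpace ℂ (Fin k → Idx n) :=
    { toFun := fun ψ => WithLp.toLp 2 fun c => ψ fun l => stdFrame n (c l)
      map_add' := fun _ _ => rfl
      map_smul' := fun _ _ => rfl }
  have hL : LinearMap.ker L = ⊥ := by
    rw [LinearMap.ker_eq_bot']
    intro ψ hψ
    have h0 : toExt n k ψ.toAlternatingMap = 0 := by
      rw [toExt_apply, Finset.sum_eq_zero, smul_zero]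
      intro c _
      have : ψ (fun l => stdFrame n (c l)) = 0 := congrArg (fun x => x c) (congrArg WithLp.ofLp hψ)
      change ψ (fun l => stdFrame n (c l)) • _ = _
      rw [this, zero_smul]
    have := toExt_injective (h0.trans (map_zero _).symm)
    ext v
    exact congrArg (fun x => x v) this
  obtain ⟨K, -, hK⟩ := L.exists_antilipschitzWith hL
  refine ⟨(K : ℝ) ^ 2 * k.factorial, by positivity, fun ψ => ?_⟩
  have h := hK.le_mul_dist ψ 0
  rw [map_zero, dist_zero_right, dist_zero_right] at h
  calc ‖ψ‖ ^ 2 ≤ (K * ‖L ψ‖) ^ 2 := by gcongr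
    _ = K ^ 2 * ∑ c : Fin k → Idx n, Complex.normSq (ψ fun l => stdFrame n (c l)) := by
      rw [mul_pow, EuclideanSpace.norm_sq_eq]
      simp only [Complex.normSq_eq_norm_sq]
      rfl
    _ = _ := by
      have : (k.factorial : ℝ) ≠ 0 := by positivity
      field_simp

theorem exists_norm_comp_sq_le (n k : ℕ) : ∃ C : ℝ, 0 ≤ C ∧ ∀ (Ω : Alt n 2) (A : Cn n ≃L[ℂ] Cn n),
    IsUnitary Ω A → ∀ φ : Alt n k, ‖φ.comp (A : Cn n →L[ℂ] Cn n)‖ ^ 2 ≤ C * normSq Ω φ := by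
  obtain ⟨C, hC, h⟩ := exists_norm_sq_le_sum n k
  refine ⟨C, hC, fun Ω A hA φ => ?_⟩
  rw [normSq_eq hA]
  exact h _

theorem normSq_nonneg {Ω : Alt n 2} (hΩ : IsPositive Ω) (φ : Alt n k) : 0 ≤ normSq Ω φ := by
  obtain ⟨A, hA⟩ := hΩ.exists_isUnitary
  rw [normSq_eq hA]
  have := fun c : Fin k → Idx n =>
    Complex.normSq_nonneg (φ.comp (A : Cn n →L[ℂ] Cn n) fun l => stdFrame n (c l))
  exact mul_nonneg (by positivity) (Finset.sum_nonneg fun c _ => this c)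

theorem norm_pairing_le (w : Alt n 2) (f : Alt n k) :
    ‖pairing n k w f f‖ ≤ ‖pairing n k‖ * ‖w‖ * ‖f‖ ^ 2 := by
  calc _ ≤ ‖pairing n k w f‖ * ‖f‖ := ContinuousLinearMap.le_opNorm _ _
    _ ≤ (‖pairing n k w‖ * ‖f‖) * ‖f‖ := by
      gcongr; exact ContinuousLinearMap.le_opNorm _ _
    _ ≤ ((‖pairing n k‖ * ‖w‖) * ‖f‖) * ‖f‖ := by
      gcongr
      exact (pairing n k).le_opNorm _
    _ = _ := by ring

theorem IsUnitary.riem_self {Ω : Alt n 2} {A : Cn n ≃L[ℂ] Cn n} (hA : IsUnitary Ω A) (v : Cn n) :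
    riem Ω (A v) (A v) = ‖v‖ ^ 2 := by
  rw [hA]
  exact inner_self_eq_norm_sq (𝕜 := ℂ) v

theorem IsPositive.comp_apply_of_isUnitary {Ω : Alt n 2} (hΩ : IsPositive Ω)
    {A : Cn n ≃L[ℂ] Cn n} (hA : IsUnitary Ω A) (v w : Cn n) :
    Ω.comp (A : Cn n →L[ℂ] Cn n) ![v, w] = ((inner ℂ v (-Complex.I • w)).re : ℂ) := by
  have e : (fun l => A ((![v, w] : Fin 2 → Cn n) l)) = ![A v, A w] := by
    ext1 i
    fin_cases i <;> rfl
  rw [← hA, riem, map_smul, smul_smul]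
  simp only [mul_neg, Complex.I_mul_I, neg_neg, one_smul]
  rw [Alt.comp_apply]
  simp only [ContinuousLinearEquiv.coe_coe]
  rw [e]
  refine Complex.ext rfl ?_
  rw [hΩ.real, Complex.ofReal_im]

theorem IsPositive.norm_comp_le_one {Ω : Alt n 2} (hΩ : IsPositive Ω)
    {A : Cn n ≃L[ℂ] Cn n} (hA : IsUnitary Ω A) : ‖Ω.comp (A : Cn n →L[ℂ] Cn n)‖ ≤ 1 := by
  refine ContinuousAlternatingMap.opNorm_le_bound _ zero_le_one fun m => ?_
  have e : m = ![m 0, m 1] := by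
    ext1 i
    fin_cases i <;> rfl
  conv_lhs => rw [e]
  rw [hΩ.comp_apply_of_isUnitary hA, Complex.norm_real, one_mul, Fin.prod_univ_two]
  calc _ ≤ ‖inner ℂ (m 0) (-Complex.I • m 1)‖ := Complex.abs_re_le_norm _
    _ ≤ ‖m 0‖ * ‖-Complex.I • m 1‖ := norm_inner_le_norm _ _
    _ = _ := by rw [norm_smul]; simp

theorem exists_norm_density_self_le (n k : ℕ) : ∃ C : ℝ, 0 ≤ C ∧ ∀ Ω : Alt n 2, IsPositive Ω →
    ∀ f : Alt n k, ‖density Ω Ω f‖ ≤ C * normSq Ω f := by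
  obtain ⟨C, hC, h⟩ := exists_norm_comp_sq_le n k
  refine ⟨‖pairing n k‖ * C, by positivity, fun Ω hΩ f => ?_⟩
  obtain ⟨A, hA⟩ := hΩ.exists_isUnitary
  rw [density_eq hA]
  refine (norm_pairing_le _ _).trans ?_
  have h1 := hΩ.norm_comp_le_one hA
  have h2 := h Ω A hA f
  calc _ ≤ ‖pairing n k‖ * 1 * (C * normSq Ω f) := by gcongr
    _ = _ := by ring

/-- In a unitary frame the covector has Euclidean norm at most `a`, and all operations involved are
fixed bounded multilinear maps. The constant depends only on `n`, `k` and `c`, so the bound is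
uniform over a manifold. -/
theorem exists_norm_density_dolbWedge_le (n k : ℕ) (c : ℂ) : ∃ C : ℝ, 0 ≤ C ∧
    ∀ Ω : Alt n 2, IsPositive Ω → ∀ (ξ : Cn n →L[ℝ] ℝ) (a : ℝ), 0 ≤ a →
    (∀ v, |ξ v| ≤ a * Real.sqrt (riem Ω v v)) → ∀ (θ : Alt n 1) (f : Alt n k),
    ‖density Ω (dolbWedge c ξ θ) f‖ ≤ C * a * Real.sqrt (normSq Ω θ) * normSq Ω f := by
  obtain ⟨C, hC, h⟩ := exists_norm_comp_sq_le n k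
  obtain ⟨C', hC', h'⟩ := exists_norm_comp_sq_le n 1
  let D : (Cn n →L[ℝ] ℝ) →L[ℝ] Alt n 1 →L[ℝ] Alt n 2 := toCLM₂ (dolbWedge c)
  refine ⟨‖pairing n k‖ * ‖D‖ * Real.sqrt C' * C, by positivity, fun Ω hΩ ξ a ha hξ θ f => ?_⟩
  obtain ⟨A, hA⟩ := hΩ.exists_isUnitary
  rw [density_eq hA, dolbWedge_comp]
  set ξ' := ξ.comp ((A : Cn n →L[ℂ] Cn n).restrictScalars ℝ)
  have h1 : ‖ξ'‖ ≤ a := by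
    refine ContinuousLinearMap.opNorm_le_bound _ ha fun v => ?_
    refine (hξ (A v)).trans ?_
    rw [hA.riem_self, Real.sqrt_sq (norm_nonneg v)]
  have h2 : ‖θ.comp (A : Cn n →L[ℂ] Cn n)‖ ≤ Real.sqrt C' * Real.sqrt (normSq Ω θ) := by
    rw [← Real.sqrt_mul hC']
    exact Real.le_sqrt_of_sq_le (h' Ω A hA θ)
  have h3 : ‖dolbWedge c ξ' (θ.comp (A : Cn n →L[ℂ] Cn n))‖ ≤
      ‖D‖ * a * (Real.sqrt C' * Real.sqrt (normSq Ω θ)) := by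
    change ‖D ξ' _‖ ≤ _
    calc _ ≤ ‖D ξ'‖ * _ := ContinuousLinearMap.le_opNorm _ _
      _ ≤ _ := by
        gcongr
        exact (D.le_opNorm _).trans (by gcongr)
  refine (norm_pairing_le _ _).trans ?_
  have h4 := h Ω A hA f
  calc _ ≤ ‖pairing n k‖ * (‖D‖ * a * (Real.sqrt C' * Real.sqrt (normSq Ω θ))) *
        (C * normSq Ω f) := by gcongr
    _ = _ := by ring

/-- The inverse of a unitary frame has norm at most `√‖Ω‖`, since `|A⁻¹ v|² = g(v, v) ≤ ‖Ω‖ |v|²`;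
pulling back a `k`-form by it costs the `k`-th power. -/
theorem exists_norm_sq_le_normSq (n k : ℕ) : ∃ C : ℝ, 0 ≤ C ∧ ∀ Ω : Alt n 2, IsPositive Ω →
    ∀ φ : Alt n k, ‖φ‖ ^ 2 ≤ C * ‖Ω‖ ^ k * normSq Ω φ := by
  obtain ⟨C, hC, h⟩ := exists_norm_comp_sq_le n k
  refine ⟨C, hC, fun Ω hΩ φ => ?_⟩
  obtain ⟨A, hA⟩ := hΩ.exists_isUnitary
  set B : Cn n →L[ℝ] Cn n := (A.symm : Cn n →L[ℂ] Cn n).restrictScalars ℝ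
  have hB : ‖B‖ ≤ Real.sqrt ‖Ω‖ := by
    refine ContinuousLinearMap.opNorm_le_bound _ (Real.sqrt_nonneg _) fun v => ?_
    rw [← sq_le_sq₀ (norm_nonneg _) (by positivity), mul_pow, Real.sq_sqrt (norm_nonneg _)]
    change ‖A.symm v‖ ^ 2 ≤ _
    rw [← hA.riem_self, A.apply_symm_apply, riem]
    calc _ ≤ ‖Ω ![v, Complex.I • v]‖ := Complex.re_le_norm _
      _ ≤ ‖Ω‖ * ∏ i, ‖(![v, Complex.I • v] : Fin 2 → Cn n) i‖ := Ω.le_opNorm _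
      _ = _ := by
        rw [Fin.prod_univ_two]
        simp [norm_smul, sq]
  have h1 : ‖φ‖ ≤ ‖φ.comp (A : Cn n →L[ℂ] Cn n)‖ * Real.sqrt ‖Ω‖ ^ k := by
    conv_lhs => rw [← φ.comp_symm A]
    refine (ContinuousAlternatingMap.norm_compContinuousLinearMap_le _ B).trans ?_
    rw [Fintype.card_fin]
    gcongr
  calc ‖φ‖ ^ 2 ≤ (‖φ.comp (A : Cn n →L[ℂ] Cn n)‖ * Real.sqrt ‖Ω‖ ^ k) ^ 2 := by gcongr
    _ = ‖φ.comp (A : Cn n →L[ℂ] Cn n)‖ ^ 2 * ‖Ω‖ ^ k := by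
      rw [mul_pow, ← pow_mul, mul_comm k 2, pow_mul, Real.sq_sqrt (norm_nonneg _)]
    _ ≤ C * normSq Ω φ * ‖Ω‖ ^ k := by
      gcongr
      exact h Ω A hA φ
    _ = _ := by ring

/-! ### The Hodge–Riemann relation for a general positive form -/

theorem IsPositive.ext_comp {Ω : Alt n 2} (hΩ : IsPositive Ω)
    {A : Cn n ≃L[ℂ] Cn n} (hA : IsUnitary Ω A) :
    ext n 2 (Ω.comp (A : Cn n →L[ℂ] Cn n)) = stdOmega n := by
  have e0 : ∀ l : Fin n, -Complex.I • stdFrame n (l, 0) = -stdFrame n (l, 1) := fun l => by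
    ext i
    by_cases h : i = l <;> simp [stdFrame, h]
  have e1 : ∀ l : Fin n, -Complex.I • stdFrame n (l, 1) = stdFrame n (l, 0) := fun l => by
    ext i
    by_cases h : i = l <;> simp [stdFrame, h]
  have key : ∀ a b : Idx n, coframes ![a, b] = coframe a * coframe b := fun a b => by
    rw [coframes_cons]
    simp [coframes, coframe]
  have hv : ∀ a b : Idx n, (Ω.comp (A : Cn n →L[ℂ] Cn n)) (fun l => stdFrame n (![a, b] l)) =
      ((inner ℂ (stdFrame n a) (-Complex.I • stdFrame n b)).re : ℂ) := fun a b => by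
    rw [← hΩ.comp_apply_of_isUnitary hA]
    congr 1
    ext1 i
    fin_cases i <;> rfl
  rw [ext_apply, toExt_apply, ← (finTwoArrowEquiv (Idx n)).symm.sum_comp]
  rw [Fintype.sum_prod_type]
  have : ∀ a b : Idx n, (Ω.comp (A : Cn n →L[ℂ] Cn n)).toAlternatingMap
      (fun l => stdFrame n ((finTwoArrowEquiv (Idx n)).symm (a, b) l)) •
      coframes ((finTwoArrowEquiv (Idx n)).symm (a, b)) =
      ((inner ℂ (stdFrame n a) (-Complex.I • stdFrame n b)).re : ℂ) • (coframe a * coframe b) := by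
    intro a b
    rw [← hv, ← key]
    rfl
  simp only [this, Fintype.sum_prod_type, Fin.sum_univ_two, e0, e1, inner_neg_right, Complex.neg_re,
    re_inner_stdFrame, Prod.mk.injEq]
  simp only [stdOmega, area, Finset.smul_sum]
  refine Finset.sum_congr rfl fun j _ => ?_
  have h0 : ∀ (c : ℝ) (x : Ext n) (P : Prop) [Decidable P],
      ((if P then c else 0 : ℝ) : ℂ) • x = if P then (c : ℂ) • x else 0 := fun c x P _ => by
    split_ifs <;> simp
  simp only [Complex.ofReal_neg, neg_smul, h0, Finset.sum_neg_distrib, and_true, show ¬(1 : Fin 2) = 0 by decide, show ¬(0 : Fin 2) = 1 by decide, and_false, if_false,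
    Finset.sum_ite_eq, Finset.mem_univ, if_true, neg_zero, zero_add, add_zero,
    Complex.ofReal_one, Complex.ofReal_zero, zero_smul, one_smul]
  rw [coframe_mul_coframe (j, 1) (j, 0)]
  simp only [neg_neg, Nat.factorial_two, Nat.cast_ofNat]
  module

/-- A unitary frame turns `Ω` into `∑ dx_j ∧ dy_j` and preserves bidegree and primitivity, so the
standard case applies. -/
theorem IsPositive.hodge_riemann {p q : ℕ} (hn : p + q + 1 = n) {Ω : Alt n 2} (hΩ : IsPositive Ω)
    (φ : Alt n (p + q)) (hb : IsBidegree p q φ.toAlternatingMap)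
    (hp : IsPrimitive n Ω.toAlternatingMap φ.toAlternatingMap) :
    ∃ R : ℝ, 0 ≤ R ∧ density Ω Ω φ = hrSign p q * R ∧ (R = 0 → φ = 0) := by
  obtain ⟨A, hA⟩ := hΩ.exists_isUnitary
  have hp' : ext n _ φ * ext n 2 Ω ^ 2 = 0 := by
    have := congrArg (toExt n _) hp
    rw [toExt_wedgePow, map_zero] at this
    -- Primitivity in degree `n - 1` is annihilation by the square of the metric.
    have e : n - (p + q) + 1 = 2 := by omega
    rwa [e] at this
  have hp2 : ext n _ (φ.comp (A : Cn n →L[ℂ] Cn n)) * stdOmega n ^ 2 = 0 := by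
    rw [← hΩ.ext_comp hA, SKT.ext_comp, SKT.ext_comp, ← map_pow, ← map_mul, hp', map_zero]
  have hb2 : IsBidegree p q (φ.comp (A : Cn n →L[ℂ] Cn n)).toAlternatingMap := by
    intro c v
    change φ (fun l => A (c • v l)) = _
    simp only [map_smul]
    exact hb c _
  obtain ⟨R, h0, h1, h2⟩ := SKT.hodge_riemann hn _ hb2 hp2
  refine ⟨R, h0, ?_, fun hR => ?_⟩
  · rw [density_eq hA, pairing_apply, hΩ.ext_comp hA]
    exact h1
  · have h3 : φ.comp (A : Cn n →L[ℂ] Cn n) = 0 := by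
      ext v
      exact congrArg (fun x => x v) (h2 hR)
    rw [← φ.comp_symm A, h3]
    rfl

end Metric

/-! ### Naturality of `∂` and `∂̄` on `1`-forms -/

section Naturality

set_option maxSynthPendingDepth 3

variable {n k : ℕ}

/-- Differentiating a pull-back by a holomorphic map gives the expected term and one involving the
second derivative of `τ`, and the latter disappears after alternatization. -/
theorem dolb_fderiv_comp {c : ℂ} {τ : Cn n → Cn n} {a a' : Cn n → Alt n 1} {z : Cn n}
    (hτ : ContDiffAt ℂ ω τ z) (ha : DifferentiableAt ℝ a z)
    (ha' : DifferentiableAt ℝ a' (τ z))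
    (h : ∀ᶠ y in nhds z, a y = (a' (τ y)).comp (fderiv ℂ τ y)) :
    dolb c (fderiv ℝ a z) = (dolb c (fderiv ℝ a' (τ z))).comp (fderiv ℂ τ z) := by
  let L : Alt n 1 →L[ℝ] (Cn n →L[ℝ] ℂ) := LinearMap.toContinuousLinearMap
    { toFun := fun ψ => LinearMap.toContinuousLinearMap
        ((AlternatingMap.ofSubsingleton ℝ (Cn n) ℂ (0 : Fin 1)).symm ψ.toAlternatingMap)
      map_add' := fun _ _ => rfl
      map_smul' := fun _ _ => rfl }
  have hL : ∀ (ψ : Alt n 1) (u : Fin 1 → Cn n), ψ u = L ψ (u 0) := fun ψ u => by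
    have : u = fun _ => u 0 := by
      ext1 i
      rw [Subsingleton.elim i 0]
    conv_lhs => rw [this]
    rfl
  set D := fderiv ℂ τ z
  set D₂ := fderiv ℂ (fderiv ℂ τ) z
  have hsymm : ∀ v w, D₂ v w = D₂ w v := hτ.isSymmSndFDerivAt (by simp)
  have hD₂ : HasFDerivAt (fderiv ℂ τ) D₂ z :=
    ((hτ.fderiv_right (m := 1) (by simp)).differentiableAt (by simp)).hasFDerivAt
  have hD : HasFDerivAt τ (D.restrictScalars ℝ) z :=
    (hτ.differentiableAt (by simp)).hasFDerivAt.restrictScalars ℝ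
  have hda : ∀ (v : Cn n) (u : Fin 1 → Cn n), fderiv ℝ a z v u =
      L (fderiv ℝ a' (τ z) (D v)) (D (u 0)) + L (a' (τ z)) (D₂ v (u 0)) := by
    intro v u
    have h1 : HasFDerivAt (fun y => L (a y) (u 0)) ((fderiv ℝ (fun y => L (a y)) z).flip (u 0)) z := by
      have hG : DifferentiableAt ℝ (fun y => L (a y)) z := L.differentiableAt.comp z ha
      simpa using hG.hasFDerivAt.clm_apply (hasFDerivAt_const (u 0) z)
    have h2 : HasFDerivAt (fun y => fderiv ℂ τ y (u 0)) ((D₂.flip (u 0)).restrictScalars ℝ) z := by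
      have := hD₂.clm_apply (hasFDerivAt_const (u 0) z)
      simp only [ContinuousLinearMap.comp_zero, zero_add] at this
      exact this.restrictScalars ℝ
    have h3 : HasFDerivAt (fun y => L (a' (τ y))) ((L.comp (fderiv ℝ a' (τ z))).comp
        (D.restrictScalars ℝ)) z :=
      (L.hasFDerivAt.comp _ ha'.hasFDerivAt).comp z hD
    have h4 := h3.clm_apply h2
    have h5 : (fun y => L (a y) (u 0)) =ᶠ[nhds z] fun y => L (a' (τ y)) (fderiv ℂ τ y (u 0)) := by
      filter_upwards [h] with y hy
      rw [← hL, hy, Alt.comp_apply, hL]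
    have h6 := congrArg (fun T => T v) ((h4.congr_of_eventuallyEq h5).unique h1)
    have h7 : fderiv ℝ (fun y => L (a y)) z = L.comp (fderiv ℝ a z) :=
      (L.hasFDerivAt.comp z ha.hasFDerivAt).fderiv
    rw [hL, add_comm]
    simp only [h7] at h6
    exact h6.symm
  let R : Cn n →L[ℝ] Alt n 1 := fderiv ℝ a z -
    LinearMap.toContinuousLinearMap
    { toFun := fun v => (fderiv ℝ a' (τ z) (D v)).comp D
      map_add' := fun v w => by simp only [map_add]; rfl
      map_smul' := fun r v => by
        rw [RingHom.id_apply, ← Complex.coe_smul, map_smul, Complex.coe_smul, map_smul]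
        rfl }
  have hR : ∀ v u, R v u = L (a' (τ z)) (D₂ v (u 0)) := by
    intro v u
    have : R v u = fderiv ℝ a z v u - (fderiv ℝ a' (τ z) (D v)).comp D u := rfl
    rw [this, hda, Alt.comp_apply, hL _ (fun l => D (u l))]
    ring
  -- The second derivative is symmetric and complex bilinear, so taking the `(1,0)` or `(0,1)` part
  -- leaves an expression symmetric in the two vectors.
  have hR0 : dolb c R = 0 := by
    ext u
    simp only [dolb, LinearMap.coe_mk, AddHom.coe_mk,
      ContinuousAlternatingMap.alternatizeUncurryFin_apply, typePart_apply]
    simp only [ContinuousAlternatingMap.smul_apply, ContinuousAlternatingMap.sub_apply, hR,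
      map_smul, smul_apply]
    simp [Fin.removeNth, hsymm (u 1) (u 0)]
  rw [dolb_comp c (fderiv ℝ a' (τ z)) D (fderiv ℝ a z - R), map_sub, hR0, sub_zero]
  intro v
  ext u
  simp [R]

end Naturality

/-! ### Forms in charts and under transition maps -/

section Charts

variable {n k : ℕ} {M : Type*} [TopologicalSpace M] [ChartedSpace (Cn n) M]

/-- The derivative of the inverse of a chart. -/
def chartD (e : OpenPartialHomeomorph M (Cn n)) (z : Cn n) : Cn n →L[ℂ] Cn n :=
  mfderiv 𝓘(ℂ, Cn n) 𝓘(ℂ, Cn n) e.symm z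

/-- The value of a form at a point, as a form on the model space. -/
def Form.val (φ : Form n M k) (x : M) : Alt n k := φ x

theorem inChart_eq (e : OpenPartialHomeomorph M (Cn n)) (φ : Form n M k) (z : Cn n) :
    inChart e φ z = (φ.val (e.symm z)).comp (chartD e z) := rfl

variable [IsManifold 𝓘(ℂ, Cn n) ω M] {e e' : OpenPartialHomeomorph M (Cn n)}

theorem exists_chartD_eq (he : e ∈ atlas (Cn n) M) {z : Cn n} (hz : z ∈ e.target) :
    ∃ B : Cn n ≃L[ℂ] Cn n, (B : Cn n →L[ℂ] Cn n) = chartD e z := by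
  have : IsManifold 𝓘(ℂ, Cn n) 1 M := IsManifold.of_le (n := ω) (by simp)
  exact ⟨(mdifferentiable_of_mem_atlas (I := 𝓘(ℂ, Cn n)) he).symm.mfderiv hz, rfl⟩

/-- The transition map between two charts. -/
def trans (e e' : OpenPartialHomeomorph M (Cn n)) : Cn n → Cn n := e' ∘ e.symm

/-- The domain of the transition map. -/
def overlap (e e' : OpenPartialHomeomorph M (Cn n)) : Set (Cn n) :=
  e.target ∩ e.symm ⁻¹' e'.source

omit [ChartedSpace (Cn n) M] [IsManifold 𝓘(ℂ, Cn n) ω M] in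
theorem isOpen_overlap : IsOpen (overlap e e') :=
  e.symm.continuousOn.isOpen_inter_preimage e.open_target e'.open_source

theorem contDiffOn_trans (he : e ∈ atlas (Cn n) M) (he' : e' ∈ atlas (Cn n) M) :
    ContDiffOn ℂ ω (trans e e') (overlap e e') := by
  rw [← contMDiffOn_iff_contDiffOn]
  have h1 := contMDiffOn_symm_of_mem_maximalAtlas (I := 𝓘(ℂ, Cn n)) (n := ω)
    (IsManifold.subset_maximalAtlas he)
  have h2 := contMDiffOn_of_mem_maximalAtlas (I := 𝓘(ℂ, Cn n)) (n := ω)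
    (IsManifold.subset_maximalAtlas he')
  exact h2.comp (h1.mono Set.inter_subset_left) Set.inter_subset_right

theorem chartD_eq_comp (he : e ∈ atlas (Cn n) M) (he' : e' ∈ atlas (Cn n) M) {z : Cn n}
    (hz : z ∈ overlap e e') :
    chartD e z = (chartD e' (trans e e' z)).comp (fderiv ℂ (trans e e') z) := by
  have : IsManifold 𝓘(ℂ, Cn n) 1 M := IsManifold.of_le (n := ω) (by simp)
  have hτ : MDifferentiableAt 𝓘(ℂ, Cn n) 𝓘(ℂ, Cn n) (trans e e') z :=
    (((contDiffOn_trans he he').contDiffAt (isOpen_overlap.mem_nhds hz)).differentiableAt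
      (by simp)).mdifferentiableAt
  have h1 : MDifferentiableAt 𝓘(ℂ, Cn n) 𝓘(ℂ, Cn n) e'.symm (trans e e' z) :=
    mdifferentiableAt_atlas_symm he' (e'.map_source hz.2)
  rw [← mfderiv_eq_fderiv]
  have h2 := mfderiv_comp z h1 hτ
  refine Eq.trans ?_ h2
  refine Filter.EventuallyEq.mfderiv_eq ?_
  filter_upwards [isOpen_overlap.mem_nhds hz] with y hy
  exact (e'.left_inv hy.2).symm

theorem inChart_eq_comp_trans (he : e ∈ atlas (Cn n) M) (he' : e' ∈ atlas (Cn n) M)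
    (φ : Form n M k) {z : Cn n} (hz : z ∈ overlap e e') :
    inChart e φ z = Alt.comp (inChart e' φ (trans e e' z)) (fderiv ℂ (trans e e') z) := by
  have h : e'.symm (trans e e' z) = e.symm z := e'.left_inv hz.2
  rw [inChart_eq, inChart_eq, Alt.comp_comp, ← chartD_eq_comp he he' hz, h]

/-- The operator `∂` or `∂̄` on forms. -/
def dolbForm (c : ℂ) (φ : Form n M k) : Form n M (k + 1) := fun x =>
  (dolb c (fderiv ℝ (inChart (chartAt (Cn n) x) φ)
    (chartAt (Cn n) x x))).compContinuousLinearMap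
    ((mfderiv 𝓘(ℂ, Cn n) 𝓘(ℂ, Cn n) (chartAt (Cn n) x) x).restrictScalars ℝ)

omit [IsManifold 𝓘(ℂ, Cn n) ω M] in
theorem del_eq (φ : Form n M k) : del φ = dolbForm Complex.I φ := rfl

omit [IsManifold 𝓘(ℂ, Cn n) ω M] in
theorem delbar_eq (φ : Form n M k) : delbar φ = dolbForm (-Complex.I) φ := by
  funext x
  simp only [delbar, dolbForm, flatDelbar_eq]

/-- The operators are defined point by point in preferred charts; naturality under the holomorphic
transition map allows any single chart to be used throughout its target. -/
theorem inChart_dolbForm (he : e ∈ atlas (Cn n) M) (c : ℂ) {α : Form n M 1} (hα : IsSmooth α)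
    {z : Cn n} (hz : z ∈ e.target) :
    inChart e (dolbForm c α) z = dolb c (fderiv ℝ (inChart e α) z) := by
  have : IsManifold 𝓘(ℂ, Cn n) 1 M := IsManifold.of_le (n := ω) (by simp)
  set x := e.symm z with hx
  set e' := chartAt (Cn n) x
  have he' : e' ∈ atlas (Cn n) M := chart_mem_atlas _ x
  have hzV : z ∈ overlap e e' := ⟨hz, mem_chart_source _ x⟩
  have hτ := (contDiffOn_trans he he').contDiffAt (isOpen_overlap.mem_nhds hzV)
  have hd : (mfderiv 𝓘(ℂ, Cn n) 𝓘(ℂ, Cn n) e' x : Cn n →L[ℂ] Cn n).comp (chartD e z) =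
      fderiv ℂ (trans e e') z := by
    rw [← mfderiv_eq_fderiv]
    exact (mfderiv_comp z (mdifferentiableAt_atlas (I := 𝓘(ℂ, Cn n)) he' (mem_chart_source _ x))
      (mdifferentiableAt_atlas_symm (I := 𝓘(ℂ, Cn n)) he hz)).symm
  have hz' : trans e e' z ∈ e'.target := e'.map_source hzV.2
  rw [dolb_fderiv_comp (a' := inChart e' α) hτ
    (((hα e he).contDiffAt (e.open_target.mem_nhds hz)).differentiableAt (by simp))
    (((hα e' he').contDiffAt (e'.open_target.mem_nhds hz')).differentiableAt (by simp)), ← hd]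
  · rfl
  · filter_upwards [isOpen_overlap.mem_nhds hzV] with y hy
    exact inChart_eq_comp_trans he he' α hy

end Charts

/-! ### The volume measure in charts -/

section Volume

set_option maxSynthPendingDepth 3

variable {n k : ℕ}

theorem continuous_gram : Continuous (gram (n := n)) := by
  refine continuous_matrix fun a b => Complex.continuous_re.comp ?_
  let L : Alt n 2 →ₗ[ℝ] ℂ :=
    { toFun := fun Ω => Ω ![stdFrame n a, Complex.I • stdFrame n b]
      map_add' := fun _ _ => rfl
      map_smul' := fun _ _ => rfl }
  exact L.continuous_of_finiteDimensional

theorem continuous_sqrt_det_gram : Continuous fun Ω : Alt n 2 => Real.sqrt (gram Ω).det :=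
  Real.continuous_sqrt.comp continuous_gram.matrix_det

variable {M : Type*} [TopologicalSpace M] [ChartedSpace (Cn n) M]

/-- A continuous positive `(1,1)`-form. -/
structure IsMetric (Ω : Form n M 2) : Prop where
  pos : ∀ x, IsPositive (Ω.val x)
  continuousOn : ∀ e ∈ atlas (Cn n) M, ContinuousOn (inChart e Ω) e.target

/-- The density of the volume measure in a chart. -/
def volDensity (Ω : Form n M 2) (e : OpenPartialHomeomorph M (Cn n)) (z : Cn n) : ENNReal :=
  ENNReal.ofReal (Real.sqrt (gram (inChart e Ω z)).det)

/-- The volume measure in a chart, as a measure on `ℂⁿ`. -/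
def flatVolume (Ω : Form n M 2) (e : OpenPartialHomeomorph M (Cn n)) : Measure (Cn n) :=
  ((volume : Measure (Cn n)).restrict e.target).withDensity (volDensity Ω e)

variable {Ω : Form n M 2} {e e' : OpenPartialHomeomorph M (Cn n)}

theorem flatVolume_absolutelyContinuous :
    flatVolume Ω e ≪ (volume : Measure (Cn n)).restrict e.target :=
  withDensity_absolutelyContinuous _ _

theorem ae_mem_target : ∀ᵐ z ∂(flatVolume Ω e), z ∈ e.target :=
  flatVolume_absolutelyContinuous.ae_le (ae_restrict_mem e.open_target.measurableSet)

theorem IsMetric.aemeasurable_volDensity (hΩ : IsMetric Ω) (he : e ∈ atlas (Cn n) M) :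
    AEMeasurable (volDensity Ω e) ((volume : Measure (Cn n)).restrict e.target) :=
  ((continuous_sqrt_det_gram.comp_continuousOn
    (hΩ.continuousOn e he)).aemeasurable e.open_target.measurableSet).ennreal_ofReal

theorem exists_fderiv_trans_eq [IsManifold 𝓘(ℂ, Cn n) ω M] (he : e ∈ atlas (Cn n) M)
    (he' : e' ∈ atlas (Cn n) M) {z : Cn n} (hz : z ∈ overlap e e') :
    ∃ B : Cn n ≃L[ℂ] Cn n, (B : Cn n →L[ℂ] Cn n) = fderiv ℂ (trans e e') z := by
  obtain ⟨B, hB⟩ := exists_chartD_eq he hz.1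
  obtain ⟨B', hB'⟩ := exists_chartD_eq he' (e'.map_source hz.2)
  refine ⟨B.trans B'.symm, ?_⟩
  have h := chartD_eq_comp he he' hz
  ext1 v
  have h1 := congrArg (fun T => T v) h
  change B'.symm (B v) = _
  rw [ContinuousLinearEquiv.symm_apply_eq]
  change (B : Cn n →L[ℂ] Cn n) v = (B' : Cn n →L[ℂ] Cn n) _
  rw [hB, hB']
  exact h1

variable [MeasurableSpace M] [BorelSpace M]

theorem aemeasurable_symm : AEMeasurable e.symm (flatVolume Ω e) :=
  (e.continuousOn_symm.aemeasurable e.open_target.measurableSet).mono_ac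
    flatVolume_absolutelyContinuous

omit [BorelSpace M] in
theorem chartVolume_eq : chartVolume Ω e = (flatVolume Ω e).map e.symm := rfl

theorem chartVolume_apply {s : Set M} (hs : MeasurableSet s) :
    chartVolume Ω e s = ∫⁻ z in e.target ∩ e.symm ⁻¹' s, volDensity Ω e z := by
  rw [chartVolume_eq, Measure.map_apply_of_aemeasurable aemeasurable_symm hs, flatVolume,
    withDensity_apply', Measure.restrict_restrict' e.open_target.measurableSet, Set.inter_comm]

theorem ae_mem_source : ∀ᵐ y ∂(chartVolume Ω e), y ∈ e.source := by
  rw [ae_iff]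
  change chartVolume Ω e e.sourceᶜ = 0
  rw [chartVolume_apply e.open_source.measurableSet.compl]
  have : e.target ∩ e.symm ⁻¹' e.sourceᶜ = ∅ := by
    ext z
    simp only [Set.mem_inter_iff, Set.mem_preimage, Set.mem_compl_iff, Set.mem_empty_iff_false,
      iff_false, not_and, not_not]
    exact fun hz => e.map_target hz
  rw [this, Measure.restrict_empty, lintegral_zero_measure]

theorem chartVolume_restrict_source : (chartVolume Ω e).restrict e.source = chartVolume Ω e :=
  Measure.restrict_eq_self_of_ae_mem ae_mem_source

omit [ChartedSpace (Cn n) M] in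
theorem measurableSet_target_inter_preimage {s : Set M} (hs : MeasurableSet s) :
    MeasurableSet (e.target ∩ e.symm ⁻¹' s) := by
  have h : Measurable (e.target.domRestrict e.symm) :=
    (continuousOn_iff_continuous_domRestrict.mp e.continuousOn_symm).measurable
  have := e.open_target.measurableSet.subtype_image (h hs)
  convert this using 1
  ext z
  simp [Set.domRestrict_apply, and_comm]

theorem aemeasurable_chart : AEMeasurable e (chartVolume Ω e) := by
  rw [← chartVolume_restrict_source]
  exact e.continuousOn.aemeasurable e.open_source.measurableSet

theorem map_chartVolume : (chartVolume Ω e).map e = flatVolume Ω e := by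
  have h := aemeasurable_chart (Ω := Ω) (e := e)
  rw [chartVolume_eq] at h ⊢
  rw [AEMeasurable.map_map_of_aemeasurable h aemeasurable_symm]
  refine (Measure.map_congr ?_).trans Measure.map_id
  filter_upwards [ae_mem_target] with z hz
  exact e.right_inv hz

/-- Change of variables along the transition map: `√det g` scales by its real Jacobian, which is
positive because the map is holomorphic. -/
theorem chartVolume_apply_eq [IsManifold 𝓘(ℂ, Cn n) ω M] (hΩ : ∀ x, IsPositive (Ω.val x))
    (he : e ∈ atlas (Cn n) M) (he' : e' ∈ atlas (Cn n) M) {s : Set M} (hs : MeasurableSet s)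
    (hse : s ⊆ e.source) (hse' : s ⊆ e'.source) : chartVolume Ω e s = chartVolume Ω e' s := by
  rw [chartVolume_apply hs, chartVolume_apply hs]
  set S := e.target ∩ e.symm ⁻¹' s
  have hS : S ⊆ overlap e e' := fun z hz => ⟨hz.1, hse' hz.2⟩
  have himg : e'.target ∩ e'.symm ⁻¹' s = trans e e' '' S := by
    ext w
    constructor
    · rintro ⟨hw, hw'⟩
      refine ⟨e (e'.symm w), ⟨e.map_source (hse hw'), ?_⟩, ?_⟩
      · rw [Set.mem_preimage, e.left_inv (hse hw')]
        exact hw'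
      · rw [trans, Function.comp_apply, e.left_inv (hse hw'), e'.right_inv hw]
    · rintro ⟨z, hz, rfl⟩
      refine ⟨e'.map_source (hse' hz.2), ?_⟩
      rw [Set.mem_preimage, trans, Function.comp_apply, e'.left_inv (hse' hz.2)]
      exact hz.2
  have hinj : Set.InjOn (trans e e') S := by
    intro z hz w hw h
    have h1 := congrArg e'.symm h
    simp only [trans, Function.comp_apply] at h1
    rw [e'.left_inv (hse' hz.2), e'.left_inv (hse' hw.2)] at h1
    exact e.symm.injOn hz.1 hw.1 h1
  have hmeas : MeasurableSet S := measurableSet_target_inter_preimage hs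
  rw [himg, lintegral_image_eq_lintegral_abs_det_fderiv_mul volume hmeas
    (f' := fun z => (fderiv ℂ (trans e e') z).restrictScalars ℝ) ?_ hinj]
  · refine setLIntegral_congr_fun hmeas fun z hz => ?_
    obtain ⟨B, hB⟩ := exists_fderiv_trans_eq he he' (hS hz)
    obtain ⟨C, hC⟩ := exists_chartD_eq he' (e'.map_source (hS hz).2)
    have hpos : IsPositive (inChart e' Ω (trans e e' z)) := by
      rw [inChart_eq, show trans e e' z = e' (e.symm z) from rfl, ← hC]
      exact (hΩ _).comp C
    have hdet : ((fderiv ℂ (trans e e') z).restrictScalars ℝ).det = rdet (B : Cn n →L[ℂ] Cn n) := by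
      rw [hB]
      rfl
    simp only [volDensity]
    rw [inChart_eq_comp_trans he he' Ω (hS hz), ← hB, sqrt_det_gram_comp hpos, hB, hdet,
      abs_of_pos (rdet_pos B), ← ENNReal.ofReal_mul (rdet_pos B).le, hB]
  · intro z hz
    exact ((((contDiffOn_trans he he').contDiffAt (isOpen_overlap.mem_nhds (hS hz))).differentiableAt
      (by simp)).hasFDerivAt.restrictScalars ℝ).hasFDerivWithinAt

/-- Identifies the supremum of measures inside one chart, which makes every later integral
computable in coordinates. -/
theorem vol_restrict_source [IsManifold 𝓘(ℂ, Cn n) ω M] (hΩ : ∀ x, IsPositive (Ω.val x))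
    (he : e ∈ atlas (Cn n) M) : (vol Ω).restrict e.source = chartVolume Ω e := by
  have hsm := e.open_source.measurableSet
  refine le_antisymm ?_ ?_
  -- Every chart measure is dominated by this sum: off the source of `e` it is at most the total
  -- volume, and on the overlap it agrees with the measure of `e`. Hence the supremum is dominated
  -- too.
  · have h : vol Ω ≤ (vol Ω).restrict e.sourceᶜ + chartVolume Ω e := by
      refine iSup₂_le fun e' he' => ?_
      rw [Measure.le_iff]
      intro s hs
      rw [← measure_inter_add_sdiff s hsm, add_comm, Measure.add_apply,
        Measure.restrict_apply hs]
      refine add_le_add ?_ ?_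
      · exact (le_iSup₂ (f := fun e (_ : e ∈ atlas (Cn n) M) => chartVolume Ω e) e' he') _
      · calc chartVolume Ω e' (s ∩ e.source)
            = chartVolume Ω e' (s ∩ e.source ∩ e'.source) := by
              refine measure_congr ?_
              filter_upwards [ae_mem_source (Ω := Ω) (e := e')] with y hy
              exact propext ⟨fun h => ⟨h, hy⟩, fun h => h.1⟩
          _ = chartVolume Ω e (s ∩ e.source ∩ e'.source) :=
            chartVolume_apply_eq hΩ he' he ((hs.inter hsm).inter e'.open_source.measurableSet)
              Set.inter_subset_right (fun y hy => hy.1.2)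
          _ ≤ chartVolume Ω e s := measure_mono fun y hy => hy.1.1
    have h' := Measure.restrict_mono (le_refl e.source) h
    rw [Measure.restrict_add, Measure.restrict_restrict hsm, Set.inter_compl_self,
      Measure.restrict_empty, zero_add, chartVolume_restrict_source] at h'
    exact h'
  · rw [← chartVolume_restrict_source]
    exact Measure.restrict_mono le_rfl
      (le_iSup₂ (f := fun e (_ : e ∈ atlas (Cn n) M) => chartVolume Ω e) e he)

theorem aestronglyMeasurable_vol [IsManifold 𝓘(ℂ, Cn n) ω M] [SecondCountableTopology M]
    (hΩ : ∀ x, IsPositive (Ω.val x)) {E : Type*} [TopologicalSpace E]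
    [TopologicalSpace.PseudoMetrizableSpace E] {g : M → E}
    (hg : ∀ e ∈ atlas (Cn n) M, AEStronglyMeasurable (g ∘ e.symm)
      ((volume : Measure (Cn n)).restrict e.target)) : AEStronglyMeasurable g (vol Ω) := by
  obtain ⟨s, hs, hcov⟩ := TopologicalSpace.countable_cover_nhds
    fun x : M => chart_source_mem_nhds (Cn n) x
  have : Countable s := hs.to_subtype
  have hcov' : ⋃ x : s, (chartAt (Cn n) (x : M)).source = Set.univ := by
    rw [← hcov, Set.iUnion_coe_set]
  rw [← Measure.restrict_univ (μ := vol Ω), ← hcov', aestronglyMeasurable_iUnion_iff]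
  intro x
  set e := chartAt (Cn n) (x : M)
  have he : e ∈ atlas (Cn n) M := chart_mem_atlas _ _
  rw [vol_restrict_source hΩ he]
  have h1 : AEStronglyMeasurable (g ∘ e.symm) ((chartVolume Ω e).map e) := by
    rw [map_chartVolume]
    exact (hg e he).mono_ac flatVolume_absolutelyContinuous
  refine (h1.comp_aemeasurable aemeasurable_chart).congr ?_
  filter_upwards [ae_mem_source] with y hy
  simp [e.left_inv hy]

theorem integral_vol_eq [IsManifold 𝓘(ℂ, Cn n) ω M] (hΩ : IsMetric Ω) (he : e ∈ atlas (Cn n) M)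
    {g : M → ℂ} (hg : AEStronglyMeasurable g (vol Ω)) (hg0 : ∀ y, y ∉ e.source → g y = 0) :
    ∫ y, g y ∂(vol Ω) =
      ∫ z in e.target, Real.sqrt (gram (inChart e Ω z)).det • g (e.symm z) := by
  rw [← setIntegral_eq_integral_of_forall_compl_eq_zero hg0, vol_restrict_source hΩ.pos he]
  have hg' : AEStronglyMeasurable g (chartVolume Ω e) := by
    rw [← vol_restrict_source hΩ.pos he]
    exact hg.restrict
  rw [chartVolume_eq] at hg' ⊢
  rw [integral_map aemeasurable_symm hg', flatVolume,
    integral_withDensity_eq_integral_toReal_smul₀ (hΩ.aemeasurable_volDensity he)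
      (Filter.Eventually.of_forall fun z => ENNReal.ofReal_lt_top)]
  refine integral_congr_ae (Filter.Eventually.of_forall fun z => ?_)
  simp only [volDensity]
  rw [ENNReal.toReal_ofReal (Real.sqrt_nonneg _)]

/-- Only an inequality is claimed, so that `h` may be an arbitrary function and no measurability of
a pointwise norm is required. -/
theorem lintegral_chart_le [IsManifold 𝓘(ℂ, Cn n) ω M] (hΩ : IsMetric Ω)
    (he : e ∈ atlas (Cn n) M) (h : M → ENNReal) :
    ∫⁻ z in e.target, volDensity Ω e z * h (e.symm z) ≤ ∫⁻ y, h y ∂(vol Ω) := by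
  calc ∫⁻ z in e.target, volDensity Ω e z * h (e.symm z)
      = ∫⁻ z, h (e.symm z) ∂(flatVolume Ω e) := by
        rw [flatVolume, lintegral_withDensity_eq_lintegral_mul_non_measurable₀ _
          (hΩ.aemeasurable_volDensity he)
          (Filter.Eventually.of_forall fun z => ENNReal.ofReal_lt_top)]
        rfl
    _ ≤ ∫⁻ y, h (e.symm (e y)) ∂(chartVolume Ω e) := by
      rw [← map_chartVolume]
      exact lintegral_map_le _ _
    _ = ∫⁻ y, h y ∂(chartVolume Ω e) := by
      refine lintegral_congr_ae ?_
      filter_upwards [ae_mem_source] with y hy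
      rw [e.left_inv hy]
    _ ≤ _ := lintegral_mono'
      (le_iSup₂ (f := fun e (_ : e ∈ atlas (Cn n) M) => chartVolume Ω e) e he) le_rfl

end Volume

/-! ### Real smooth functions on complex manifolds -/

section RealStructure

set_option maxSynthPendingDepth 3

variable {n : ℕ} {M N : Type*} [TopologicalSpace M] [ChartedSpace (Cn n) M]
  [TopologicalSpace N] [ChartedSpace (Cn n) N]

theorem isManifold_real [IsManifold 𝓘(ℂ, Cn n) ω M] : IsManifold 𝓘(ℝ, Cn n) ∞ M := by
  refine isManifold_of_contDiffOn 𝓘(ℝ, Cn n) ∞ M fun e e' he he' => ?_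
  have h := ((contDiffOn_trans he he').restrict_scalars ℝ).of_le (m := ∞) (by simp)
  refine h.mono fun z hz => ?_
  simpa [overlap] using hz

theorem hasMFDerivAt_restrictScalars {f : M → N} {x : M}
    {f' : TangentSpace 𝓘(ℂ, Cn n) x →L[ℂ] TangentSpace 𝓘(ℂ, Cn n) (f x)}
    (h : HasMFDerivAt 𝓘(ℂ, Cn n) 𝓘(ℂ, Cn n) f x f') :
    HasMFDerivAt 𝓘(ℝ, Cn n) 𝓘(ℝ, Cn n) f x (f'.restrictScalars ℝ) :=
  ⟨h.1, h.2.restrictScalars ℝ⟩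

theorem contMDiff_restrictScalars {f : M → N} (h : ContMDiff 𝓘(ℂ, Cn n) 𝓘(ℂ, Cn n) ω f) :
    ContMDiff 𝓘(ℝ, Cn n) 𝓘(ℝ, Cn n) ∞ f := by
  intro x
  have h1 := contMDiffAt_iff.mp (h x)
  refine contMDiffAt_iff.mpr ⟨h1.1, ?_⟩
  exact (h1.2.restrict_scalars ℝ).of_le (by simp)

/-- Smooth real functions. -/
abbrev IsSmoothFun (χ : M → ℝ) : Prop := ContMDiff 𝓘(ℝ, Cn n) 𝓘(ℝ, ℝ) ∞ χ

/-- The differential of a real function. -/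
def diff (χ : M → ℝ) (x : M) : Cn n →L[ℝ] ℝ := mfderiv 𝓘(ℝ, Cn n) 𝓘(ℝ, ℝ) χ x

variable [IsManifold 𝓘(ℂ, Cn n) ω M] {e : OpenPartialHomeomorph M (Cn n)} {χ : M → ℝ}

theorem contDiffOn_comp_symm (he : e ∈ atlas (Cn n) M) (hχ : IsSmoothFun (n := n) χ) :
    ContDiffOn ℝ ∞ (χ ∘ e.symm) e.target := by
  have := isManifold_real (n := n) (M := M)
  rw [← contMDiffOn_iff_contDiffOn]
  exact hχ.comp_contMDiffOn (contMDiffOn_symm_of_mem_maximalAtlas (I := 𝓘(ℝ, Cn n)) (n := ∞)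
    (IsManifold.subset_maximalAtlas he))

theorem diff_comp_chartD (he : e ∈ atlas (Cn n) M) (hχ : IsSmoothFun (n := n) χ) {z : Cn n}
    (hz : z ∈ e.target) : (diff (n := n) χ (e.symm z)).comp ((chartD e z).restrictScalars ℝ) =
      fderiv ℝ (χ ∘ e.symm) z := by
  have : IsManifold 𝓘(ℂ, Cn n) 1 M := IsManifold.of_le (n := ω) (by simp)
  have h1 := hasMFDerivAt_restrictScalars
    (mdifferentiableAt_atlas_symm (I := 𝓘(ℂ, Cn n)) he hz).hasMFDerivAt
  have h2 := ((hχ (e.symm z)).mdifferentiableAt (by simp)).hasMFDerivAt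
  have h3 := (h2.comp z h1).mfderiv
  rw [mfderiv_eq_fderiv] at h3
  exact h3.symm

omit [IsManifold 𝓘(ℂ, Cn n) ω M] in
theorem diff_comp {f : N → M} (hf : ContMDiff 𝓘(ℂ, Cn n) 𝓘(ℂ, Cn n) ω f)
    (hχ : IsSmoothFun (n := n) χ) (y : N) : diff (n := n) (χ ∘ f) y =
      (diff (n := n) χ (f y)).comp
        ((mfderiv 𝓘(ℂ, Cn n) 𝓘(ℂ, Cn n) f y).restrictScalars ℝ) := by
  have h1 := hasMFDerivAt_restrictScalars ((hf y).mdifferentiableAt (by simp)).hasMFDerivAt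
  have h2 := ((hχ (f y)).mdifferentiableAt (by simp)).hasMFDerivAt
  exact (h2.comp y h1).mfderiv

omit [IsManifold 𝓘(ℂ, Cn n) ω M] in
theorem diff_congr {χ' : M → ℝ} {x : M} (h : χ =ᶠ[nhds x] χ') :
    diff (n := n) χ x = diff (n := n) χ' x := h.mfderiv_eq

omit [IsManifold 𝓘(ℂ, Cn n) ω M] in
theorem diff_of_notMem_tsupport {x : M} (h : x ∉ tsupport χ) : diff (n := n) χ x = 0 := by
  have h1 : χ =ᶠ[nhds x] fun _ => (0 : ℝ) := notMem_tsupport_iff_eventuallyEq.mp h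
  rw [diff_congr h1]
  exact mfderiv_const

omit [IsManifold 𝓘(ℂ, Cn n) ω M] in
theorem diff_const (a : ℝ) (x : M) : diff (n := n) (fun _ => a) x = 0 := mfderiv_const

omit [IsManifold 𝓘(ℂ, Cn n) ω M] in
theorem diff_add {f g : M → ℝ} (hf : IsSmoothFun (n := n) f) (hg : IsSmoothFun (n := n) g) (x : M) :
    diff (n := n) (fun y => f y + g y) x = diff (n := n) f x + diff (n := n) g x :=
  (((hf x).mdifferentiableAt (by simp)).hasMFDerivAt.add
    ((hg x).mdifferentiableAt (by simp)).hasMFDerivAt).mfderiv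

omit [IsManifold 𝓘(ℂ, Cn n) ω M] in
theorem isSmoothFun_sum_and_diff_sum {ι : Type*} (s : Finset ι) {f : ι → M → ℝ}
    (hf : ∀ i ∈ s, IsSmoothFun (n := n) (f i)) (x : M) :
    IsSmoothFun (n := n) (fun y => ∑ i ∈ s, f i y) ∧
      diff (n := n) (fun y => ∑ i ∈ s, f i y) x = ∑ i ∈ s, diff (n := n) (f i) x := by
  classical
  induction s using Finset.induction_on with
  | empty =>
    simp only [Finset.sum_empty]
    exact ⟨contMDiff_const, diff_const 0 x⟩
  | insert i s hi ih =>
    obtain ⟨h1, h2⟩ := ih fun j hj => hf j (by simp [hj])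
    have h3 := hf i (by simp)
    simp only [Finset.sum_insert hi]
    exact ⟨h3.add h1, by rw [diff_add h3 h1, h2]⟩

/-! ### Bounded gradients -/

theorem norm_riem_sub_le (Ω Ω' : Alt n 2) (v : Cn n) :
    |riem Ω v v - riem Ω' v v| ≤ ‖Ω - Ω'‖ * ‖v‖ ^ 2 := by
  have : riem Ω v v - riem Ω' v v = ((Ω - Ω') ![v, Complex.I • v]).re := by
    simp [riem]
  rw [this]
  calc _ ≤ ‖(Ω - Ω') ![v, Complex.I • v]‖ := Complex.abs_re_le_norm _
    _ ≤ ‖Ω - Ω'‖ * ∏ i, ‖(![v, Complex.I • v] : Fin 2 → Cn n) i‖ :=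
      ContinuousAlternatingMap.le_opNorm _ _
    _ = _ := by
      rw [Fin.prod_univ_two]
      simp [norm_smul, sq]

/-- Positivity is stable: a lower bound for the metric at one point persists nearby with a worse
constant. -/
theorem IsPositive.eventually_norm_sq_le {Ω : Alt n 2} (hΩ : IsPositive Ω) :
    ∃ a : ℝ, 0 < a ∧ ∀ᶠ Ω' in nhds Ω, ∀ v, ‖v‖ ^ 2 ≤ a * riem Ω' v v := by
  obtain ⟨A, hA⟩ := hΩ.exists_isUnitary
  set a := ‖(A : Cn n →L[ℂ] Cn n)‖ ^ 2 + 1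
  have ha : 0 < a := by positivity
  have h1 : ∀ v, ‖v‖ ^ 2 ≤ a * riem Ω v v := by
    intro v
    have h := (A : Cn n →L[ℂ] Cn n).le_opNorm (A.symm v)
    simp only [ContinuousLinearEquiv.coe_coe, A.apply_symm_apply] at h
    have h' := hA.riem_self (A.symm v)
    rw [A.apply_symm_apply] at h'
    rw [h']
    calc ‖v‖ ^ 2 ≤ (‖(A : Cn n →L[ℂ] Cn n)‖ * ‖A.symm v‖) ^ 2 := by gcongr
      _ = ‖(A : Cn n →L[ℂ] Cn n)‖ ^ 2 * ‖A.symm v‖ ^ 2 := by ring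
      _ ≤ _ := by
        gcongr
        simp [a]
  -- A perturbation of size `1/(2a)` costs half of `‖v‖²`, which the doubled constant absorbs.
  refine ⟨2 * a, by positivity, ?_⟩
  filter_upwards [Metric.closedBall_mem_nhds Ω (ε := 1 / (2 * a)) (by positivity)] with Ω' hΩ' v
  rw [mem_closedBall_iff_norm] at hΩ'
  have h2 := norm_riem_sub_le Ω' Ω v
  have h3 : ‖Ω' - Ω‖ * ‖v‖ ^ 2 ≤ 1 / (2 * a) * ‖v‖ ^ 2 := by gcongr
  have h4 := (abs_le.mp (h2.trans h3)).1
  have h5 := h1 v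
  have h6 : a * riem Ω v v ≤ a * (riem Ω' v v + 1 / (2 * a) * ‖v‖ ^ 2) := by
    gcongr
    linarith
  have h7 : a * (1 / (2 * a) * ‖v‖ ^ 2) = ‖v‖ ^ 2 / 2 := by field_simp
  linarith [mul_add a (riem Ω' v v) (1 / (2 * a) * ‖v‖ ^ 2)]

/-- The existence of a bound passes to subsets and finite unions, and holds locally by continuity of
the derivative and the lower bound for the metric in a chart. Compactness does the rest. -/
theorem IsMetric.exists_diff_le {Ω : Form n M 2} (hΩ : IsMetric Ω)
    (hχ : IsSmoothFun (n := n) χ) {K : Set M} (hK : IsCompact K) :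
    ∃ C : ℝ, 0 ≤ C ∧ ∀ x ∈ K, ∀ v, |diff (n := n) χ x v| ≤ C * Real.sqrt (riem (Ω.val x) v v) := by
  refine hK.induction_on (p := fun K => ∃ C : ℝ, 0 ≤ C ∧ ∀ x ∈ K, ∀ v,
    |diff (n := n) χ x v| ≤ C * Real.sqrt (riem (Ω.val x) v v)) ⟨0, le_rfl, by simp⟩ ?_ ?_ ?_
  · rintro s t hst ⟨C, hC, h⟩
    exact ⟨C, hC, fun x hx => h x (hst hx)⟩
  · rintro s t ⟨C, hC, h⟩ ⟨C', hC', h'⟩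
    refine ⟨max C C', le_max_of_le_left hC, ?_⟩
    rintro x (hx | hx) v
    · exact (h x hx v).trans (by gcongr; exact le_max_left _ _)
    · exact (h' x hx v).trans (by gcongr; exact le_max_right _ _)
  · intro x _
    set e := chartAt (Cn n) x
    have he : e ∈ atlas (Cn n) M := chart_mem_atlas _ _
    have hx : x ∈ e.source := mem_chart_source _ x
    have hz : e x ∈ e.target := e.map_source hx
    have hpos : ∀ z ∈ e.target, IsPositive (inChart e Ω z) := fun z hz => by
      obtain ⟨B, hB⟩ := exists_chartD_eq he hz
      rw [inChart_eq, ← hB]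
      exact (hΩ.pos _).comp B
    obtain ⟨a, ha, hev⟩ := (hpos _ hz).eventually_norm_sq_le
    have hcΩ : ContinuousAt (inChart e Ω) (e x) :=
      (hΩ.continuousOn e he).continuousAt (e.open_target.mem_nhds hz)
    have hcχ : ContinuousAt (fun z => ‖fderiv ℝ (χ ∘ e.symm) z‖) (e x) :=
      (((contDiffOn_comp_symm he hχ).continuousOn_fderiv_of_isOpen e.open_target
        (by simp)).continuousAt (e.open_target.mem_nhds hz)).norm
    set c := ‖fderiv ℝ (χ ∘ e.symm) (e x)‖ + 1
    have hc0 : 0 ≤ c := by positivity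
    have hev' : ∀ᶠ z in nhds (e x), ‖fderiv ℝ (χ ∘ e.symm) z‖ < c :=
      hcχ.eventually_lt_const (by simp [c])
    have hall := (hcΩ.eventually hev).and (hev'.and (e.open_target.mem_nhds hz))
    have hall' := (e.continuousAt hx).eventually hall
    refine ⟨_, mem_nhdsWithin_of_mem_nhds (Filter.inter_mem hall' (e.open_source.mem_nhds hx)),
      c * Real.sqrt a, by positivity, ?_⟩
    rintro y ⟨⟨h1, h2, h3⟩, h4⟩ v
    obtain ⟨B, hB⟩ := exists_chartD_eq he h3
    have hd := diff_comp_chartD he hχ h3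
    have hr := riem_comp (Ω.val (e.symm (e y))) (chartD e (e y)) (B.symm v) (B.symm v)
    rw [← inChart_eq] at hr
    rw [e.left_inv h4] at hd hr
    rw [← hB] at hd hr
    simp only [ContinuousLinearEquiv.coe_coe, B.apply_symm_apply] at hr
    have hdv := congrArg (fun T => T (B.symm v)) hd
    have hdv' : diff (n := n) χ y v = fderiv ℝ (χ ∘ e.symm) (e y) (B.symm v) := by
      rw [← hdv]
      simp
    rw [hdv', ← hr, ← Real.norm_eq_abs]
    have h5 := h1 (B.symm v)
    calc _ ≤ ‖fderiv ℝ (χ ∘ e.symm) (e y)‖ * ‖B.symm v‖ := ContinuousLinearMap.le_opNorm _ _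
      _ ≤ c * Real.sqrt (a * riem (inChart e Ω (e y)) (B.symm v) (B.symm v)) := by
        gcongr
        exact Real.le_sqrt_of_sq_le h5
      _ = _ := by rw [Real.sqrt_mul ha.le, mul_assoc]

end RealStructure

/-! ### Integration by parts on a complex manifold -/

theorem integrable_smul_of_bounded {X : Type*} [TopologicalSpace X] [MeasurableSpace X]
    [OpensMeasurableSpace X] {μ : Measure X} {F : X → ℂ} (hF : Integrable F μ) {g : X → ℝ}
    (hg : Continuous g) {C : ℝ} (hC : ∀ x, ‖g x‖ ≤ C) : Integrable (fun x => g x • F x) μ := by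
  refine (hF.norm.const_mul C).mono'
    (hg.measurable.aestronglyMeasurable.smul hF.1) (Filter.Eventually.of_forall fun x => ?_)
  rw [norm_smul]
  exact mul_le_mul_of_nonneg_right (hC x) (norm_nonneg _)

section GlobalParts

set_option maxSynthPendingDepth 3

variable {n k : ℕ} {M : Type*} [TopologicalSpace M] [ChartedSpace (Cn n) M]
  [MeasurableSpace M]
  {Ω : Form n M 2} {φ : Form n M k} {α β : Form n M 1} {e : OpenPartialHomeomorph M (Cn n)}
  {χ : M → ℝ}

/-- The form `∂χ ∧ α + ∂̄χ ∧ β`. -/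
def gradWedge (α β : Form n M 1) (χ : M → ℝ) : Form n M 2 := fun x =>
  dolbWedge Complex.I (diff (n := n) χ x) (α.val x) +
    dolbWedge (-Complex.I) (diff (n := n) χ x) (β.val x)

/-- The density of `φ ∧ conj φ ∧ w` with respect to the volume form of `Ω`. -/
def formDensity (Ω w : Form n M 2) (φ : Form n M k) (x : M) : ℂ :=
  density (Ω.val x) (w.val x) (φ.val x)

omit [MeasurableSpace M] in
theorem gradWedge_val (x : M) : (gradWedge α β χ).val x =
    dolbWedge Complex.I (diff (n := n) χ x) (α.val x) +
      dolbWedge (-Complex.I) (diff (n := n) χ x) (β.val x) := rfl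

omit [MeasurableSpace M] in
theorem gradWedge_of_notMem_tsupport {x : M} (hx : x ∉ tsupport χ) :
    (gradWedge α β χ).val x = 0 := by
  rw [gradWedge_val, diff_of_notMem_tsupport hx, map_zero, map_zero, LinearMap.zero_apply,
    LinearMap.zero_apply, add_zero]

variable [IsManifold 𝓘(ℂ, Cn n) ω M]

omit [MeasurableSpace M] in
theorem IsMetric.inChart_pos (hΩ : IsMetric Ω) (he : e ∈ atlas (Cn n) M) {z : Cn n}
    (hz : z ∈ e.target) : IsPositive (inChart e Ω z) := by
  obtain ⟨B, hB⟩ := exists_chartD_eq he hz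
  rw [inChart_eq, ← hB]
  exact (hΩ.pos _).comp B

omit [MeasurableSpace M] in
theorem sqrt_smul_formDensity (hΩ : IsMetric Ω) (he : e ∈ atlas (Cn n) M) {z : Cn n}
    (hz : z ∈ e.target) (w : Form n M 2) (φ : Form n M k) :
    Real.sqrt (gram (inChart e Ω z)).det • formDensity Ω w φ (e.symm z) =
      pairing n k (inChart e w z) (inChart e φ z) (inChart e φ z) := by
  have hpos := sqrt_det_gram_pos (hΩ.inChart_pos he hz)
  obtain ⟨B, hB⟩ := exists_chartD_eq he hz
  rw [formDensity, ← density_comp (hΩ.pos _) B, density, hB, ← inChart_eq, ← inChart_eq,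
    ← inChart_eq, Complex.real_smul, mul_div_cancel₀]
  exact_mod_cast hpos.ne'

omit [MeasurableSpace M] in
theorem formDensity_symm (hΩ : IsMetric Ω) (he : e ∈ atlas (Cn n) M) {z : Cn n}
    (hz : z ∈ e.target) (w : Form n M 2) (φ : Form n M k) :
    formDensity Ω w φ (e.symm z) = (Real.sqrt (gram (inChart e Ω z)).det)⁻¹ •
      pairing n k (inChart e w z) (inChart e φ z) (inChart e φ z) := by
  rw [← sqrt_smul_formDensity hΩ he hz, smul_smul,
    inv_mul_cancel₀ (sqrt_det_gram_pos (hΩ.inChart_pos he hz)).ne', one_smul]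

omit [MeasurableSpace M] in
theorem inChart_gradWedge (he : e ∈ atlas (Cn n) M) (hχ : IsSmoothFun (n := n) χ) {z : Cn n}
    (hz : z ∈ e.target) : inChart e (gradWedge α β χ) z =
      dolbWedge Complex.I (fderiv ℝ (χ ∘ e.symm) z) (inChart e α z) +
        dolbWedge (-Complex.I) (fderiv ℝ (χ ∘ e.symm) z) (inChart e β z) := by
  rw [← diff_comp_chartD he hχ hz, inChart_eq e α, inChart_eq e β, ← dolbWedge_comp,
    ← dolbWedge_comp]
  rfl

omit [MeasurableSpace M] in
theorem continuousOn_inChart_gradWedge (he : e ∈ atlas (Cn n) M) (hα : IsSmooth α)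
    (hβ : IsSmooth β) (hχ : IsSmoothFun (n := n) χ) :
    ContinuousOn (inChart e (gradWedge α β χ)) e.target := by
  have hd := (contDiffOn_comp_symm he hχ).continuousOn_fderiv_of_isOpen e.open_target (by simp)
  have h : ∀ (c : ℂ) (γ : Form n M 1), IsSmooth γ → ContinuousOn
      (fun z => dolbWedge c (fderiv ℝ (χ ∘ e.symm) z) (inChart e γ z)) e.target := by
    intro c γ hγ
    let D : (Cn n →L[ℝ] ℝ) →L[ℝ] Alt n 1 →L[ℝ] Alt n 2 := toCLM₂ (dolbWedge c)
    exact (D.continuous.comp_continuousOn hd).clm_apply (hγ e he).continuousOn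
  exact ((h _ α hα).add (h _ β hβ)).congr fun z hz => inChart_gradWedge he hχ hz

variable [BorelSpace M]

theorem aestronglyMeasurable_formDensity [SecondCountableTopology M] (hΩ : IsMetric Ω)
    (hφ : ∀ e ∈ atlas (Cn n) M,
      AEStronglyMeasurable (inChart e φ) ((volume : Measure (Cn n)).restrict e.target))
    {w : Form n M 2} (hw : ∀ e ∈ atlas (Cn n) M, ContinuousOn (inChart e w) e.target) :
    AEStronglyMeasurable (formDensity Ω w φ) (vol Ω) := by
  refine aestronglyMeasurable_vol hΩ.pos fun e he => ?_
  have hm := e.open_target.measurableSet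
  have h1 : AEStronglyMeasurable (fun z => pairing n k (inChart e w z))
      ((volume : Measure (Cn n)).restrict e.target) :=
    ((pairing n k).continuous.comp_continuousOn (hw e he)).aestronglyMeasurable hm
  have h2 := aestronglyMeasurable_clm_apply (aestronglyMeasurable_clm_apply h1 (hφ e he)) (hφ e he)
  have h3 : ContinuousOn (fun z => (Real.sqrt (gram (inChart e Ω z)).det)⁻¹) e.target :=
    (continuous_sqrt_det_gram.comp_continuousOn (hΩ.continuousOn e he)).inv₀ fun z hz =>
      (sqrt_det_gram_pos (hΩ.inChart_pos he hz)).ne'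
  refine ((h3.aestronglyMeasurable hm).smul h2).congr ?_
  filter_upwards [ae_restrict_mem hm] with z hz
  exact (formDensity_symm hΩ he hz w φ).symm

theorem integrable_formDensity [SecondCountableTopology M] (hΩ : IsMetric Ω) (hφ : IsL2 Ω φ)
    {w : Form n M 2} (hw : ∀ e ∈ atlas (Cn n) M, ContinuousOn (inChart e w) e.target) {C : ℝ}
    (hC : ∀ x, ‖formDensity Ω w φ x‖ ≤ C * normSq (Ω.val x) (φ.val x)) :
    Integrable (formDensity Ω w φ) (vol Ω) := by
  refine ⟨aestronglyMeasurable_formDensity hΩ hφ.measurable hw, ?_⟩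
  rw [hasFiniteIntegral_iff_norm]
  calc ∫⁻ x, ENNReal.ofReal ‖formDensity Ω w φ x‖ ∂(vol Ω)
      ≤ ∫⁻ x, ENNReal.ofReal |C| * ENNReal.ofReal (normSq (Ω.val x) (φ.val x)) ∂(vol Ω) := by
        refine lintegral_mono fun x => ?_
        rw [← ENNReal.ofReal_mul (abs_nonneg C)]
        refine ENNReal.ofReal_le_ofReal ((hC x).trans ?_)
        have := normSq_nonneg (hΩ.pos x) (φ.val x)
        gcongr
        exact le_abs_self C
    _ = ENNReal.ofReal |C| * ∫⁻ x, ENNReal.ofReal (normSq (Ω.val x) (φ.val x)) ∂(vol Ω) :=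
      lintegral_const_mul' _ _ ENNReal.ofReal_ne_top
    _ < ⊤ := ENNReal.mul_lt_top ENNReal.ofReal_lt_top hφ.finite

theorem integrable_formDensity_self [SecondCountableTopology M] (hΩ : IsMetric Ω)
    (hφ : IsL2 Ω φ) : Integrable (formDensity Ω Ω φ) (vol Ω) := by
  obtain ⟨C, -, h⟩ := exists_norm_density_self_le n k
  exact integrable_formDensity hΩ hφ hΩ.continuousOn fun x => h _ (hΩ.pos x) _

theorem integrable_formDensity_gradWedge [SecondCountableTopology M] (hΩ : IsMetric Ω)
    (hφ : IsL2 Ω φ) (hα : IsSmooth α) (hβ : IsSmooth β) (hαb : IsBounded Ω α) (hβb : IsBounded Ω β)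
    (hχ : IsSmoothFun (n := n) χ)
    (hd : ∃ a : ℝ, 0 ≤ a ∧ ∀ x v, |diff (n := n) χ x v| ≤ a * Real.sqrt (riem (Ω.val x) v v)) :
    Integrable (formDensity Ω (gradWedge α β χ) φ) (vol Ω) := by
  obtain ⟨a, ha, hd⟩ := hd
  obtain ⟨A, hA⟩ := hαb
  obtain ⟨B, hB⟩ := hβb
  obtain ⟨C, hC, h⟩ := exists_norm_density_dolbWedge_le n k Complex.I
  obtain ⟨C', hC', h'⟩ := exists_norm_density_dolbWedge_le n k (-Complex.I)
  refine integrable_formDensity hΩ hφ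
    (fun e he => continuousOn_inChart_gradWedge he hα hβ hχ)
    (C := C * a * Real.sqrt A + C' * a * Real.sqrt B) fun x => ?_
  have h1 := h (Ω.val x) (hΩ.pos x) _ a ha (hd x) (α.val x) (φ.val x)
  have h2 := h' (Ω.val x) (hΩ.pos x) _ a ha (hd x) (β.val x) (φ.val x)
  have h3 := normSq_nonneg (hΩ.pos x) (φ.val x)
  have e1 : Real.sqrt (normSq (Ω.val x) (α.val x)) ≤ Real.sqrt A := Real.sqrt_le_sqrt (hA x)
  have e2 : Real.sqrt (normSq (Ω.val x) (β.val x)) ≤ Real.sqrt B := Real.sqrt_le_sqrt (hB x)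
  have h4 : formDensity Ω (gradWedge α β χ) φ x =
      density (Ω.val x) (dolbWedge Complex.I (diff (n := n) χ x) (α.val x)) (φ.val x) +
      density (Ω.val x) (dolbWedge (-Complex.I) (diff (n := n) χ x) (β.val x)) (φ.val x) :=
    density_add _ _ _ _
  rw [h4, add_mul]
  refine (norm_add_le _ _).trans (add_le_add (h1.trans ?_) (h2.trans ?_))
  · gcongr
  · gcongr

/-- On a compact part of a chart the metric is bounded and its volume density is bounded below, so
global `L²` integrability implies Euclidean `L²` integrability there. -/
theorem memLp_inChart (hΩ : IsMetric Ω) (hφ : IsL2 Ω φ) (he : e ∈ atlas (Cn n) M) {K : Set (Cn n)}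
    (hKe : K ⊆ e.target) (hK : IsCompact K) :
    MemLp (inChart e φ) 2 ((volume : Measure (Cn n)).restrict K) := by
  have hm : AEStronglyMeasurable (inChart e φ) ((volume : Measure (Cn n)).restrict K) :=
    (hφ.measurable e he).mono_measure (Measure.restrict_mono hKe le_rfl)
  rw [memLp_two_iff_integrable_sq_norm hm]
  refine ⟨hm.norm.pow 2, ?_⟩
  rw [hasFiniteIntegral_iff_ofReal (Filter.Eventually.of_forall fun z => by positivity)]
  obtain ⟨C, hC, h⟩ := exists_norm_sq_le_normSq n k
  obtain ⟨b, hb⟩ := hK.exists_bound_of_continuousOn ((hΩ.continuousOn e he).mono hKe)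
  have hinv : ContinuousOn (fun z => (Real.sqrt (gram (inChart e Ω z)).det)⁻¹) K :=
    ((continuous_sqrt_det_gram.comp_continuousOn (hΩ.continuousOn e he)).inv₀ fun z hz =>
      (sqrt_det_gram_pos (hΩ.inChart_pos he hz)).ne').mono hKe
  obtain ⟨d, hd⟩ := hK.exists_bound_of_continuousOn hinv
  have hKm := hK.measurableSet
  calc ∫⁻ z in K, ENNReal.ofReal (‖inChart e φ z‖ ^ 2)
      ≤ ∫⁻ z in K, ENNReal.ofReal (C * |b| ^ k * |d|) * (volDensity Ω e z *
          ENNReal.ofReal (normSq (Ω.val (e.symm z)) (φ.val (e.symm z)))) := by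
        refine setLIntegral_mono' hKm fun z hz => ?_
        have hpos := hΩ.inChart_pos he (hKe hz)
        obtain ⟨B, hB⟩ := exists_chartD_eq he (hKe hz)
        have hN : normSq (inChart e Ω z) (inChart e φ z) =
            normSq (Ω.val (e.symm z)) (φ.val (e.symm z)) := by
          rw [inChart_eq, inChart_eq, ← hB]
          exact normSq_comp (hΩ.pos _) B _
        have hs := sqrt_det_gram_pos hpos
        rw [volDensity, ← ENNReal.ofReal_mul hs.le, ← ENNReal.ofReal_mul (by positivity), ← hN]
        refine ENNReal.ofReal_le_ofReal ((h _ hpos _).trans ?_)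
        have hn := normSq_nonneg hpos (inChart e φ z)
        have hd' : 1 ≤ |d| * Real.sqrt (gram (inChart e Ω z)).det := by
          have := (hd z hz).trans (le_abs_self d)
          rw [norm_inv, Real.norm_of_nonneg hs.le, inv_le_iff_one_le_mul₀ hs] at this
          exact this
        have hb' : ‖inChart e Ω z‖ ≤ |b| := (hb z hz).trans (le_abs_self b)
        calc C * ‖inChart e Ω z‖ ^ k * normSq (inChart e Ω z) (inChart e φ z)
            ≤ C * |b| ^ k * normSq (inChart e Ω z) (inChart e φ z) * 1 := by
              rw [mul_one]
              gcongr
          _ ≤ C * |b| ^ k * normSq (inChart e Ω z) (inChart e φ z) *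
              (|d| * Real.sqrt (gram (inChart e Ω z)).det) := by gcongr
          _ = _ := by ring
    _ = ENNReal.ofReal (C * |b| ^ k * |d|) * ∫⁻ z in K, (volDensity Ω e z *
          ENNReal.ofReal (normSq (Ω.val (e.symm z)) (φ.val (e.symm z)))) :=
      lintegral_const_mul' _ _ ENNReal.ofReal_ne_top
    _ < ⊤ := by
      refine ENNReal.mul_lt_top ENNReal.ofReal_lt_top ?_
      refine lt_of_le_of_lt (lintegral_mono_set hKe) ?_
      exact lt_of_le_of_lt (lintegral_chart_le hΩ he
        fun x => ENNReal.ofReal (normSq (Ω.val x) (φ.val x))) hφ.finite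

omit [MeasurableSpace M] [IsManifold 𝓘(ℂ, Cn n) ω M] [BorelSpace M] in
theorem weaklyClosed_inChart (h : WeakDelZero φ) (h' : WeakDelbarZero φ)
    (he : e ∈ atlas (Cn n) M) : WeaklyClosed e.target (inChart e φ) := by
  intro c hc χ hχ hχc hχe
  rw [← setIntegral_eq_integral_of_tsupport hχe (fun ξ z => dolbWedge c ξ (inChart e φ z))
    (fun z => by simp)]
  rcases hc with rfl | rfl
  · simpa only [delWedge_eq] using h e he χ hχ hχc hχe
  · simpa only [delbarWedge_eq] using h' e he χ hχ hχc hχe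

/-- `Ω = ∂α + ∂̄β`. -/
def IsPotential (Ω : Form n M 2) (α β : Form n M 1) : Prop :=
  IsSmooth α ∧ IsSmooth β ∧ ∀ x, Ω x = del α x + delbar β x

omit [MeasurableSpace M] [BorelSpace M] in
theorem IsPotential.inChart_eq (h : IsPotential Ω α β) (he : e ∈ atlas (Cn n) M) {z : Cn n}
    (hz : z ∈ e.target) : inChart e Ω z = dolb Complex.I (fderiv ℝ (inChart e α) z) +
      dolb (-Complex.I) (fderiv ℝ (inChart e β) z) := by
  rw [← inChart_dolbForm he _ h.1 hz, ← inChart_dolbForm he _ h.2.1 hz]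
  have h1 : Ω.val (e.symm z) =
      (dolbForm Complex.I α).val (e.symm z) + (dolbForm (-Complex.I) β).val (e.symm z) := by
    rw [← del_eq, ← delbar_eq]
    exact h.2.2 _
  rw [SKT.inChart_eq, h1]
  rfl

omit [MeasurableSpace M] [BorelSpace M] in
theorem IsPotential.continuousOn (h : IsPotential Ω α β) (he : e ∈ atlas (Cn n) M) :
    ContinuousOn (inChart e Ω) e.target := by
  have hd : ∀ (c : ℂ) (γ : Form n M 1), IsSmooth γ →
      ContinuousOn (fun z => dolb c (fderiv ℝ (inChart e γ) z)) e.target := by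
    intro c γ hγ
    let D : (Cn n →L[ℝ] Alt n 1) →L[ℝ] Alt n 2 := LinearMap.toContinuousLinearMap (dolb c)
    exact D.continuous.comp_continuousOn
      ((hγ e he).continuousOn_fderiv_of_isOpen e.open_target (by simp))
  exact ((hd _ α h.1).add (hd _ β h.2.1)).congr fun z hz => h.inChart_eq he hz

/-- In one chart the volume density cancels the denominator of `formDensity`, and the claim becomes
the Euclidean integration by parts, used with `∂` for `α` and `∂̄` for `β`. -/
theorem integral_smul_formDensity_of_tsupport_subset [T2Space M] [SecondCountableTopology M]
    (hΩ : IsMetric Ω) (hφ : IsL2 Ω φ) (hp : IsPotential Ω α β) (hdel : WeakDelZero φ)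
    (hdelbar : WeakDelbarZero φ) (he : e ∈ atlas (Cn n) M) (hχ : IsSmoothFun (n := n) χ)
    (hχc : HasCompactSupport χ) (hχe : tsupport χ ⊆ e.source) :
    ∫ x, χ x • formDensity Ω Ω φ x ∂(vol Ω) =
      -∫ x, formDensity Ω (gradWedge α β χ) φ x ∂(vol Ω) := by
  -- Outside the target the values of the inverse chart carry no meaning, so the cut-off is replaced
  -- by zero there.
  set u : Cn n → ℝ := e.target.indicator (χ ∘ e.symm) with hu
  have hK : IsCompact (e '' tsupport χ) := hχc.isCompact.image_of_continuousOn
    (e.continuousOn.mono hχe)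
  have hKe : e '' tsupport χ ⊆ e.target := by
    rintro _ ⟨x, hx, rfl⟩
    exact e.map_source (hχe hx)
  have hu0 : ∀ z, z ∉ e '' tsupport χ → u z = 0 := by
    intro z hz
    by_cases hze : z ∈ e.target
    · rw [hu, Set.indicator_of_mem hze]
      change χ (e.symm z) = 0
      exact image_eq_zero_of_notMem_tsupport fun h => hz ⟨_, h, e.right_inv hze⟩
    · rw [hu, Set.indicator_of_notMem hze]
  have hut : tsupport u ⊆ e '' tsupport χ :=
    closure_minimal (fun z hz => by_contra fun h => hz (hu0 z h)) hK.isClosed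
  have huc : HasCompactSupport u := HasCompactSupport.of_support_subset_isCompact hK
    ((subset_tsupport _).trans hut)
  have hueq : ∀ z ∈ e.target, u =ᶠ[nhds z] χ ∘ e.symm := fun z hz => by
    filter_upwards [e.open_target.mem_nhds hz] with y hy
    exact Set.indicator_of_mem hy _
  have hus : ContDiff ℝ ∞ u := by
    rw [contDiff_iff_contDiffAt]
    intro z
    by_cases hz : z ∈ e.target
    · exact ((contDiffOn_comp_symm he hχ).contDiffAt
        (e.open_target.mem_nhds hz)).congr_of_eventuallyEq (hueq z hz)
    · refine (contDiffAt_const (c := (0 : ℝ))).congr_of_eventuallyEq ?_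
      filter_upwards [hK.isClosed.isOpen_compl.mem_nhds fun h => hz (hKe h)] with y hy
      exact hu0 y hy
  have hL2 : ∀ K ⊆ e.target, IsCompact K → MemLp (inChart e φ) 2 (volume.restrict K) :=
    fun K hKe hK => memLp_inChart hΩ hφ he hKe hK
  have hwc := weaklyClosed_inChart hdel hdelbar he
  obtain ⟨i1, i2, h12⟩ := integral_smul_pairing_dolb e.open_target hL2 hwc (Or.inl rfl)
    (hp.1 e he) hus huc (hut.trans hKe)
  obtain ⟨i3, i4, h34⟩ := integral_smul_pairing_dolb e.open_target hL2 hwc (Or.inr rfl)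
    (hp.2.1 e he) hus huc (hut.trans hKe)
  have hm1 : AEStronglyMeasurable (fun x => χ x • formDensity Ω Ω φ x) (vol Ω) :=
    hχ.continuous.aestronglyMeasurable.smul
      (aestronglyMeasurable_formDensity hΩ hφ.measurable hΩ.continuousOn)
  have hm2 : AEStronglyMeasurable (formDensity Ω (gradWedge α β χ) φ) (vol Ω) :=
    aestronglyMeasurable_formDensity hΩ hφ.measurable
      fun e he => continuousOn_inChart_gradWedge he hp.1 hp.2.1 hχ
  rw [integral_vol_eq hΩ he hm1 ?_, integral_vol_eq hΩ he hm2 ?_]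
  · have hA : ∫ z in e.target, Real.sqrt (gram (inChart e Ω z)).det •
        (χ (e.symm z) • formDensity Ω Ω φ (e.symm z)) =
        ∫ z, (pairing n k (u z • dolb Complex.I (fderiv ℝ (inChart e α) z)) (inChart e φ z)
          (inChart e φ z) + pairing n k (u z • dolb (-Complex.I) (fderiv ℝ (inChart e β) z))
          (inChart e φ z) (inChart e φ z)) := by
      refine Eq.trans ?_ (setIntegral_eq_integral_of_forall_compl_eq_zero (s := e.target) ?_)
      · refine setIntegral_congr_fun e.open_target.measurableSet fun z hz => ?_
        rw [smul_comm, sqrt_smul_formDensity hΩ he hz, hp.inChart_eq he hz,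
          show u z = χ (e.symm z) from Set.indicator_of_mem hz _]
        simp only [map_add, map_smul, add_apply, smul_apply, smul_add]
      · intro z hz
        simp [show u z = 0 from Set.indicator_of_notMem hz _]
    have hB : ∫ z in e.target, Real.sqrt (gram (inChart e Ω z)).det •
        formDensity Ω (gradWedge α β χ) φ (e.symm z) =
        ∫ z, (pairing n k (dolbWedge Complex.I (fderiv ℝ u z) (inChart e α z)) (inChart e φ z)
          (inChart e φ z) + pairing n k (dolbWedge (-Complex.I) (fderiv ℝ u z) (inChart e β z))
          (inChart e φ z) (inChart e φ z)) := by
      refine Eq.trans ?_ (setIntegral_eq_integral_of_forall_compl_eq_zero (s := e.target) ?_)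
      · refine setIntegral_congr_fun e.open_target.measurableSet fun z hz => ?_
        rw [sqrt_smul_formDensity hΩ he hz, inChart_gradWedge he hχ hz, (hueq z hz).fderiv_eq]
        simp only [map_add, add_apply]
      · intro z hz
        have : fderiv ℝ u z = 0 := image_eq_zero_of_notMem_tsupport fun h =>
          hz (hKe (hut (tsupport_fderiv_subset ℝ h)))
        simp [this]
    rw [hA, hB, integral_add i1 i3, integral_add i2 i4, h12, h34]
    ring
  · intro x hx
    have h0 : (gradWedge α β χ).val x = 0 := gradWedge_of_notMem_tsupport fun h => hx (hχe h)
    simp [formDensity, h0, density]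
  · intro x hx
    simp [image_eq_zero_of_notMem_tsupport fun h => hx (hχe h)]

/-- A partition of unity subordinate to chart domains splits `χ` into finitely many pieces, and both
sides are additive in `χ`. -/
theorem integral_smul_formDensity_of_hasCompactSupport [T2Space M] [SecondCountableTopology M]
    (hΩ : IsMetric Ω) (hφ : IsL2 Ω φ) (hp : IsPotential Ω α β) (hαb : IsBounded Ω α)
    (hβb : IsBounded Ω β) (hdel : WeakDelZero φ)
    (hdelbar : WeakDelbarZero φ) (hχ : IsSmoothFun (n := n) χ) (hχc : HasCompactSupport χ) :
    ∫ x, χ x • formDensity Ω Ω φ x ∂(vol Ω) =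
      -∫ x, formDensity Ω (gradWedge α β χ) φ x ∂(vol Ω) := by
  have := isManifold_real (n := n) (M := M)
  have : LocallyCompactSpace M := ChartedSpace.locallyCompactSpace (Cn n) M
  obtain ⟨ρ, hρ⟩ := SmoothPartitionOfUnity.exists_isSubordinate 𝓘(ℝ, Cn n) (s := Set.univ)
    isClosed_univ (fun x : M => (chartAt (Cn n) x).source)
    (fun x => (chartAt (Cn n) x).open_source)
    (fun x _ => Set.mem_iUnion.mpr ⟨x, mem_chart_source _ x⟩)
  have hfin := ρ.locallyFinite.finite_nonempty_inter_compact hχc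
  set J := hfin.toFinset
  set f : M → M → ℝ := fun i x => ρ i x * χ x
  have hf : ∀ i, IsSmoothFun (n := n) (f i) := fun i => (ρ i).contMDiff.mul hχ
  have hfχ : ∀ i, tsupport (f i) ⊆ tsupport χ := fun i => tsupport_mul_subset_right
  have hfe : ∀ i, tsupport (f i) ⊆ (chartAt (Cn n) i).source := fun i =>
    tsupport_mul_subset_left.trans (hρ i)
  have hfc : ∀ i, HasCompactSupport (f i) := fun i =>
    HasCompactSupport.of_support_subset_isCompact hχc ((subset_tsupport _).trans (hfχ i))
  have hsum : χ = fun x => ∑ i ∈ J, f i x := by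
    funext x
    by_cases hx : x ∈ tsupport χ
    · have h1 := ρ.sum_eq_one (Set.mem_univ x)
      rw [finsum_eq_sum_of_support_subset (s := J)] at h1
      · rw [← Finset.sum_mul, h1, one_mul]
      · intro i hi
        simp only [J, Set.Finite.coe_toFinset, Set.mem_ofPred_eq]
        exact ⟨x, hi, hx⟩
    · have h0 := image_eq_zero_of_notMem_tsupport hx
      simp [f, h0]
  have hd : ∀ i, ∃ a : ℝ, 0 ≤ a ∧ ∀ x v,
      |diff (n := n) (f i) x v| ≤ a * Real.sqrt (riem (Ω.val x) v v) := by
    intro i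
    obtain ⟨a, ha, h⟩ := hΩ.exists_diff_le (hf i) (hfc i)
    refine ⟨a, ha, fun x v => ?_⟩
    by_cases hx : x ∈ tsupport (f i)
    · exact h x hx v
    · rw [diff_of_notMem_tsupport hx]
      simp only [zero_apply, abs_zero]
      positivity
  have hint : ∀ i, Integrable (formDensity Ω (gradWedge α β (f i)) φ) (vol Ω) := fun i =>
    integrable_formDensity_gradWedge hΩ hφ hp.1 hp.2.1 hαb hβb (hf i) (hd i)
  have hF := integrable_formDensity_self hΩ hφ
  have hint' : ∀ i, Integrable (fun x => f i x • formDensity Ω Ω φ x) (vol Ω) := by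
    intro i
    obtain ⟨C, hC⟩ := (hfc i).exists_bound_of_continuous (hf i).continuous
    exact integrable_smul_of_bounded hF (hf i).continuous hC
  have e1 : ∀ x, χ x • formDensity Ω Ω φ x = ∑ i ∈ J, f i x • formDensity Ω Ω φ x := fun x => by
    have h0 : χ x = ∑ i ∈ J, f i x := congrFun hsum x
    have h1 := Finset.sum_smul (s := J) (f := fun i => f i x) (x := formDensity Ω Ω φ x)
    rw [← h1]
    exact congrArg (fun r : ℝ => r • formDensity Ω Ω φ x) h0
  have e2 : ∀ x, formDensity Ω (gradWedge α β χ) φ x =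
      ∑ i ∈ J, formDensity Ω (gradWedge α β (f i)) φ x := by
    intro x
    have h1 := (congrArg (fun g => diff (n := n) g x) hsum).trans
      (isSmoothFun_sum_and_diff_sum (n := n) J (fun i _ => hf i) x).2
    have h2 : (gradWedge α β χ).val x = ∑ i ∈ J, (gradWedge α β (f i)).val x := by
      simp only [gradWedge_val, h1, map_sum, LinearMap.sum_apply, Finset.sum_add_distrib]
    simp only [formDensity, density, h2, map_sum, sum_apply, Finset.sum_div]
  simp_rw [e1, e2]
  rw [integral_finsetSum _ fun i _ => hint' i, integral_finsetSum _ fun i _ => hint i,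
    ← Finset.sum_neg_distrib]
  exact Finset.sum_congr rfl fun i _ => integral_smul_formDensity_of_tsupport_subset hΩ hφ hp hdel
    hdelbar (chart_mem_atlas _ i) (hf i) (hfc i) (hfe i)

end GlobalParts

/-- A point outside the image has an empty fibre, and then so do all points of an evenly covered
neighbourhood. Closedness is what a partition of unity on the image needs. -/
theorem isClosed_range_of_isCoveringMap {X Y : Type*} [TopologicalSpace X] [TopologicalSpace Y]
    {π : Y → X} (hπ : IsCoveringMap π) : IsClosed (Set.range π) := by
  refine isOpen_compl_iff.mp (isOpen_iff_mem_nhds.mpr fun x hx => ?_)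
  obtain ⟨_, U, hxU, hU, _, H, _⟩ := hπ x
  filter_upwards [hU.mem_nhds hxU]
  rintro _ hz ⟨y, rfl⟩
  exact hx ⟨_, (H ⟨y, hz⟩).2.2⟩

/-! ### Cutting off along the sheets of a covering -/

section Covering

set_option maxSynthPendingDepth 3

variable {n k : ℕ} {X Y : Type*} [TopologicalSpace X] [ChartedSpace (Cn n) X]
  [TopologicalSpace Y] [ChartedSpace (Cn n) Y] {π : Y → X} {Ω : Form n X 2}

theorem IsHermitianMetric.isMetric (hΩ : IsHermitianMetric Ω) : IsMetric Ω where
  pos x := ⟨hΩ.real x, hΩ.bidegree x, hΩ.pos x⟩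
  continuousOn e he := (hΩ.smooth e he).continuousOn

theorem pullback_val (φ : Form n X k) (y : Y) : (pullback π φ).val y =
    (φ.val (π y)).comp (mfderiv 𝓘(ℂ, Cn n) 𝓘(ℂ, Cn n) π y) := rfl

theorem isPositive_pullback (hπ : IsLocalDiffeomorph 𝓘(ℂ, Cn n) 𝓘(ℂ, Cn n) ω π)
    (hΩ : ∀ x, IsPositive (Ω.val x)) (y : Y) : IsPositive ((pullback π Ω).val y) := by
  rw [pullback_val]
  exact (hΩ (π y)).comp ((hπ y).mfderivToContinuousLinearEquiv (by simp))

theorem exists_diff_comp_le [CompactSpace X] [IsManifold 𝓘(ℂ, Cn n) ω X]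
    (hπ : IsLocalDiffeomorph 𝓘(ℂ, Cn n) 𝓘(ℂ, Cn n) ω π) (hΩ : IsMetric Ω)
    {f : X → ℝ} (hf : IsSmoothFun (n := n) f) : ∃ a : ℝ, 0 ≤ a ∧ ∀ y v,
      |diff (n := n) (f ∘ π) y v| ≤ a * Real.sqrt (riem ((pullback π Ω).val y) v v) := by
  obtain ⟨a, ha, h⟩ := hΩ.exists_diff_le hf isCompact_univ
  refine ⟨a, ha, fun y v => ?_⟩
  have h1 := h (π y) (Set.mem_univ _) (mfderiv 𝓘(ℂ, Cn n) 𝓘(ℂ, Cn n) π y v)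
  have h2 : riem ((pullback π Ω).val y) v v = _ :=
    riem_comp (n := n) (Ω.val (π y)) (mfderiv 𝓘(ℂ, Cn n) 𝓘(ℂ, Cn n) π y) v v
  rw [diff_comp hπ.contMDiff hf, h2]
  exact h1

variable [IsManifold 𝓘(ℂ, Cn n) ω Y] [T2Space Y] [SecondCountableTopology Y]
  [MeasurableSpace Y] [BorelSpace Y] {Ω' : Form n Y 2} {φ : Form n Y k} {α β : Form n Y 1}

/-- Here `f ∘ π` need not have compact support, but its restriction to one sheet does. The identity
holds sheet by sheet and is then summed, both integrands being integrable on the whole cover. -/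
theorem integral_comp_smul_formDensity [CompactSpace X] {ι : Type*} [TopologicalSpace ι]
    [DiscreteTopology ι] [Countable ι] (t : Bundle.Trivialization ι π)
    (hπ : ContMDiff 𝓘(ℂ, Cn n) 𝓘(ℂ, Cn n) ω π) (hΩ : IsMetric Ω') (hφ : IsL2 Ω' φ)
    (hp : IsPotential Ω' α β) (hαb : IsBounded Ω' α) (hβb : IsBounded Ω' β)
    (hdel : WeakDelZero φ) (hdelbar : WeakDelbarZero φ) {f : X → ℝ}
    (hf : IsSmoothFun (n := n) f) (hft : tsupport f ⊆ t.baseSet)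
    (hd : ∃ a : ℝ, 0 ≤ a ∧ ∀ y v,
      |diff (n := n) (f ∘ π) y v| ≤ a * Real.sqrt (riem (Ω'.val y) v v)) :
    ∫ y, f (π y) • formDensity Ω' Ω' φ y ∂(vol Ω') =
      -∫ y, formDensity Ω' (gradWedge α β (f ∘ π)) φ y ∂(vol Ω') := by
  have hfπ : IsSmoothFun (n := n) (f ∘ π) := hf.comp (contMDiff_restrictScalars hπ)
  have hfc : IsCompact (tsupport f) := (isClosed_tsupport f).isCompact
  set F := formDensity Ω' Ω' φ
  set G := formDensity Ω' (gradWedge α β (f ∘ π)) φ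
  have hF : Integrable (fun y => f (π y) • F y) (vol Ω') := by
    obtain ⟨C, hC⟩ := hfc.exists_bound_of_continuousOn hf.continuous.continuousOn
    refine integrable_smul_of_bounded (C := max C 0) (integrable_formDensity_self hΩ hφ)
      hfπ.continuous fun y => ?_
    by_cases hy : π y ∈ tsupport f
    · exact (hC _ hy).trans (le_max_left _ _)
    · rw [image_eq_zero_of_notMem_tsupport hy, norm_zero]
      exact le_max_right _ _
  have hG : Integrable G (vol Ω') :=
    integrable_formDensity_gradWedge hΩ hφ hp.1 hp.2.1 hαb hβb hfπ hd
  -- the sheets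
  let U : ι → Set Y := fun s => t.source ∩ t ⁻¹' (Prod.snd ⁻¹' {s})
  have hUo : ∀ s, IsOpen (U s) := fun s =>
    t.continuousOn_toFun.isOpen_inter_preimage t.open_source
      ((isOpen_discrete {s}).preimage continuous_snd)
  have hUm : ∀ s, MeasurableSet (U s) := fun s => (hUo s).measurableSet
  have hUd : Pairwise (Function.onFun Disjoint U) := by
    intro s s' hss
    refine Set.disjoint_left.mpr fun y hy hy' => hss ?_
    have h1 : (t y).2 = s := hy.2
    have h2 : (t y).2 = s' := hy'.2
    rw [← h1, h2]
  have hUu : ∀ y, y ∉ ⋃ s, U s → π y ∉ tsupport f := by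
    intro y hy h
    exact hy (Set.mem_iUnion.mpr ⟨(t y).2, t.mem_source.mpr (hft h), rfl⟩)
  have hsupp : ∀ y, π y ∉ tsupport f → y ∉ tsupport (f ∘ π) := by
    intro y hy h
    refine hy (closure_minimal (t := π ⁻¹' tsupport f) ?_ ?_ h)
    · intro z hz
      exact subset_tsupport f hz
    · exact (isClosed_tsupport f).preimage hπ.continuous
  have hG0 : ∀ (χ : Y → ℝ) (y : Y), y ∉ tsupport χ →
      formDensity Ω' (gradWedge α β χ) φ y = 0 := by
    intro χ y hy
    simp [formDensity, gradWedge_of_notMem_tsupport hy, density]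
  -- On the sheet `s` the support of the cut-off lies in the image of the compact set `tsupport f ×ˢ
  -- {s}` under the inverse trivialization.
  have key : ∀ s, ∫ y in U s, f (π y) • F y ∂(vol Ω') = -∫ y in U s, G y ∂(vol Ω') := by
    intro s
    set χ : Y → ℝ := (U s).indicator (f ∘ π) with hχ
    set K : Set Y := t.toOpenPartialHomeomorph.symm '' (tsupport f ×ˢ {s})
    have hsub : tsupport f ×ˢ {s} ⊆ t.target := by
      rw [t.target_eq]
      exact Set.prod_mono hft (Set.subset_univ _)
    have hKc : IsCompact K := (hfc.prod isCompact_singleton).image_of_continuousOn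
      (t.toOpenPartialHomeomorph.continuousOn_symm.mono hsub)
    have hKU : K ⊆ U s := by
      rintro _ ⟨p, hp, rfl⟩
      refine ⟨t.toOpenPartialHomeomorph.map_target (hsub hp), ?_⟩
      have h1 : t (t.toOpenPartialHomeomorph.symm p) = p :=
        t.toOpenPartialHomeomorph.right_inv (hsub hp)
      change (t (t.toOpenPartialHomeomorph.symm p)).2 = s
      rw [h1]
      exact hp.2
    have hχ0 : ∀ y, y ∉ K → χ y = 0 := by
      intro y hy
      by_cases hyU : y ∈ U s
      · rw [hχ, Set.indicator_of_mem hyU]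
        refine image_eq_zero_of_notMem_tsupport (f := f) fun h => hy ⟨t y, ⟨?_, hyU.2⟩, ?_⟩
        · rw [t.coe_fst hyU.1]
          exact h
        · exact t.toOpenPartialHomeomorph.left_inv hyU.1
      · rw [hχ, Set.indicator_of_notMem hyU]
    have hχK : tsupport χ ⊆ K :=
      closure_minimal (fun y hy => by_contra fun h => hy (hχ0 y h)) hKc.isClosed
    have hχc : HasCompactSupport χ := HasCompactSupport.of_support_subset_isCompact hKc
      ((subset_tsupport _).trans hχK)
    have hχU : ∀ y ∈ U s, χ =ᶠ[nhds y] f ∘ π := fun y hy => by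
      filter_upwards [(hUo s).mem_nhds hy] with z hz
      exact Set.indicator_of_mem hz _
    have hχs : IsSmoothFun (n := n) χ := by
      intro y
      by_cases hy : y ∈ U s
      · exact (hfπ y).congr_of_eventuallyEq (hχU y hy)
      · refine (contMDiffAt_const (c := (0 : ℝ))).congr_of_eventuallyEq ?_
        filter_upwards [hKc.isClosed.isOpen_compl.mem_nhds fun h => hy (hKU h)] with z hz
        exact hχ0 z hz
    have h := integral_smul_formDensity_of_hasCompactSupport hΩ hφ hp hαb hβb hdel hdelbar hχs hχc
    rw [← integral_indicator (hUm s), ← integral_indicator (hUm s)]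
    have e1 : (U s).indicator (fun y => f (π y) • F y) = fun y => χ y • F y := by
      funext y
      by_cases hy : y ∈ U s
      · rw [Set.indicator_of_mem hy, hχ, Set.indicator_of_mem hy]
        rfl
      · rw [Set.indicator_of_notMem hy, hχ, Set.indicator_of_notMem hy, zero_smul]
    have e2 : (U s).indicator G = formDensity Ω' (gradWedge α β χ) φ := by
      funext y
      by_cases hy : y ∈ U s
      · rw [Set.indicator_of_mem hy]
        simp only [G, formDensity, gradWedge_val, diff_congr (n := n) (hχU y hy)]
      · rw [Set.indicator_of_notMem hy, hG0 χ y fun h => hy (hKU (hχK h))]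
    rw [e1, e2]
    exact h
  -- Countable additivity over the disjoint sheets; off their union both integrands vanish.
  have s1 := hasSum_integral_iUnion hUm hUd hF.integrableOn
  have s2 := hasSum_integral_iUnion hUm hUd hG.integrableOn
  rw [setIntegral_eq_integral_of_forall_compl_eq_zero] at s1 s2
  · simp_rw [key] at s1
    exact s1.unique s2.neg
  · intro y hy
    exact hG0 _ y (hsupp y (hUu y hy))
  · intro y hy
    rw [image_eq_zero_of_notMem_tsupport (hUu y hy), zero_smul]

/-- A partition of unity on the image of `π`, subordinate to evenly covered sets, pulls back to
functions with sum one. The gradient terms of the individual identities therefore cancel. -/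
theorem integral_formDensity_self_eq_zero [T2Space X] [CompactSpace X]
    [IsManifold 𝓘(ℂ, Cn n) ω X] (hcov : IsCoveringMap π)
    (hπ : IsLocalDiffeomorph 𝓘(ℂ, Cn n) 𝓘(ℂ, Cn n) ω π) (hΩX : IsMetric Ω)
    (hp : IsPotential (pullback π Ω) α β) (hαb : IsBounded (pullback π Ω) α)
    (hβb : IsBounded (pullback π Ω) β) (hφ : IsL2 (pullback π Ω) φ)
    (hdel : WeakDelZero φ) (hdelbar : WeakDelbarZero φ) :
    ∫ y, formDensity (pullback π Ω) (pullback π Ω) φ y ∂(vol (pullback π Ω)) = 0 := by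
  have := isManifold_real (n := n) (M := X)
  -- Continuity of the pulled-back metric in charts is read off from `∂α + ∂̄β`.
  have hΩ : IsMetric (pullback π Ω) :=
    ⟨isPositive_pullback hπ hΩX.pos, fun e he => hp.continuousOn he⟩
  set Ω' := pullback π Ω
  have hdisc : ∀ x, DiscreteTopology (π ⁻¹' {x}) := fun x => (hcov x).1
  -- The fibres are discrete subspaces of a second countable space.
  have hcount : ∀ x, Countable (π ⁻¹' {x}) := fun x =>
    TopologicalSpace.separableSpace_iff_countable.mp inferInstance
  have hne : ∀ x : Set.range π, Nonempty (π ⁻¹' {x.1}) := fun x => let ⟨y, hy⟩ := x.2; ⟨⟨y, hy⟩⟩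
  -- Indexing by the range of `π` provides the nonempty fibres needed for each point to lie in its
  -- own base set.
  let t : ∀ x : Set.range π, Bundle.Trivialization (π ⁻¹' {x.1}) π := fun x =>
    (hcov x.1).toTrivialization
  obtain ⟨ρ, hρ⟩ := SmoothPartitionOfUnity.exists_isSubordinate 𝓘(ℝ, Cn n) (s := Set.range π)
    (isClosed_range_of_isCoveringMap hcov) (fun x => (t x).baseSet) (fun x => (t x).open_baseSet)
    (fun x hx => Set.mem_iUnion.mpr ⟨⟨x, hx⟩,
      @IsEvenlyCovered.mem_toTrivialization_baseSet _ _ _ _ _ _ _ _ (hne ⟨x, hx⟩) (hcov x)⟩)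
  have hfin := ρ.locallyFinite.finite_nonempty_inter_compact isCompact_univ
  set J := hfin.toFinset
  have hsum : ∀ y, ∑ i ∈ J, ρ i (π y) = 1 := by
    intro y
    have h1 := ρ.sum_eq_one (Set.mem_range_self (f := π) y)
    rw [finsum_eq_sum_of_support_subset (s := J)] at h1
    · exact h1
    · intro i hi
      simp only [J, Set.Finite.coe_toFinset, Set.mem_ofPred_eq]
      exact ⟨π y, hi, Set.mem_univ _⟩
  have hρs : ∀ i, IsSmoothFun (n := n) (ρ i) := fun i => (ρ i).contMDiff
  have hρπ : ∀ i, IsSmoothFun (n := n) (ρ i ∘ π) := fun i =>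
    (hρs i).comp (contMDiff_restrictScalars hπ.contMDiff)
  have hd := fun i => exists_diff_comp_le hπ hΩX (hρs i)
  have hF := integrable_formDensity_self hΩ hφ
  have hint : ∀ i, Integrable (formDensity Ω' (gradWedge α β (ρ i ∘ π)) φ) (vol Ω') := fun i =>
    integrable_formDensity_gradWedge hΩ hφ hp.1 hp.2.1 hαb hβb (hρπ i) (hd i)
  have hint' : ∀ i, Integrable (fun y => ρ i (π y) • formDensity Ω' Ω' φ y) (vol Ω') := fun i =>
    integrable_smul_of_bounded (C := 1) hF (hρπ i).continuous fun y => by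
      rw [Real.norm_of_nonneg (ρ.nonneg i _)]
      exact ρ.le_one i _
  have e1 : ∀ y, formDensity Ω' Ω' φ y = ∑ i ∈ J, ρ i (π y) • formDensity Ω' Ω' φ y := by
    intro y
    have h1 := Finset.sum_smul (s := J) (f := fun i => ρ i (π y)) (x := formDensity Ω' Ω' φ y)
    rw [← h1, hsum, one_smul]
  -- The gradient form is linear in the differential of the cut-off, and these differentials add up
  -- to that of the constant `1`.
  have e2 : ∀ y, ∑ i ∈ J, formDensity Ω' (gradWedge α β (ρ i ∘ π)) φ y = 0 := by
    intro y
    have h1 := (isSmoothFun_sum_and_diff_sum (n := n) J (fun i _ => hρπ i) y).2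
    have h0 : (fun y => ∑ i ∈ J, (ρ i ∘ π) y) = fun _ => (1 : ℝ) := funext hsum
    have h2 := (congrArg (fun g => diff (n := n) g y) h0).trans (diff_const 1 y)
    have h3 := h1.symm.trans h2
    have h4 : ∑ i ∈ J, (gradWedge α β (ρ i ∘ π)).val y = 0 := by
      simp only [gradWedge_val, Finset.sum_add_distrib, ← LinearMap.sum_apply, ← map_sum, h3,
        map_zero, LinearMap.zero_apply, add_zero]
    simp only [formDensity, density]
    rw [← Finset.sum_div, ← sum_apply, ← sum_apply, ← map_sum, h4]
    simp
  have hmain := fun i => integral_comp_smul_formDensity (t i) hπ.contMDiff hΩ hφ hp hαb hβb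
    hdel hdelbar (hρs i) (hρ i) (hd i)
  rw [integral_congr_ae (Filter.Eventually.of_forall e1), integral_finsetSum _ fun i _ => hint' i, Finset.sum_congr rfl fun i _ => hmain i,
    Finset.sum_neg_distrib, ← integral_finsetSum _ fun i _ => hint i]
  simp_rw [e2]
  simp

end Covering

end SKT

/-! ### The vanishing theorem -/

open SKT in
theorem theorem3p16 {n p q : ℕ} (hpq : p + q + 1 = n)
    {X : Type*} [TopologicalSpace X] [T2Space X] [CompactSpace X] [ConnectedSpace X]
    [ChartedSpace (SKT.Cn n) X] [IsManifold 𝓘(ℂ, SKT.Cn n) ω X]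
    {Y : Type*} [TopologicalSpace Y] [T2Space Y] [SecondCountableTopology Y]
    [ChartedSpace (SKT.Cn n) Y] [IsManifold 𝓘(ℂ, SKT.Cn n) ω Y]
    [MeasurableSpace Y] [BorelSpace Y]
    (π : Y → X) (hπ : SKT.IsUniversalCover (n := n) π)
    (Ω : SKT.Form n X 2) (hΩ : SKT.IsSKTHyperbolicMetric π Ω)
    (φ : SKT.Form n Y (p + q)) (hL2 : SKT.IsL2 (SKT.pullback π Ω) φ)
    (hbideg : ∀ᵐ y ∂(SKT.vol (SKT.pullback π Ω)), SKT.IsBidegree p q (φ y).toAlternatingMap)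
    (hprim : ∀ᵐ y ∂(SKT.vol (SKT.pullback π Ω)),
      SKT.IsPrimitive n (SKT.pullback π Ω y).toAlternatingMap (φ y).toAlternatingMap)
    (hdel : SKT.WeakDelZero φ) (hdelbar : SKT.WeakDelbarZero φ) :
    ∀ᵐ y ∂(SKT.vol (SKT.pullback π Ω)), φ y = 0 := by
  obtain ⟨α, β, hα, hβ, hαb, hβb, hpot⟩ := hΩ.tildeBounded
  have hΩX : IsMetric Ω := hΩ.toIsSKTMetric.toIsHermitianMetric.isMetric
  have hp : IsPotential (pullback π Ω) α β := ⟨hα, hβ, hpot⟩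
  have hpos := isPositive_pullback hπ.isLocalBiholomorphism hΩX.pos
  have hΩY : IsMetric (pullback π Ω) := ⟨hpos, fun e he => hp.continuousOn he⟩
  set Ω' := pullback π Ω
  have h0 := integral_formDensity_self_eq_zero hπ.isCoveringMap hπ.isLocalBiholomorphism hΩX hp
    hαb hβb hL2 hdel hdelbar
  have hF := integrable_formDensity_self hΩY hL2
  have hs := hrSign_ne_zero p q
  have hR : ∀ᵐ y ∂(vol Ω'), ∃ R : ℝ, 0 ≤ R ∧ formDensity Ω' Ω' φ y = hrSign p q * R ∧
      (R = 0 → φ y = 0) := by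
    filter_upwards [hbideg, hprim] with y hb hpr
    exact (hpos y).hodge_riemann hpq (φ.val y) hb hpr
  -- The Hodge–Riemann relation provides its nonnegative number only point by point. Dividing out
  -- the constant and taking real parts gives an integrable function that agrees with it almost
  -- everywhere.
  set r : Y → ℝ := fun y => ((hrSign p q)⁻¹ * formDensity Ω' Ω' φ y).re
  have hreq : ∀ y (R : ℝ), formDensity Ω' Ω' φ y = hrSign p q * R → r y = R := by
    intro y R h
    simp only [r]
    rw [h, inv_mul_cancel_left₀ hs, Complex.ofReal_re]
  have hri : Integrable r (vol Ω') := (hF.const_mul _).re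
  have hr0 : ∫ y, r y ∂(vol Ω') = 0 := by
    have h1 : ∫ y, r y ∂(vol Ω') = (∫ y, (hrSign p q)⁻¹ * formDensity Ω' Ω' φ y ∂(vol Ω')).re :=
      integral_re (hF.const_mul _)
    rw [h1, integral_const_mul, h0, mul_zero, Complex.zero_re]
  have hnn : 0 ≤ᵐ[vol Ω'] r := by
    filter_upwards [hR] with y ⟨R, hR0, hRe, _⟩
    rw [hreq y R hRe]
    exact hR0
  have hz := (integral_eq_zero_iff_of_nonneg_ae hnn hri).mp hr0
  filter_upwards [hR, hz] with y ⟨R, _, hRe, hφ⟩ hy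
  exact hφ ((hreq y R hRe).symm.trans hy)

end
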